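/- Let $ABC$ be a nondegenerate triangle in $\mathbb R^3$ with side lengths $s_{ij}$ and vertices $X_1=A$, $X_2=B$, $X_3=C$. The \emph{danger cylinder} is the right circular cylinder over the circumcircle of $ABC$. Its \emph{Morley generatrices} $L_1,L_2,L_3$ are the generatrices through those points of the circumcircle whose radius vector from the circumcenter is a positive multiple of $M_i-\tfrac12(M_j+M_k)$, $\{i,j,k\}=\{1,2,3\}$, where $M_1M_2M_3$ is the first Morley triangle of $ABC$ ($M_i$ is the intersection of the two interior angle trisectors adjacent to the side opposite $X_i$); these vectors lie along the altitudes of the equilateral triangle $M_1M_2M_3$. For a point $O$, a \emph{distance triple} of $O$ is $e=(e_1,e_2,e_3)\in\mathbb C^3$ with $e_i^2=|OX_i|^2$ for $i=1,2,3$. For $e\in(\mathbb C\setminus\{0\})^3$, a \emph{complementary solution} associated with $e$ is $e'\in(\mathbb C\setminus\{0\})^3$ with $e'\ne\pm e$ such that $e$ and $e'$ solve the same P3P system $e_i^2+e_j^2-2c_{ij}e_ie_j=s_{ij}^2$ $(i<j)$, i.e. $$\frac{e_i^2+e_j^2-s_{ij}^2}{e_ie_j}=\frac{e_i'^2+e_j'^2-s_{ij}^2}{e_i'e_j'},\qquad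 i<j .$$ The \emph{deltoidal surface} $S\subset\mathbb C^3$ is the Zariski closure of the set of all complementary solutions associated with distance triples of points of the danger cylinder outside the plane $ABC$. For $i=1,2,3$, the \emph{cuspidal curve} $\Gamma_i\subset\mathbb C^3$ is the Zariski closure of the set of all complementary solutions associated with distance triples of points of $L_i$ outside the plane $ABC$. The \emph{singular locus} of $S$ is the set of points of $S$ at which all first partial derivatives of all polynomials vanishing on $S$ are zero. \textbf{Theorem.} For each $i\in\{1,2,3\}$, the curve $\Gamma_i$ is contained in the singular locus of $S$. If $O\in L_i$ is not on the circumcircle of $ABC$, then every complementary solution $e'$ associated with a distance triple of $O$ lies on $\Gamma_i$ and is a singular point of $S$ of cuspidal type: there is a nonzero linear form $\ell$ such that the quadratic part at $e'$ of every polynomial vanishing on $S$ is a scalar multiple of $\ell^2$. In particular, if a camera center $O'\in\mathbb R^3$ has a distance triple that is complementary to a distance triple of $O$, then $(|O'A|,|O'B|,|O'C|)$ lies on $\Gamma_i$ and is a singular point of $S$ of cuspidal type. -/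

import Mathlib

namespace P3P

/-- Space of the control points and of the camera centre. -/
abbrev Space : Type := EuclideanSpace ℝ (Fin 3)

/-- A (nondegenerate) control triangle with vertices `T.points 0`, `T.points 1`, `T.points 2`. -/
abbrev ControlTriangle : Type := Affine.Triangle ℝ Space

/-- The plane of the control triangle. -/
def plane (T : ControlTriangle) : Set Space :=
  (affineSpan ℝ (Set.range T.points) : Set Space)

/-- The foot of the perpendicular from `O` to the plane of the control triangle. -/
noncomputable def foot (T : ControlTriangle) (O : Space) : Space :=
  (T.orthogonalProjectionSpan O : Space)

/-- The danger cylinder: the right circular cylinder over the circumcircle of the triangle. -/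
def dangerCylinder (T : ControlTriangle) : Set Space :=
  {O | dist (foot T O) T.circumcenter = T.circumradius}

/-- `M` is the first Morley triangle of `T`: the vertex `M i` is the intersection of the two
inner angle trisectors adjacent to the side of `T` opposite to the vertex `i`. At each end `j` of
that side (with `k` the other end), the ray from `j` through `M i` makes one third of the angle of
the triangle with the side `jk` and two thirds of it with the side `ji`. -/
def IsFirstMorleyTriangle (T : ControlTriangle) (M : Fin 3 → Space) : Prop :=
  ∀ i j k : Fin 3, i ≠ j → j ≠ k → i ≠ k →
    EuclideanGeometry.angle (M i) (T.points j) (T.points k) =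
        EuclideanGeometry.angle (T.points i) (T.points j) (T.points k) / 3 ∧
      EuclideanGeometry.angle (M i) (T.points j) (T.points i) =
        2 * EuclideanGeometry.angle (T.points i) (T.points j) (T.points k) / 3

/-- The three Morley generatrices of the danger cylinder. The `i`-th one is perpendicular to the
plane of the triangle and meets it in the end point of the radius of the circumcircle that is
parallel to, and points in the same direction as, the altitude of the first Morley triangle drawn
from the foot towards the vertex `M i` (the Morley triangle is equilateral, so the foot of this
altitude is the midpoint of the opposite side). -/
def morleyGeneratrix (T : ControlTriangle) (i : Fin 3) : Set Space :=
  {O | O ∈ dangerCylinder T ∧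
    ∃ M : Fin 3 → Space, IsFirstMorleyTriangle T M ∧
      ∃ r : ℝ, 0 < r ∧
        foot T O - T.circumcenter = r • (M i - midpoint ℝ (M (i + 1)) (M (i + 2)))}

/-- `e` consists of distances from `O` to the three control points, each up to sign. -/
def IsDistanceTriple (T : ControlTriangle) (O : Space) (e : Fin 3 → ℂ) : Prop :=
  ∀ i, e i ^ 2 = ((dist O (T.points i) : ℝ) : ℂ) ^ 2

/-- `e` solves the P3P equations `eᵢ² + eⱼ² - 2 cᵢⱼ eᵢ eⱼ = sᵢⱼ²` with cosines `c`, where `sᵢⱼ`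
are the side lengths of the control triangle. -/
def IsP3PSolution (T : ControlTriangle) (c : Fin 3 → Fin 3 → ℂ) (e : Fin 3 → ℂ) : Prop :=
  ∀ i j, i ≠ j →
    e i ^ 2 + e j ^ 2 - 2 * c i j * (e i * e j) =
      ((dist (T.points i) (T.points j) : ℝ) : ℂ) ^ 2

/-- `e'` is a complementary solution associated with `e`: both have nonzero entries (so that the
cosines are determined), both solve one and the same P3P system, and they differ by more than the
central symmetry `e ↦ -e` of that system. -/
def IsComplementary (T : ControlTriangle) (e e' : Fin 3 → ℂ) : Prop :=
  (∀ i, e i ≠ 0) ∧ (∀ i, e' i ≠ 0) ∧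
    (∃ c : Fin 3 → Fin 3 → ℂ, IsP3PSolution T c e ∧ IsP3PSolution T c e') ∧
    e' ≠ e ∧ e' ≠ -e

/-- All solutions complementary to camera centres in `S` that are not in the plane of the
triangle. On the danger cylinder, the centres in that plane are those on the circumcircle, for
which the P3P system has infinitely many solutions. -/
def complementarySolutions (T : ControlTriangle) (S : Set Space) : Set (Fin 3 → ℂ) :=
  {e' | ∃ O ∈ S, O ∉ plane T ∧ ∃ e, IsDistanceTriple T O e ∧ IsComplementary T e e'}

/-- The Zariski closure in affine three-space over the complex numbers. -/
def zariskiClosure (S : Set (Fin 3 → ℂ)) : Set (Fin 3 → ℂ) :=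
  MvPolynomial.zeroLocus ℂ (MvPolynomial.vanishingIdeal ℂ S)

/-- The deltoidal surface, in the coordinates `(e'₁, e'₂, e'₃)`: the Zariski closure of all
solutions complementary to camera centres on the danger cylinder. -/
def deltoidalSurface (T : ControlTriangle) : Set (Fin 3 → ℂ) :=
  zariskiClosure (complementarySolutions T (dangerCylinder T))

/-- The singular locus of an algebraic surface `V` in affine three-space: the points of `V` at
which all first partial derivatives of all equations of `V` vanish. If the ideal of `V` is
generated by `C`, this is the zero set of `C` and its three partial derivatives. -/
def singularLocus (V : Set (Fin 3 → ℂ)) : Set (Fin 3 → ℂ) :=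
  {p | p ∈ V ∧ ∀ g ∈ MvPolynomial.vanishingIdeal ℂ V,
    ∀ i, MvPolynomial.eval p (MvPolynomial.pderiv i g) = 0}

/-- `p` is a singular point of cuspidal type of the surface `V`: a singular point with a double
tangent plane, i.e. at `p` the quadratic part of every equation of `V` is a multiple of the square
of one fixed nonzero linear form `l`. This holds along cuspidal edges, such as that of `y² = x³`,
and fails along curves where two sheets of the surface cross transversally. -/
def IsCuspidalPoint (V : Set (Fin 3 → ℂ)) (p : Fin 3 → ℂ) : Prop :=
  p ∈ singularLocus V ∧
    ∃ l : Fin 3 → ℂ, l ≠ 0 ∧ ∀ g ∈ MvPolynomial.vanishingIdeal ℂ V,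
      ∃ a : ℂ, ∀ i j,
        MvPolynomial.eval p (MvPolynomial.pderiv i (MvPolynomial.pderiv j g)) = a * (l i * l j)

/-- The `i`-th cuspidal curve: the Zariski closure of all solutions complementary to camera
centres on the `i`-th Morley generatrix. -/
def cuspidalCurve (T : ControlTriangle) (i : Fin 3) : Set (Fin 3 → ℂ) :=
  zariskiClosure (complementarySolutions T (morleyGeneratrix T i))

end P3P

/-! Divide a solution `e'` of the P3P system by the known solution `e`: the ratio `r` satisfies `b r
r = b 1 1`, where `b` is the vector of the three polar forms (`polarForm`). No nonzero vector is
isotropic for `b`, because the Gram determinant of the three rays is nonzero off the plane of the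
triangle. So, up to sign, the solutions are the base points of a pencil of conics, four with
multiplicity, and the known solution is the base point `1`.

On the danger cylinder `b 1` has a kernel, spanned by the vector `lam` of cotangents of the
inscribed angles, so `1` is a multiple base point. On a Morley generatrix the inscribed angles add
up to `π / 2` modulo `2π`. This makes `lam` tangent to the cylinder (`lam_mul_q`), and `1` has
multiplicity at least three (`polarForm_lam_lam_add`). A complementary solution `r` is then a simple
base point (`form_injective`), and its existence excludes multiplicity four, whence `B ≠ 0` and the
cosines move to first order along the generatrix. Simplicity means that the map `Psi` from solutions
to cosines is locally invertible at `r`, so curves of cosines lift to curves of complementary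
solutions.

Two curves of camera centres are lifted. The generatrix gives a curve with tangent `x`. The curve on
the cylinder that starts in the direction `lam` gives `r + t² u + t³ v + o(t³)`, since the cosines
are stationary there. Pairing the jets of the cosines with the conormal of their image (`n₀`, `n₁`)
shows that `x`, `u`, `v` are independent; the decisive number is `sum_n₁_mul_gam''`, nonzero because
`B ≠ 0`.

Let `f` vanish on the surface. Along these curves its gradient kills `x`, `u`, `v`, so it is zero.
As the gradient vanishes all along the lifted generatrix, the Hessian kills `x`; the coefficients of
`t⁴` and `t⁵` along the cusp give `Hess (u, u) = Hess (u, v) = 0`. Hence the Hessian is a multiple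
of the square of the coordinate along `v`. Passing to Zariski closures gives the inclusion of the
cuspidal curve. The link with Morley's triangle is `morley_altitude`, which computes the direction
of its altitude. -/

namespace P3P

/-! ### Pencils of conics -/

section Pencil

variable {b : (Fin 3 → ℂ) →ₗ[ℂ] (Fin 3 → ℂ) →ₗ[ℂ] (Fin 3 → ℂ)}

/-- If a quadratic map with values on the line through `b e e` has no isotropic vectors, then it
lives on the line through `e`. -/
lemma exists_eq_smul_of_anisotropic (hsym : ∀ v w, b v w = b w v)
    (haniso : ∀ v, b v v = 0 → v = 0) {e v : Fin 3 → ℂ} {β η : ℂ}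
    (h1 : b e v = β • b e e) (h2 : b v v = η • b e e) : ∃ x : ℂ, v = x • e := by
  -- `b (s e + v) (s e + v)` is `s² + 2 β s + η` times `b e e`; the root `s = -β + z` makes the
  -- vector isotropic.
  obtain ⟨z, hz⟩ := IsAlgClosed.exists_pow_nat_eq (β ^ 2 - η) (n := 2) (by norm_num)
  have h := haniso ((-β + z) • e + v) (by
    simp only [map_add, map_smul, LinearMap.add_apply, LinearMap.smul_apply, hsym v e, h1, h2,
      smul_smul, ← add_smul]
    rw [show (-β + z) * (-β + z + β) + ((-β + z) * β + η) = 0 by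
      linear_combination hz, zero_smul])
  refine ⟨-(-β + z), ?_⟩
  rw [neg_smul]
  exact (neg_eq_of_add_eq_zero_right h).symm

/-- Otherwise `exists_eq_smul_of_anisotropic` with `β = 0` makes `d` a multiple of `e`, and `b e d =
0` makes `e` isotropic. -/
lemma not_mem_line_of_kernel (hsym : ∀ v w, b v w = b w v)
    (haniso : ∀ v, b v v = 0 → v = 0) {e d : Fin 3 → ℂ} (he : e ≠ 0) (hd : d ≠ 0)
    (hed : b e d = 0) (η : ℂ) : b d d ≠ η • b e e := by
  intro h
  obtain ⟨x, rfl⟩ := exists_eq_smul_of_anisotropic hsym haniso (e := e) (v := d) (β := 0)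
    (by simpa using hed) h
  rw [map_smul, smul_eq_zero] at hed
  rcases hed with rfl | hed
  · simp at hd
  · exact he (haniso e hed)

/-- A base point of a pencil of conics, a tangent vector there, and a further base point span. -/
lemma exists_combination (hsym : ∀ v w, b v w = b w v)
    (haniso : ∀ v, b v v = 0 → v = 0) {e d r : Fin 3 → ℂ} (he : e ≠ 0) (hd : d ≠ 0)
    (hed : b e d = 0) (hr : b r r = b e e) (h1 : r ≠ e) (h2 : r ≠ -e) (v : Fin 3 → ℂ) :
    ∃ x y z : ℂ, v = x • e + y • d + z • r := by
  have hs : b e e ≠ 0 := fun h => he (haniso e h)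
  -- If `r = x e + y d`, then `b e e = b r r = x² b e e + y² b d d`. For `y ≠ 0` this puts `b d d`
  -- on the line through `b e e`; for `y = 0` it gives `r = ± e`.
  have key : ∀ x y : ℂ, r ≠ x • e + y • d := by
    intro x y h
    have hrr : (x ^ 2) • b e e + (y ^ 2) • b d d = b e e := by
      have h' := hr
      rw [h] at h'
      simpa only [map_add, map_smul, LinearMap.add_apply, LinearMap.smul_apply, hsym d e, hed,
        smul_smul, smul_zero, add_zero, zero_add, pow_two] using h'
    by_cases hy : y = 0
    · subst hy
      have : (x ^ 2 - 1) • b e e = 0 := by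
        rw [sub_smul, one_smul, sub_eq_zero]; simpa using hrr
      rcases smul_eq_zero.1 this with hx | hx
      · have : (x - 1) * (x + 1) = 0 := by linear_combination hx
        rcases mul_eq_zero.1 this with hx | hx
        · exact h1 (by rw [h, sub_eq_zero.1 hx]; simp)
        · exact h2 (by rw [h, eq_neg_of_add_eq_zero_left hx]; simp)
      · exact hs hx
    · refine not_mem_line_of_kernel hsym haniso he hd hed ((1 - x ^ 2) / y ^ 2) ?_
      have : (y ^ 2) • b d d = (1 - x ^ 2) • b e e := by
        rw [sub_smul, one_smul, eq_sub_iff_add_eq, add_comm]; exact hrr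
      rw [div_eq_inv_mul, mul_smul, ← this, smul_smul, inv_mul_cancel₀ (pow_ne_zero 2 hy), one_smul]
  have key2 : ∀ x : ℂ, d ≠ x • e := by
    rintro x rfl
    rw [map_smul, smul_eq_zero] at hed
    rcases hed with rfl | hed
    · simp at hd
    · exact hs hed
  have hli : LinearIndependent ℂ ![e, d, r] := by
    rw [Fintype.linearIndependent_iff]
    intro g hg
    simp only [Fin.sum_univ_three, Matrix.cons_val_zero, Matrix.cons_val_one,
      Matrix.cons_val_two, Matrix.head_cons, Matrix.tail_cons] at hg
    have h2 : g 2 = 0 := by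
      by_contra h
      refine key (-(g 2)⁻¹ * g 0) (-(g 2)⁻¹ * g 1) ?_
      have : (-(g 2)⁻¹) • (g 0 • e + g 1 • d) = r := by
        rw [eq_neg_of_add_eq_zero_left hg, smul_neg, smul_smul, neg_mul, inv_mul_cancel₀ h]
        simp
      rw [← this, smul_add, smul_smul, smul_smul]
    rw [h2, zero_smul, add_zero] at hg
    have h1 : g 1 = 0 := by
      by_contra h
      refine key2 (-(g 1)⁻¹ * g 0) ?_
      rw [mul_smul, eq_neg_of_add_eq_zero_left hg, smul_neg, smul_smul, neg_mul, inv_mul_cancel₀ h]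
      simp
    rw [h1, zero_smul, add_zero, smul_eq_zero] at hg
    have h0 := hg.resolve_right he
    intro i
    fin_cases i <;> assumption
  have hsp := hli.span_eq_top_of_card_eq_finrank (by simp)
  have hv : v ∈ Submodule.span ℂ (Set.range ![e, d, r]) := by rw [hsp]; trivial
  obtain ⟨c, hc⟩ := (Submodule.mem_span_range_iff_exists_fun ℂ).1 hv
  exact ⟨c 0, c 1, c 2, by rw [← hc, Fin.sum_univ_three]; rfl⟩

/-- Used with `b e e` and `b e r`: then `f` is a conic of the pencil containing the whole line
through the base points `e` and `r`. -/
lemma exists_functional (s t : Fin 3 → ℂ) :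
    ∃ f : (Fin 3 → ℂ) →ₗ[ℂ] ℂ, f ≠ 0 ∧ f s = 0 ∧ f t = 0 := by
  have hlt : Module.finrank ℂ (Submodule.span ℂ (Set.range ![s, t])) <
      Module.finrank ℂ (Fin 3 → ℂ) := by
    refine lt_of_le_of_lt (finrank_range_le_card ![s, t]) (by simp)
  obtain ⟨f, hf, hle⟩ := Submodule.exists_le_ker_of_lt_top (Submodule.span ℂ (Set.range ![s, t]))
    (lt_of_le_of_ne le_top fun h => by rw [h, finrank_top] at hlt; exact lt_irrefl _ hlt)
  exact ⟨f, hf, hle (Submodule.subset_span ⟨0, rfl⟩), hle (Submodule.subset_span ⟨1, rfl⟩)⟩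

/-- In the presence of a base point `e` of multiplicity three, with second order curve
`e + τ d + τ² p / 2`, and another base point `r`, the mixed value `b d r` has an independent
direction. -/
lemma not_all_functionals_vanish (hsym : ∀ v w, b v w = b w v)
    (haniso : ∀ v, b v v = 0 → v = 0)
    (hnd : ∀ f : (Fin 3 → ℂ) →ₗ[ℂ] ℂ, (∀ v, f (b v v) = 0) → f = 0)
    {e d p r : Fin 3 → ℂ} (he : e ≠ 0) (hd : d ≠ 0)
    (hed : b e d = 0) (hdp : b d d + b e p = 0)
    (hr : b r r = b e e) (h1 : r ≠ e) (h2 : r ≠ -e) {f : (Fin 3 → ℂ) →ₗ[ℂ] ℂ} (hf : f ≠ 0)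
    (hfs : f (b e e) = 0) (hft : f (b e r) = 0) : f (b d r) ≠ 0 := by
  intro hdr
  have hcomb := exists_combination hsym haniso he hd hed hr h1 h2
  obtain ⟨x, y, z, hp⟩ := hcomb p
  -- Multiplicity three enters here: `b d d = -b e p`, and `p` is a combination of `e`, `d`, `r`.
  -- With `b d r` also killed, `f` would vanish on every value of the form.
  have hdd : f (b d d) = 0 := by
    rw [eq_neg_of_add_eq_zero_left hdp, hp]
    simp [hed, hfs, hft]
  refine hf (hnd f fun v => ?_)
  obtain ⟨x, y, z, hp⟩ := hcomb v
  rw [hp]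
  simp [hsym d e, hsym r e, hsym r d, hed, hfs, hft, hdd, hdr, hr]

/-- If a pencil of conics has a base point of multiplicity three, then every other base point is
simple. -/
lemma kernel_eq_zero_of_triple (hsym : ∀ v w, b v w = b w v)
    (haniso : ∀ v, b v v = 0 → v = 0)
    (hnd : ∀ f : (Fin 3 → ℂ) →ₗ[ℂ] ℂ, (∀ v, f (b v v) = 0) → f = 0)
    {e d p r : Fin 3 → ℂ} (he : e ≠ 0) (hd : d ≠ 0)
    (hed : b e d = 0) (hdp : b d d + b e p = 0)
    (hr : b r r = b e e) (h1 : r ≠ e) (h2 : r ≠ -e) {v : Fin 3 → ℂ} (hv : b r v = 0) :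
    v = 0 := by
  obtain ⟨x, y, z, rfl⟩ := exists_combination hsym haniso he hd hed hr h1 h2 v
  obtain ⟨f, hf, hfs, hft⟩ := exists_functional (b e e) (b e r)
  have hdr := not_all_functionals_vanish hsym haniso hnd he hd hed hdp hr h1 h2 hf hfs hft
  have hs : b e e ≠ 0 := fun h => he (haniso e h)
  have hy : y = 0 := by
    have := congrArg f hv
    simpa [hsym r e, hsym r d, hr, hfs, hft, hdr] using this
  subst hy
  -- Otherwise `b e r` lies on the line through `b e e`, so `r` is a multiple of `e`, and `b r r = b
  -- e e` leaves only `± e`.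
  have hx : x = 0 := by
    by_contra hx
    have hre : b e r = (-(x⁻¹ * z)) • b e e := by
      have : x • b e r + z • b e e = 0 := by simpa [hsym r e, hr] using hv
      rw [neg_smul, mul_smul, ← smul_neg, ← eq_neg_of_add_eq_zero_left this, smul_smul,
        inv_mul_cancel₀ hx, one_smul]
    obtain ⟨w, hw⟩ := exists_eq_smul_of_anisotropic hsym haniso hre (η := 1) (by simpa using hr)
    have : (w ^ 2 - 1) • b e e = 0 := by
      have h' := hr
      rw [hw] at h'
      rw [sub_smul, one_smul, sub_eq_zero]
      simpa [smul_smul, pow_two] using h'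
    have : (w - 1) * (w + 1) = 0 := by
      linear_combination (smul_eq_zero.1 this).resolve_right hs
    rcases mul_eq_zero.1 this with hx | hx
    · exact h1 (by rw [hw, sub_eq_zero.1 hx]; simp)
    · exact h2 (by rw [hw, eq_neg_of_add_eq_zero_left hx]; simp)
  subst hx
  have hz : z • b e e = 0 := by simpa [hr] using hv
  rw [(smul_eq_zero.1 hz).resolve_right hs]
  simp

/-- A pencil of conics with a base point of multiplicity four has no other base point. -/
lemma false_of_quadruple (hsym : ∀ v w, b v w = b w v)
    (haniso : ∀ v, b v v = 0 → v = 0)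
    (hnd : ∀ f : (Fin 3 → ℂ) →ₗ[ℂ] ℂ, (∀ v, f (b v v) = 0) → f = 0)
    {e d p u r : Fin 3 → ℂ} (he : e ≠ 0) (hd : d ≠ 0)
    (hed : b e d = 0) (hdp : b d d + b e p = 0) (hdu : b d p + b e u = 0)
    (hr : b r r = b e e) (h1 : r ≠ e) (h2 : r ≠ -e) : False := by
  have hcomb := exists_combination hsym haniso he hd hed hr h1 h2
  obtain ⟨f, hf, hfs, hft⟩ := exists_functional (b e e) (b e r)
  have hdr := not_all_functionals_vanish hsym haniso hnd he hd hed hdp hr h1 h2 hf hfs hft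
  obtain ⟨x, y, z, hp⟩ := hcomb p
  obtain ⟨x', y', z', hu⟩ := hcomb u
  have hdd : f (b d d) = 0 := by
    rw [eq_neg_of_add_eq_zero_left hdp, hp]
    simp [hed, hfs, hft]
  -- Applied to the third-order condition, `f` leaves only `z * f (b d r)`. So `p` lies in the span
  -- of `e` and `d`, and `b d d = -b e p` falls on the line through `b e e`.
  have hz : z = 0 := by
    have := congrArg f hdu
    rw [hp, hu] at this
    simpa [hsym d e, hed, hfs, hft, hdd, hdr] using this
  refine not_mem_line_of_kernel hsym haniso he hd hed (-x) ?_
  rw [eq_neg_of_add_eq_zero_left hdp, hp, hz]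
  simp [hed]

end Pencil
end P3P

namespace P3P

/-! ### The pencil of a P3P system -/

/-- The vector of polar forms of the three P3P equations, in coordinates relative to one solution:
`q` are the squared distances of that solution and `g` the inner products of its rays. The
component `l` belongs to the pair `l + 1`, `l + 2`. -/
def polarForm {K : Type*} [Field K] (q g : Fin 3 → K) :
    (Fin 3 → K) →ₗ[K] (Fin 3 → K) →ₗ[K] (Fin 3 → K) :=
  LinearMap.mk₂ K (fun v w l => q (l + 1) * (v (l + 1) * w (l + 1)) +
      q (l + 2) * (v (l + 2) * w (l + 2)) - g l * (v (l + 1) * w (l + 2) + v (l + 2) * w (l + 1)))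
    (fun _ _ _ => by ext l; simp only [Pi.add_apply]; ring)
    (fun _ _ _ => by ext l; simp only [Pi.smul_apply, smul_eq_mul]; ring)
    (fun _ _ _ => by ext l; simp only [Pi.add_apply]; ring)
    (fun _ _ _ => by ext l; simp only [Pi.smul_apply, smul_eq_mul]; ring)

section PolarForm

variable {K : Type*} [Field K]

lemma polarForm_apply (q g v w : Fin 3 → K) (l : Fin 3) :
    polarForm q g v w l = q (l + 1) * (v (l + 1) * w (l + 1)) +
      q (l + 2) * (v (l + 2) * w (l + 2)) - g l * (v (l + 1) * w (l + 2) + v (l + 2) * w (l + 1)) :=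
  rfl

lemma polarForm_comm (q g v w : Fin 3 → K) : polarForm q g v w = polarForm q g w v := by
  ext l
  simp only [polarForm_apply]
  ring

lemma polarForm_ofReal (q g v w : Fin 3 → ℝ) :
    polarForm (fun i => (q i : ℂ)) (fun i => (g i : ℂ)) (fun i => (v i : ℂ)) (fun i => (w i : ℂ)) =
      fun l => ((polarForm q g v w l : ℝ) : ℂ) := by
  ext l
  simp only [polarForm_apply]
  push_cast
  ring

/-- If all `v i` are nonzero, the equations determine `g`. With `A, B, C` for `q i * v i ^ 2`, the
Gram determinant times `4 (v 0 v 1 v 2)²` becomes `4ABC + (B+C)(C+A)(A+B) - A(B+C)² - B(C+A)² -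
C(A+B)² = 0`. If one `v i` is zero, the equations force the others to vanish. -/
lemma polarForm_anisotropic {q g : Fin 3 → K} (hK : (2 : K) ≠ 0) (hq : ∀ i, q i ≠ 0)
    (hdet : q 0 * q 1 * q 2 + 2 * g 0 * g 1 * g 2 - q 0 * g 0 ^ 2 - q 1 * g 1 ^ 2 - q 2 * g 2 ^ 2
      ≠ 0) {v : Fin 3 → K} (hv : polarForm q g v v = 0) : v = 0 := by
  have e0 : q 1 * (v 1 * v 1) + q 2 * (v 2 * v 2) - g 0 * (v 1 * v 2 + v 2 * v 1) = 0 :=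
    congrFun hv 0
  have e1 : q 2 * (v 2 * v 2) + q 0 * (v 0 * v 0) - g 1 * (v 2 * v 0 + v 0 * v 2) = 0 :=
    congrFun hv 1
  have e2 : q 0 * (v 0 * v 0) + q 1 * (v 1 * v 1) - g 2 * (v 0 * v 1 + v 1 * v 0) = 0 :=
    congrFun hv 2
  have hprod : v 0 * v 1 * v 2 = 0 := by
    by_contra h
    refine hdet (mul_left_cancel₀ (mul_ne_zero (mul_ne_zero hK hK) (pow_ne_zero 2 h)) ?_)
    have f0 : 2 * g 0 * (v 1 * v 2) = q 1 * v 1 ^ 2 + q 2 * v 2 ^ 2 := by linear_combination -e0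
    have f1 : 2 * g 1 * (v 2 * v 0) = q 2 * v 2 ^ 2 + q 0 * v 0 ^ 2 := by linear_combination -e1
    have f2 : 2 * g 2 * (v 0 * v 1) = q 0 * v 0 ^ 2 + q 1 * v 1 ^ 2 := by linear_combination -e2
    calc 2 * 2 * (v 0 * v 1 * v 2) ^ 2 * (q 0 * q 1 * q 2 + 2 * g 0 * g 1 * g 2 - q 0 * g 0 ^ 2 -
          q 1 * g 1 ^ 2 - q 2 * g 2 ^ 2)
        = 4 * (q 0 * v 0 ^ 2) * (q 1 * v 1 ^ 2) * (q 2 * v 2 ^ 2) +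
          (2 * g 0 * (v 1 * v 2)) * (2 * g 1 * (v 2 * v 0)) * (2 * g 2 * (v 0 * v 1)) -
          q 0 * v 0 ^ 2 * (2 * g 0 * (v 1 * v 2)) ^ 2 -
          q 1 * v 1 ^ 2 * (2 * g 1 * (v 2 * v 0)) ^ 2 -
          q 2 * v 2 ^ 2 * (2 * g 2 * (v 0 * v 1)) ^ 2 := by ring
      _ = 2 * 2 * (v 0 * v 1 * v 2) ^ 2 * 0 := by rw [f0, f1, f2]; ring
  have hz : ∀ {i j : Fin 3} {c : K}, q i * (v i * v i) + q j * (v j * v j) -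
      c * (v i * v j + v j * v i) = 0 → v i = 0 → v j = 0 := by
    intro i j c h hi
    rw [hi] at h
    simpa [hq j] using h
  have hz' : ∀ {i j : Fin 3} {c : K}, q i * (v i * v i) + q j * (v j * v j) -
      c * (v i * v j + v j * v i) = 0 → v j = 0 → v i = 0 := by
    intro i j c h hi
    rw [hi] at h
    simpa [hq i] using h
  have h0 : v 0 = 0 := by
    rcases mul_eq_zero.1 hprod with h | h
    · rcases mul_eq_zero.1 h with h | h
      · exact h
      · exact hz' e2 h
    · exact hz e1 h
  have h1 := hz e2 h0
  have h2 := hz e0 h1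
  ext i
  fin_cases i <;> assumption

/-- The coordinate vectors show that any two of the three coefficients of `f` have sum zero. -/
lemma polarForm_nondegenerate {q g : Fin 3 → K} (hK : (2 : K) ≠ 0) (hq : ∀ i, q i ≠ 0)
    (f : (Fin 3 → K) →ₗ[K] K) (h : ∀ v, f (polarForm q g v v) = 0) : f = 0 := by
  have hdec : ∀ w : Fin 3 → K, f w = w 0 * f (Pi.single 0 1) + w 1 * f (Pi.single 1 1) +
      w 2 * f (Pi.single 2 1) := by
    intro w
    rw [LinearMap.pi_apply_eq_sum_univ f w, Fin.sum_univ_three]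
    simp [eq_comm, ← Pi.single_apply]
  have h0 := h (Pi.single 0 1)
  have h1 := h (Pi.single 1 1)
  have h2 := h (Pi.single 2 1)
  have hs : ∀ i l, polarForm q g (Pi.single i 1) (Pi.single i 1) l = if l = i then 0 else q i := by
    intro i l
    fin_cases i <;> fin_cases l <;> simp [polarForm_apply]
  rw [hdec] at h0 h1 h2
  rw [hs, hs, hs] at h0 h1 h2
  simp at h0 h1 h2
  rw [← mul_add] at h0 h1 h2
  replace h0 := (mul_eq_zero.1 h0).resolve_left (hq 0)
  replace h1 := (mul_eq_zero.1 h1).resolve_left (hq 1)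
  replace h2 := (mul_eq_zero.1 h2).resolve_left (hq 2)
  have F0 : f (Pi.single 0 1) = 0 := by
    refine (mul_eq_zero.1 ?_).resolve_left hK
    linear_combination h1 + h2 - h0
  have F1 : f (Pi.single 1 1) = 0 := by linear_combination h2 - F0
  have F2 : f (Pi.single 2 1) = 0 := by linear_combination h1 - F0
  refine LinearMap.ext fun w => ?_
  rw [hdec, F0, F1, F2]
  simp

end PolarForm

/-! ### Configurations over a Morley generatrix -/

/-- The shape of a control triangle inscribed in a circle of squared diameter `k`, and a camera
centre at height `√H` above a point of the circle: `σ i` is the inscribed angle over the chord from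
that point to the `i`-th vertex. The last two conditions place the centre on a Morley generatrix. -/
structure MorleyConfig where
  σ : Fin 3 → ℝ
  k : ℝ
  H : ℝ
  k_pos : 0 < k
  H_pos : 0 < H
  sin_sub_ne_zero : ∀ l, Real.sin (σ (l + 1) - σ (l + 2)) ≠ 0
  cos_sum : Real.cos (σ 0 + σ 1 + σ 2) = 0
  sin_sum : Real.sin (σ 0 + σ 1 + σ 2) = 1

namespace MorleyConfig

open Real

variable (M : MorleyConfig)

noncomputable def x (i : Fin 3) : ℝ := sin (M.σ i)
noncomputable def y (i : Fin 3) : ℝ := cos (M.σ i)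
noncomputable def X : ℝ := M.x 0 * M.x 1 * M.x 2
noncomputable def Y : ℝ := M.y 0 * M.y 1 * M.y 2
/-- Squared distances to the control points. -/
noncomputable def q (i : Fin 3) : ℝ := M.H + M.k * M.x i ^ 2
-- By the inscribed angle theorem `k * D l ^ 2` is the squared side between the vertices `l + 1` and
-- `l + 2`.
noncomputable def D (l : Fin 3) : ℝ := sin (M.σ (l + 1) - M.σ (l + 2))
/-- Inner products of the rays to the control points. -/
noncomputable def g (l : Fin 3) : ℝ := (M.q (l + 1) + M.q (l + 2) - M.k * M.D l ^ 2) / 2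
/-- The relative motion of the distances that keeps the cosines constant to first order. -/
noncomputable def lam (i : Fin 3) : ℝ := M.Y - M.x i * M.y i
-- The speed of the inscribed angle along the curve on the cylinder in direction `lam`; the squared
-- height moves at speed `2 * k * Y * H` (see `height`).
noncomputable def B : ℝ := M.k * M.X - M.H
-- Chosen so that `1 + τ lam + τ² rho / 2` solves the system to second order. The summand `lam ^ 2`
-- cancels one part of the polar form at `(lam, lam)`; the other summand cancels the rest, which is
-- `-B * (D l * x l) ^ 2`.
noncomputable def rho (i : Fin 3) : ℝ := M.lam i ^ 2 + M.B / M.k * (M.y i ^ 2 - M.X)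

lemma X_eq (l : Fin 3) : M.X = M.x l * M.x (l + 1) * M.x (l + 2) := by
  fin_cases l <;> simp [X] <;> ring

lemma Y_eq (l : Fin 3) : M.Y = M.y l * M.y (l + 1) * M.y (l + 2) := by
  fin_cases l <;> simp [Y] <;> ring

lemma sum_eq (l : Fin 3) : M.σ 0 + M.σ 1 + M.σ 2 = M.σ l + M.σ (l + 1) + M.σ (l + 2) := by
  fin_cases l <;> simp <;> ring

lemma circle (i : Fin 3) : M.x i ^ 2 + M.y i ^ 2 = 1 := sin_sq_add_cos_sq _

/-- The Morley condition on the sum of the angles is used directly only here and in `y_eq`;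
everything else follows from these two relations. -/
lemma x_eq (l : Fin 3) : M.x l = M.y (l + 1) * M.y (l + 2) - M.x (l + 1) * M.x (l + 2) := by
  have h : M.σ (l + 1) + M.σ (l + 2) = (M.σ 0 + M.σ 1 + M.σ 2) - M.σ l := by
    rw [M.sum_eq l]; ring
  simp only [x, y]
  rw [← cos_add, h, cos_sub, M.cos_sum, M.sin_sum]
  ring

lemma y_eq (l : Fin 3) : M.y l = M.y (l + 1) * M.x (l + 2) + M.x (l + 1) * M.y (l + 2) := by
  have h : M.σ (l + 1) + M.σ (l + 2) = (M.σ 0 + M.σ 1 + M.σ 2) - M.σ l := by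
    rw [M.sum_eq l]; ring
  have : sin (M.σ (l + 1) + M.σ (l + 2)) = M.y l := by
    rw [h, sin_sub, M.cos_sum, M.sin_sum]; simp [y]
  rw [← this, sin_add]
  simp only [x, y]
  ring

lemma D_eq (l : Fin 3) : M.D l = M.x (l + 1) * M.y (l + 2) - M.x (l + 2) * M.y (l + 1) := by
  simp only [D, x, y, sin_sub]; ring

lemma D_ne_zero (l : Fin 3) : M.D l ≠ 0 := M.sin_sub_ne_zero l

lemma q_pos (i : Fin 3) : 0 < M.q i :=
  add_pos_of_pos_of_nonneg M.H_pos (mul_nonneg M.k_pos.le (sq_nonneg _))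

/-- The kernel direction is tangent to the danger cylinder: after multiplication by `2 * k`, the
right side is the rate of change of the squared distance when the squared height grows at rate `2 *
k * Y * H` and the inscribed angle at rate `B`. -/
lemma lam_mul_q (i : Fin 3) : M.lam i * M.q i = M.Y * M.H + M.B * (M.x i * M.y i) := by
  have h1 := M.circle i
  have h2 := M.X_eq i
  have h3 := M.Y_eq i
  have h4 := M.x_eq i
  have h5 := M.y_eq i
  simp only [lam, q, B]
  generalize M.x i = a, M.y i = b, M.x (i + 1) = a1, M.y (i + 1) = b1, M.x (i + 2) = a2,
    M.y (i + 2) = b2 at *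
  generalize M.X = X, M.Y = Y at *
  subst h2 h3
  grind

lemma x_mul_y_sub (l : Fin 3) :
    M.x (l + 1) * M.y (l + 1) - M.x (l + 2) * M.y (l + 2) = M.D l * M.x l := by
  have h1 := M.circle (l + 1)
  have h2 := M.circle (l + 2)
  rw [D_eq, M.x_eq l]
  grind

lemma polarForm_one (v : Fin 3 → ℝ) (l : Fin 3) :
    polarForm M.q M.g 1 v l = M.k * M.D l *
      (M.x (l + 1) * M.y (l + 2) * v (l + 1) - M.x (l + 2) * M.y (l + 1) * v (l + 2)) := by
  have h1 := M.circle (l + 1)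
  have h2 := M.circle (l + 2)
  simp only [polarForm_apply, g, q, Pi.one_apply, D_eq]
  grind

lemma polarForm_one_one (l : Fin 3) : polarForm M.q M.g 1 1 l = M.k * M.D l ^ 2 := by
  rw [polarForm_one, D_eq]
  simp only [Pi.one_apply]
  ring

/-- In this form `lam` is `X` times the cotangent of `σ` wherever the sine is nonzero, which makes
the kernel equation of `polarForm_one` evident. -/
lemma lam_eq (l : Fin 3) : M.lam l = M.y l * M.x (l + 1) * M.x (l + 2) := by
  rw [lam, M.Y_eq l]
  linear_combination (-M.y l) * M.x_eq l

lemma lam_eq' (l : Fin 3) : M.lam (l + 1) = M.y (l + 1) * M.x (l + 2) * M.x l := by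
  rw [lam_eq]
  fin_cases l <;> simp

lemma lam_eq'' (l : Fin 3) : M.lam (l + 2) = M.y (l + 2) * M.x l * M.x (l + 1) := by
  rw [lam_eq]
  fin_cases l <;> simp

lemma polarForm_one_lam : polarForm M.q M.g 1 M.lam = 0 := by
  ext l
  rw [polarForm_one, lam_eq', lam_eq'']
  simp only [Pi.zero_apply]
  ring

lemma lam_sub (l : Fin 3) : M.lam (l + 1) - M.lam (l + 2) = -(M.D l * M.x l) := by
  rw [← x_mul_y_sub, lam, lam]; ring

/-- The motion along the kernel extends to second order. -/
lemma polarForm_lam_lam_add : polarForm M.q M.g M.lam M.lam + polarForm M.q M.g 1 M.rho = 0 := by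
  ext l
  have hk := M.k_pos.ne'
  have h0 : M.k * M.D l * (M.x (l + 1) * M.y (l + 2) * M.lam (l + 1) -
      M.x (l + 2) * M.y (l + 1) * M.lam (l + 2)) = 0 := by
    rw [← polarForm_one, polarForm_one_lam]; rfl
  have ha : M.g l = M.q (l + 1) - M.k * M.D l * (M.x (l + 1) * M.y (l + 2)) := by
    have := M.circle (l + 1)
    have := M.circle (l + 2)
    simp only [g, q, D_eq]
    grind
  have hb : M.g l = M.q (l + 2) + M.k * M.D l * (M.x (l + 2) * M.y (l + 1)) := by
    have := M.circle (l + 1)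
    have := M.circle (l + 2)
    simp only [g, q, D_eq]
    grind
  have h1 := M.lam_mul_q (l + 1)
  have h2 := M.lam_mul_q (l + 2)
  have h3 := M.lam_sub l
  have h4 := M.x_mul_y_sub l
  have h5 := M.D_eq l
  have h6 := M.X_eq l
  have h7 := M.x_eq l
  rw [Pi.add_apply, polarForm_one, polarForm_apply]
  simp only [rho, Pi.zero_apply]
  have hq : M.lam (l + 1) * M.q (l + 1) - M.lam (l + 2) * M.q (l + 2) =
      M.B * (M.D l * M.x l) := by rw [h1, h2, ← h4]; ring
  have hm : (M.D l * M.x l) * (M.D l * M.x l) = M.D l *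
      (M.x (l + 1) * M.y (l + 2) * (M.y (l + 1) ^ 2 - M.X) -
        M.x (l + 2) * M.y (l + 1) * (M.y (l + 2) ^ 2 - M.X)) := by
    linear_combination (M.D l * M.D l * M.x l) * h7 + M.D l * M.D l * h6 +
      (M.D l * M.y (l + 1) * M.y (l + 2)) * (-h4) - M.D l * M.X * h5
  -- The last bracket is what the summand `lam ^ 2` of `rho` contributes; the first product equals
  -- `-B * (D l * x l) ^ 2`.
  have hsplit : M.q (l + 1) * (M.lam (l + 1) * M.lam (l + 1)) +
      M.q (l + 2) * (M.lam (l + 2) * M.lam (l + 2)) -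
      M.g l * (M.lam (l + 1) * M.lam (l + 2) + M.lam (l + 2) * M.lam (l + 1)) =
      (M.lam (l + 1) - M.lam (l + 2)) *
        (M.lam (l + 1) * M.q (l + 1) - M.lam (l + 2) * M.q (l + 2)) -
      M.k * M.D l * (M.x (l + 1) * M.y (l + 2) * M.lam (l + 1) ^ 2 -
        M.x (l + 2) * M.y (l + 1) * M.lam (l + 2) ^ 2) := by
    linear_combination (-(M.lam (l + 1) * M.lam (l + 2))) * (ha + hb) +
      (M.lam (l + 1) + M.lam (l + 2)) * h0
  rw [hsplit, hq, h3]
  have : M.k * M.D l * (M.x (l + 1) * M.y (l + 2) * (M.B / M.k * (M.y (l + 1) ^ 2 - M.X)) -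
      M.x (l + 2) * M.y (l + 1) * (M.B / M.k * (M.y (l + 2) ^ 2 - M.X))) =
      M.B * ((M.D l * M.x l) * (M.D l * M.x l)) := by
    rw [hm]; field_simp
  linear_combination this

/-- Since the `D l` are nonzero, no two sines vanish together, so `lam = 0` forces all sines to be
nonzero. Then all cosines vanish, and so does `D 0`. -/
lemma lam_ne_zero : M.lam ≠ 0 := by
  intro h
  have e : ∀ l, M.y l * M.x (l + 1) * M.x (l + 2) = 0 := fun l => by
    rw [← lam_eq, h]; rfl
  have hx : ∀ l, M.x l ≠ 0 := by
    intro l hl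
    have h1 : M.y l ≠ 0 := by
      intro h; have := M.circle l; rw [hl, h] at this; norm_num at this
    have h12 : M.x (l + 1) ≠ 0 := by
      intro h
      have := M.D_ne_zero (l + 2)
      apply this
      rw [D_eq, show l + 2 + 1 = l by fin_cases l <;> rfl,
        show l + 2 + 2 = l + 1 by fin_cases l <;> rfl, hl, h]
      ring
    have h13 : M.x (l + 2) ≠ 0 := by
      intro h
      have := M.D_ne_zero (l + 1)
      apply this
      rw [D_eq, show l + 1 + 1 = l + 2 by fin_cases l <;> rfl,
        show l + 1 + 2 = l by fin_cases l <;> rfl, hl, h]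
      ring
    exact mul_ne_zero (mul_ne_zero h1 h12) h13 (e l)
  have hy : ∀ l, M.y l = 0 := fun l => by simpa [hx] using e l
  apply M.D_ne_zero 0
  rw [D_eq, hy, hy]; ring

lemma Y_ne_zero (hB : M.B = 0) : M.Y ≠ 0 := by
  intro hY
  refine M.lam_ne_zero (funext fun i => ?_)
  have := M.lam_mul_q i
  rw [hB, hY] at this
  simpa [(M.q_pos i).ne'] using this

/-- The Gram determinant is `H` times the square of twice the area of the triangle, that is `H * k²
* (D 0 * D 1 * D 2)²`. -/
lemma gram_ne_zero : M.q 0 * M.q 1 * M.q 2 + 2 * M.g 0 * M.g 1 * M.g 2 - M.q 0 * M.g 0 ^ 2 -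
    M.q 1 * M.g 1 ^ 2 - M.q 2 * M.g 2 ^ 2 ≠ 0 := by
  -- Multiplying by `x² + y² = 1` exhibits `q` and `g` as inner products of the vectors `(√H, √k x
  -- (x, y))`; the determinant of these vectors is, up to `√H k`, the left side of `hD`.
  have hq : ∀ i, M.q i = M.H + M.k * M.x i ^ 2 * (M.x i ^ 2 + M.y i ^ 2) := fun i => by
    rw [circle, q]; ring
  have hg : ∀ l, M.g l = M.H + M.k * M.x (l + 1) * M.x (l + 2) *
      (M.x (l + 1) * M.x (l + 2) + M.y (l + 1) * M.y (l + 2)) := fun l => by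
    have := M.circle (l + 1)
    have := M.circle (l + 2)
    simp only [g, q, D_eq]
    grind
  have hD : M.x 0 * M.x 1 * (M.x 0 * M.y 1 - M.x 1 * M.y 0) +
      M.x 1 * M.x 2 * (M.x 1 * M.y 2 - M.x 2 * M.y 1) +
      M.x 2 * M.x 0 * (M.x 2 * M.y 0 - M.x 0 * M.y 2) = -(M.D 0 * M.D 1 * M.D 2) := by
    have := M.circle 0
    have := M.circle 1
    have := M.circle 2
    have h0 : M.D 0 = M.x 1 * M.y 2 - M.x 2 * M.y 1 := M.D_eq 0
    have h1 : M.D 1 = M.x 2 * M.y 0 - M.x 0 * M.y 2 := M.D_eq 1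
    have h2 : M.D 2 = M.x 0 * M.y 1 - M.x 1 * M.y 0 := M.D_eq 2
    rw [h0, h1, h2]
    grind
  have hg0 : M.g 0 = _ := hg 0
  have hg1 : M.g 1 = _ := hg 1
  have hg2 : M.g 2 = _ := hg 2
  simp only [Fin.isValue, zero_add, Fin.reduceAdd] at hg0 hg1 hg2
  rw [hg0, hg1, hg2, hq 0, hq 1, hq 2]
  have : M.H * M.k ^ 2 * (M.D 0 * M.D 1 * M.D 2) ^ 2 ≠ 0 :=
    mul_ne_zero (mul_ne_zero M.H_pos.ne' (pow_ne_zero 2 M.k_pos.ne'))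
      (pow_ne_zero 2 (mul_ne_zero (mul_ne_zero (M.D_ne_zero 0) (M.D_ne_zero 1)) (M.D_ne_zero 2)))
  rw [← neg_sq (M.D 0 * M.D 1 * M.D 2), ← hD] at this
  convert this using 1
  ring

/-- The complexified polar form. -/
noncomputable def form : (Fin 3 → ℂ) →ₗ[ℂ] (Fin 3 → ℂ) →ₗ[ℂ] (Fin 3 → ℂ) :=
  polarForm (fun i => (M.q i : ℂ)) (fun i => (M.g i : ℂ))

lemma form_comm (v w : Fin 3 → ℂ) : M.form v w = M.form w v := polarForm_comm _ _ _ _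

lemma form_anisotropic (v : Fin 3 → ℂ) (hv : M.form v v = 0) : v = 0 :=
  polarForm_anisotropic two_ne_zero (fun i => by exact_mod_cast (M.q_pos i).ne')
    (by exact_mod_cast M.gram_ne_zero) hv

lemma form_nondegenerate (f : (Fin 3 → ℂ) →ₗ[ℂ] ℂ) (h : ∀ v, f (M.form v v) = 0) : f = 0 :=
  polarForm_nondegenerate two_ne_zero (fun i => by exact_mod_cast (M.q_pos i).ne') f h

lemma form_ofReal (v w : Fin 3 → ℝ) : M.form (fun i => (v i : ℂ)) (fun i => (w i : ℂ)) =
    fun l => ((polarForm M.q M.g v w l : ℝ) : ℂ) := polarForm_ofReal _ _ _ _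

lemma one_eq_ofReal : (1 : Fin 3 → ℂ) = fun i => (((1 : Fin 3 → ℝ) i : ℝ) : ℂ) := by
  ext; simp

lemma form_one_one (l : Fin 3) : M.form 1 1 l = ((M.k * M.D l ^ 2 : ℝ) : ℂ) := by
  rw [one_eq_ofReal, form_ofReal]
  simp only [polarForm_one_one]

/-- A further base point of the pencil is simple. -/
lemma form_injective {r : Fin 3 → ℂ} (hr : M.form r r = M.form 1 1) (h1 : r ≠ 1) (h2 : r ≠ -1)
    {v : Fin 3 → ℂ} (hv : M.form r v = 0) : v = 0 := by
  refine kernel_eq_zero_of_triple M.form_comm M.form_anisotropic M.form_nondegenerate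
    (e := 1) (d := fun i => (M.lam i : ℂ)) (p := fun i => (M.rho i : ℂ)) one_ne_zero ?_ ?_ ?_
    hr h1 h2 hv
  · intro h
    exact M.lam_ne_zero (funext fun i => by simpa using congrFun h i)
  · rw [one_eq_ofReal, form_ofReal, polarForm_one_lam]
    ext; simp
  · rw [one_eq_ofReal, form_ofReal, form_ofReal]
    ext l
    have := congrFun M.polarForm_lam_lam_add l
    simp only [Pi.add_apply, Pi.zero_apply] at this ⊢
    exact_mod_cast this

/-- If moving the centre along the generatrix preserves the cosines to first order, then the base
point has multiplicity four. -/
lemma exists_polarForm_inv_ne_zero {r : Fin 3 → ℂ} (hr : M.form r r = M.form 1 1) (h1 : r ≠ 1)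
    (h2 : r ≠ -1) : polarForm M.q M.g 1 (fun i => (M.q i)⁻¹) ≠ 0 := by
  intro h
  -- With `a`, `b` the inverses of the two `q`'s in row `l`, the assumption reads `g l * (a + b) =
  -- 2`. This alone yields the next two orders, with the powers of `1 / q` as coefficients.
  refine false_of_quadruple M.form_comm M.form_anisotropic M.form_nondegenerate
    (e := 1) (d := fun i => (((M.q i)⁻¹ : ℝ) : ℂ)) (p := fun i => (((M.q i)⁻¹ ^ 2 : ℝ) : ℂ))
    (u := fun i => (((M.q i)⁻¹ ^ 3 : ℝ) : ℂ)) (r := r) one_ne_zero ?_ ?_ ?_ ?_ hr h1 h2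
  · intro h
    have := congrFun h 0
    simp only [Pi.zero_apply, Complex.ofReal_eq_zero, inv_eq_zero] at this
    exact (M.q_pos 0).ne' this
  · rw [one_eq_ofReal, form_ofReal, h]
    ext; simp
  all_goals
    rw [one_eq_ofReal, form_ofReal, form_ofReal]
    ext l
    have h' := congrFun h l
    simp only [Pi.add_apply, Pi.zero_apply, polarForm_apply, Pi.one_apply, one_mul] at h' ⊢
    have hA := mul_inv_cancel₀ (M.q_pos (l + 1)).ne'
    have hB := mul_inv_cancel₀ (M.q_pos (l + 2)).ne'
    norm_cast
    generalize (M.q (l + 1))⁻¹ = a at *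
    generalize (M.q (l + 2))⁻¹ = b at *
    generalize M.q (l + 1) = q1, M.q (l + 2) = q2, M.g l = g at *
    grind

/-- For `B = 0` the relation `lam_mul_q` makes `lam` proportional to `1 / q`: the kernel points
along the generatrix, and the base point `1` would have multiplicity four. -/
lemma B_ne_zero {r : Fin 3 → ℂ} (hr : M.form r r = M.form 1 1) (h1 : r ≠ 1) (h2 : r ≠ -1) :
    M.B ≠ 0 := by
  intro hB
  refine M.exists_polarForm_inv_ne_zero hr h1 h2 ?_
  have hY := M.Y_ne_zero hB
  have : (fun i => (M.q i)⁻¹) = (M.Y * M.H)⁻¹ • M.lam := by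
    ext i
    have hq := (M.q_pos i).ne'
    have := M.lam_mul_q i
    rw [hB, zero_mul, add_zero] at this
    have h0 : M.Y * M.H ≠ 0 := mul_ne_zero hY M.H_pos.ne'
    rw [Pi.smul_apply, smul_eq_mul, inv_mul_eq_div, eq_div_iff h0, inv_mul_eq_div, ← this,
      mul_div_cancel_right₀ _ hq]
  rw [this, map_smul, polarForm_one_lam, smul_zero]

end MorleyConfig
end P3P

namespace P3P

open Filter Topology Asymptotics

/-! ### Jets of the cosines along curves on the danger cylinder -/

/-- Mean value inequality on the ball of radius `|t|`, where `h'` is bounded by `c * |t| ^ n`. -/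
lemma isLittleO_pow_succ_of_hasDerivAt {h h' : ℝ → ℝ} {n : ℕ}
    (hd : ∀ᶠ t in 𝓝 0, HasDerivAt h (h' t) t) (h0 : h 0 = 0)
    (ho : h' =o[𝓝 0] fun t => t ^ n) : h =o[𝓝 0] fun t => t ^ (n + 1) := by
  rw [isLittleO_iff] at ho ⊢
  intro c hc
  obtain ⟨ε, hε, hball⟩ := Metric.eventually_nhds_iff.1 (hd.and (ho hc))
  refine Metric.eventually_nhds_iff.2 ⟨ε, hε, fun t ht => ?_⟩
  have hmem : ∀ s ∈ Metric.closedBall (0 : ℝ) |t|, dist s 0 < ε := fun s hs =>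
    lt_of_le_of_lt (Metric.mem_closedBall.1 hs) (by simpa using ht)
  have := (convex_closedBall (0 : ℝ) |t|).norm_image_sub_le_of_norm_hasDerivWithin_le
    (f := h) (f' := h') (C := c * |t| ^ n) (x := 0) (y := t)
    (fun s hs => (hball (hmem s hs)).1.hasDerivWithinAt)
    (fun s hs => ?_) (by simp) (by simp)
  · rw [h0, sub_zero, sub_zero] at this
    rw [norm_pow, pow_succ, ← mul_assoc]
    simpa using this
  · refine ((hball (hmem s hs)).2).trans ?_
    rw [norm_pow]
    refine mul_le_mul_of_nonneg_left (pow_le_pow_left₀ (norm_nonneg _) ?_ n) hc.le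
    simpa using hs

lemma eq_zero_of_isLittleO {E : Type*} [NormedAddCommGroup E] [NormedSpace ℝ E] {c : E} {n : ℕ}
    (h : (fun t : ℝ => t ^ n • c) =o[𝓝 0] fun t => t ^ n) : c = 0 := by
  by_contra hc
  have h1 : (fun t : ℝ => t ^ n) =O[𝓝 0] fun t => t ^ n • c :=
    IsBigO.of_bound ‖c‖⁻¹ (Eventually.of_forall fun t => by
      rw [norm_smul, mul_comm, mul_assoc, mul_inv_cancel₀ (norm_ne_zero_iff.2 hc), mul_one])
  refine isLittleO_irrefl ?_ (h1.trans_isLittleO h)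
  have h2 : ∃ᶠ t : ℝ in 𝓝[≠] 0, t ^ n ≠ 0 := by
    refine Eventually.frequently ?_
    filter_upwards [self_mem_nhdsWithin] with t ht using pow_ne_zero n ht
  exact h2.filter_mono nhdsWithin_le_nhds

/-- Second order expansion of a function and third order expansion of its primitive. -/
lemma exists_jet {f F : ℝ → ℝ} {a : ℝ} (hf : ∀ᶠ t in 𝓝 0, HasDerivAt f (F t) t)
    (hF : ContDiffAt ℝ 2 F 0) (hF0 : F 0 = 0) (ha : HasDerivAt F a 0) :
    ∃ b : ℝ, (fun t => F t - (a * t + b * t ^ 2)) =o[𝓝 0] (fun t => t ^ 2) ∧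
      (fun t => f t - (f 0 + t ^ 2 * (a / 2) + t ^ 3 * (b / 3))) =o[𝓝 0] fun t => t ^ 3 := by
  have hd1 : ∀ᶠ t in 𝓝 0, HasDerivAt F (deriv F t) t := by
    filter_upwards [hF.eventually (by simp)] with t ht
    exact (ht.differentiableAt (by norm_num)).hasDerivAt
  have hd2 : DifferentiableAt ℝ (deriv F) 0 := by
    have : ContDiffAt ℝ 1 (deriv F) 0 := hF.derivWithin (by norm_num)
    exact this.differentiableAt (by norm_num)
  obtain ⟨d, hd⟩ : ∃ d, HasDerivAt (deriv F) d 0 := ⟨_, hd2.hasDerivAt⟩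
  have h1 : (fun t => F t - (a * t + d / 2 * t ^ 2)) =o[𝓝 0] (fun t => t ^ (1 + 1)) := by
    refine isLittleO_pow_succ_of_hasDerivAt (h' := fun t => deriv F t - (a + d * t)) ?_
      (by simp [hF0]) ?_
    · filter_upwards [hd1] with t ht
      refine (ht.sub (((hasDerivAt_id t).const_mul a).add
        (((hasDerivAt_id t).pow 2).const_mul (d / 2)))).congr_deriv ?_
      simp
      ring
    · have := hd.isLittleO
      rw [ha.deriv] at this
      refine this.congr (fun t => ?_) (fun t => by simp)
      simp
      ring
  refine ⟨d / 2, by simpa using h1, ?_⟩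
  refine isLittleO_pow_succ_of_hasDerivAt (n := 2)
    (h' := fun t => F t - (a * t + d / 2 * t ^ 2)) ?_ (by simp) (by simpa using h1)
  filter_upwards [hf] with t ht
  refine (ht.sub ((((hasDerivAt_id t).pow 2).mul_const (a / 2)).const_add (f 0) |>.add
        (((hasDerivAt_id t).pow 3).mul_const (d / 2 / 3)))).congr_deriv ?_
  simp
  ring

/-- Grouped so that `dᵢ / pᵢ` is multiplied by the inner product of a ray and the side, which
`qAt_sub` factors on the cylinder. -/
lemma hasDerivAt_cosine {p₁ p₂ : ℝ → ℝ} {d₁ d₂ c₁ c₂ s t : ℝ} (h₁ : HasDerivAt p₁ d₁ t)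
    (h₂ : HasDerivAt p₂ d₂ t) (hp₁ : 0 < p₁ t) (hp₂ : 0 < p₂ t) (hc₁ : 0 < c₁) (hc₂ : 0 < c₂) :
    HasDerivAt (fun t => (p₁ t + p₂ t - s) / (2 * (√(p₁ t / c₁) * √(p₂ t / c₂))))
      ((d₁ * ((p₁ t - p₂ t + s) / 2) / p₁ t + d₂ * ((p₂ t - p₁ t + s) / 2) / p₂ t) /
        (2 * (√(p₁ t / c₁) * √(p₂ t / c₂)))) t := by
  have e₁ := (h₁.div_const c₁).sqrt (div_pos hp₁ hc₁).ne'
  have e₂ := (h₂.div_const c₂).sqrt (div_pos hp₂ hc₂).ne'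
  have s₁ : 0 < √(p₁ t / c₁) := Real.sqrt_pos.2 (div_pos hp₁ hc₁)
  have s₂ : 0 < √(p₂ t / c₂) := Real.sqrt_pos.2 (div_pos hp₂ hc₂)
  refine (((h₁.add h₂).sub_const s).div ((e₁.mul e₂).const_mul 2)
    (mul_pos two_pos (mul_pos s₁ s₂)).ne').congr_deriv ?_
  have q₁ : p₁ t = c₁ * √(p₁ t / c₁) ^ 2 := by
    rw [Real.sq_sqrt (div_pos hp₁ hc₁).le]; field_simp
  have q₂ : p₂ t = c₂ * √(p₂ t / c₂) ^ 2 := by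
    rw [Real.sq_sqrt (div_pos hp₂ hc₂).le]; field_simp
  simp only [Pi.add_apply, Pi.mul_apply]
  generalize √(p₁ t / c₁) = u at *
  generalize √(p₂ t / c₂) = v at *
  rw [q₁, q₂]
  field_simp
  ring

/-! ### Cosines along the generatrix and along the curve tangent to the kernel, and their conormal.
-/

namespace MorleyConfig

open Real

variable (M : MorleyConfig)

/-- Squared distances after turning by the inscribed angle `t` and changing the squared height. -/
noncomputable def qAt (t H : ℝ) (i : Fin 3) : ℝ := H + M.k * sin (M.σ i + t) ^ 2

/-- The ratios of the distances to the initial ones. -/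
noncomputable def eta (t H : ℝ) (i : Fin 3) : ℝ := √(M.qAt t H i / M.q i)

/-- Multiples of the cosines, the initial values being the inner products of the rays. -/
noncomputable def gam (t H : ℝ) (l : Fin 3) : ℝ :=
  (M.qAt t H (l + 1) + M.qAt t H (l + 2) - M.k * M.D l ^ 2) /
    (2 * (M.eta t H (l + 1) * M.eta t H (l + 2)))

lemma qAt_pos (t : ℝ) {H : ℝ} (hH : 0 < H) (i : Fin 3) : 0 < M.qAt t H i :=
  add_pos_of_pos_of_nonneg hH (mul_nonneg M.k_pos.le (sq_nonneg _))

lemma qAt_zero (i : Fin 3) : M.qAt 0 M.H i = M.q i := by simp [qAt, q, x]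

lemma eta_pos (t : ℝ) {H : ℝ} (hH : 0 < H) (i : Fin 3) : 0 < M.eta t H i :=
  Real.sqrt_pos.2 (div_pos (M.qAt_pos t hH i) (M.q_pos i))

lemma eta_sq (t : ℝ) {H : ℝ} (hH : 0 < H) (i : Fin 3) :
    M.eta t H i ^ 2 * M.q i = M.qAt t H i := by
  rw [eta, Real.sq_sqrt (div_pos (M.qAt_pos t hH i) (M.q_pos i)).le,
    div_mul_cancel₀ _ (M.q_pos i).ne']

lemma eta_zero (i : Fin 3) : M.eta 0 M.H i = 1 := by
  rw [eta, qAt_zero, div_self (M.q_pos i).ne', sqrt_one]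

lemma gam_zero (l : Fin 3) : M.gam 0 M.H l = M.g l := by
  rw [gam, eta_zero, eta_zero, qAt_zero, qAt_zero, g, mul_one, mul_one]

lemma qAt_sub (t H : ℝ) (l : Fin 3) :
    (M.qAt t H (l + 1) - M.qAt t H (l + 2) + M.k * M.D l ^ 2) / 2 =
      M.k * M.D l * (sin (M.σ (l + 1) + t) * cos (M.σ (l + 2) + t)) ∧
    (M.qAt t H (l + 2) - M.qAt t H (l + 1) + M.k * M.D l ^ 2) / 2 =
      -(M.k * M.D l * (sin (M.σ (l + 2) + t) * cos (M.σ (l + 1) + t))) := by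
  have hD : M.D l = sin (M.σ (l + 1) + t) * cos (M.σ (l + 2) + t) -
      cos (M.σ (l + 1) + t) * sin (M.σ (l + 2) + t) := by
    rw [D, ← sin_sub]; ring_nf
  have h1 := sin_sq_add_cos_sq (M.σ (l + 1) + t)
  have h2 := sin_sq_add_cos_sq (M.σ (l + 2) + t)
  simp only [qAt]
  rw [hD]
  constructor <;> grind

/-- The first derivative of the cosines along the generatrix. -/
noncomputable def gam' (l : Fin 3) : ℝ := polarForm M.q M.g 1 (fun i => (M.q i)⁻¹) l / 2

lemma hasDerivAt_gam_generatrix (l : Fin 3) :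
    HasDerivAt (fun t => M.gam 0 (M.H + t) l) (M.gam' l) 0 := by
  have h : ∀ i, HasDerivAt (fun t => M.qAt 0 (M.H + t) i) 1 0 := fun i => by
    simp only [qAt]
    exact ((hasDerivAt_id (0 : ℝ)).const_add M.H).add_const _
  have hq : ∀ i, M.qAt 0 (M.H + 0) i = M.q i := fun i => by rw [add_zero, qAt_zero]
  have hp : ∀ i, 0 < M.qAt 0 (M.H + 0) i := fun i => by rw [hq]; exact M.q_pos i
  refine (hasDerivAt_cosine (h (l + 1)) (h (l + 2)) (hp _) (hp _) (M.q_pos _)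
    (M.q_pos _)).congr_deriv ?_
  have := M.qAt_sub 0 (M.H + 0) l
  rw [this.1, this.2, hq, hq, div_self (M.q_pos _).ne', div_self (M.q_pos _).ne', gam',
    polarForm_one]
  simp [x, y]
  ring

/-- The third order curve on the danger cylinder along which the cosines are stationary. -/
noncomputable def height (t : ℝ) : ℝ := M.H + 2 * M.k * M.Y * M.H * t

/-- The logarithmic derivative of the squared distances along the curve; at `t = 0` it is `2 * k *
lam`. -/
noncomputable def w (t : ℝ) (i : Fin 3) : ℝ :=
  (2 * M.k * M.Y * M.H + 2 * M.k * M.B * (sin (M.σ i + M.B * t) * cos (M.σ i + M.B * t))) /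
    M.qAt (M.B * t) (M.height t) i

/-- The derivative of the cosines along that curve. -/
noncomputable def F (l : Fin 3) (t : ℝ) : ℝ :=
  M.k * M.D l * (M.w t (l + 1) * (sin (M.σ (l + 1) + M.B * t) * cos (M.σ (l + 2) + M.B * t)) -
    M.w t (l + 2) * (sin (M.σ (l + 2) + M.B * t) * cos (M.σ (l + 1) + M.B * t))) /
  (2 * (M.eta (M.B * t) (M.height t) (l + 1) * M.eta (M.B * t) (M.height t) (l + 2)))

lemma eventually_height_pos : ∀ᶠ t in 𝓝 0, 0 < M.height t := by
  have : Continuous M.height := by unfold height; fun_prop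
  exact this.continuousAt.eventually (lt_mem_nhds (by simpa [height] using M.H_pos))

lemma height_zero : M.height 0 = M.H := by simp [height]

lemma hasDerivAt_qAt (t : ℝ) (i : Fin 3) :
    HasDerivAt (fun t => M.qAt (M.B * t) (M.height t) i) (2 * M.k * M.Y * M.H +
      2 * M.k * M.B * (sin (M.σ i + M.B * t) * cos (M.σ i + M.B * t))) t := by
  simp only [qAt, height]
  have h1 : HasDerivAt (fun t => M.σ i + M.B * t) M.B t := by
    simpa using ((hasDerivAt_id t).const_mul M.B).const_add (M.σ i)
  have h2 : HasDerivAt (fun t => M.H + 2 * M.k * M.Y * M.H * t) (2 * M.k * M.Y * M.H) t := by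
    simpa using ((hasDerivAt_id t).const_mul (2 * M.k * M.Y * M.H)).const_add M.H
  refine (h2.add ((h1.sin.pow 2).const_mul M.k)).congr_deriv ?_
  simp
  ring

lemma hasDerivAt_gam {t : ℝ} (ht : 0 < M.height t) (l : Fin 3) :
    HasDerivAt (fun t => M.gam (M.B * t) (M.height t) l) (M.F l t) t := by
  refine (hasDerivAt_cosine (M.hasDerivAt_qAt t (l + 1)) (M.hasDerivAt_qAt t (l + 2))
    (M.qAt_pos _ ht _) (M.qAt_pos _ ht _) (M.q_pos _) (M.q_pos _)).congr_deriv ?_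
  have := M.qAt_sub (M.B * t) (M.height t) l
  rw [this.1, this.2, F, w, w]
  simp only [eta]
  congr 1
  ring

lemma w_zero (i : Fin 3) : M.w 0 i = 2 * M.k * M.lam i := by
  have h := M.lam_mul_q i
  simp only [w, mul_zero, add_zero, height_zero, qAt_zero]
  rw [div_eq_iff (M.q_pos i).ne']
  simp only [x, y] at h
  linear_combination (-2 * M.k) * h

lemma F_zero (l : Fin 3) : M.F l 0 = 0 := by
  have h := congrFun M.polarForm_one_lam l
  rw [polarForm_one] at h
  simp only [F, w_zero, mul_zero, add_zero]
  simp only [x, y, Pi.zero_apply] at h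
  rw [div_eq_zero_iff]
  left
  linear_combination 2 * M.k * h

lemma contDiffAt_qAt (i : Fin 3) :
    ContDiffAt ℝ 2 (fun t => M.qAt (M.B * t) (M.height t) i) 0 := by
  simp only [qAt, height]
  fun_prop

lemma contDiffAt_F (l : Fin 3) : ContDiffAt ℝ 2 (M.F l) 0 := by
  have hq := M.contDiffAt_qAt
  have hpos : ∀ i, M.qAt (M.B * 0) (M.height 0) i ≠ 0 := fun i => by
    rw [mul_zero, height_zero, qAt_zero]; exact (M.q_pos i).ne'
  have hw : ∀ i, ContDiffAt ℝ 2 (fun t => M.w t i) 0 := fun i =>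
    ContDiffAt.div (by fun_prop) (hq i) (hpos i)
  have he : ∀ i, ContDiffAt ℝ 2 (fun t => M.eta (M.B * t) (M.height t) i) 0 := fun i =>
    ((hq i).div_const _).sqrt (div_ne_zero (hpos i) (M.q_pos i).ne')
  have hw1 := hw (l + 1)
  have hw2 := hw (l + 2)
  have he1 := he (l + 1)
  have he2 := he (l + 2)
  unfold F
  refine ContDiffAt.div (by fun_prop) (by fun_prop) ?_
  rw [mul_zero, height_zero, eta_zero, eta_zero]
  norm_num

/-- Half of the logarithmic acceleration of the squared distances. -/
noncomputable def w' (i : Fin 3) : ℝ :=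
  2 * M.k * M.B ^ 2 * (M.y i ^ 2 - M.x i ^ 2) / M.q i - (2 * M.k * M.lam i) ^ 2

lemma hasDerivAt_w (i : Fin 3) : HasDerivAt (fun t => M.w t i) (M.w' i) 0 := by
  have h1 : HasDerivAt (fun t => M.σ i + M.B * t) M.B 0 := by
    simpa using ((hasDerivAt_id (0 : ℝ)).const_mul M.B).const_add (M.σ i)
  have hq := M.hasDerivAt_qAt 0 i
  have hpos : M.qAt (M.B * 0) (M.height 0) i ≠ 0 := by
    rw [mul_zero, height_zero, qAt_zero]; exact (M.q_pos i).ne'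
  have hw := M.w_zero i
  refine ((((h1.sin.mul h1.cos).const_mul (2 * M.k * M.B)).const_add
    (2 * M.k * M.Y * M.H)).div hq hpos).congr_deriv ?_
  rw [w, div_eq_iff hpos] at hw
  simp only [Pi.mul_apply]
  rw [hw]
  have hq0 := (M.q_pos i).ne'
  simp only [mul_zero, height_zero, qAt_zero, add_zero, w', x, y]
  field_simp
  ring

/-- The second derivative of the cosines. -/
noncomputable def gam'' (l : Fin 3) : ℝ :=
  M.k * M.D l * ((M.w' (l + 1) * (M.x (l + 1) * M.y (l + 2)) -
    M.w' (l + 2) * (M.x (l + 2) * M.y (l + 1))) -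
    2 * M.k * M.B * (M.D l * M.x l) * M.x l) / 2

lemma hasDerivAt_F (l : Fin 3) : HasDerivAt (M.F l) (M.gam'' l) 0 := by
  have h1 : ∀ i, HasDerivAt (fun t => M.σ i + M.B * t) M.B 0 := fun i => by
    simpa using ((hasDerivAt_id (0 : ℝ)).const_mul M.B).const_add (M.σ i)
  have hq : ∀ i, DifferentiableAt ℝ (fun t => M.qAt (M.B * t) (M.height t) i) 0 := fun i =>
    (M.hasDerivAt_qAt 0 i).differentiableAt
  have hpos : ∀ i, M.qAt (M.B * 0) (M.height 0) i ≠ 0 := fun i => by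
    rw [mul_zero, height_zero, qAt_zero]; exact (M.q_pos i).ne'
  have he : ∀ i, DifferentiableAt ℝ (fun t => M.eta (M.B * t) (M.height t) i) 0 := fun i =>
    ((hq i).div_const _).sqrt (div_ne_zero (hpos i) (M.q_pos i).ne')
  -- The derivative `d` of the denominator need not be known: it is multiplied by the numerator of
  -- `F`, which vanishes at `0` (`hz'`).
  obtain ⟨d, hE⟩ := (((he (l + 1)).mul (he (l + 2))).const_mul 2)
  replace hE := hE.hasDerivAt
  have hN := ((((M.hasDerivAt_w (l + 1)).mul ((h1 (l + 1)).sin.mul (h1 (l + 2)).cos)).sub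
    ((M.hasDerivAt_w (l + 2)).mul ((h1 (l + 2)).sin.mul (h1 (l + 1)).cos))).const_mul
      (M.k * M.D l))
  refine (hN.div hE ?_).congr_deriv ?_
  · simp [height_zero, eta_zero]
  · have hlam := M.lam_sub l
    have hx := M.x_eq l
    have hl := congrFun M.polarForm_one_lam l
    rw [polarForm_one] at hl
    simp only [x, y, Pi.zero_apply] at hl hx hlam
    simp only [Pi.mul_apply, Pi.sub_apply, mul_zero, add_zero, height_zero, eta_zero, w_zero,
      gam'', x, y]
    have hz' : M.k * M.D l * (2 * M.k * M.lam (l + 1) * (sin (M.σ (l + 1)) * cos (M.σ (l + 2))) -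
        2 * M.k * M.lam (l + 2) * (sin (M.σ (l + 2)) * cos (M.σ (l + 1)))) = 0 := by
      linear_combination 2 * M.k * hl
    rw [hz']
    linear_combination (M.k * M.D l * M.k * M.B * (cos (M.σ (l + 1)) * cos (M.σ (l + 2)) -
      sin (M.σ (l + 1)) * sin (M.σ (l + 2)))) * hlam + M.k * M.D l * M.k * M.B *
      (M.D l * sin (M.σ l)) * hx

/-- The conormal of the image of the danger cylinder under the cosines. -/
noncomputable def conormal (l : Fin 3) (t : ℝ) : ℝ :=
  cos (M.σ l + M.B * t) / M.D l *
    (M.eta (M.B * t) (M.height t) (l + 1) * M.eta (M.B * t) (M.height t) (l + 2))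

noncomputable def n₀ (l : Fin 3) : ℝ := M.y l / M.D l

/-- The derivative of `conormal` at `0`, simplified by `sum_lam`. -/
noncomputable def n₁ (l : Fin 3) : ℝ := M.x l * (M.k * M.y l ^ 2 - M.B) / M.D l

lemma conormal_zero (l : Fin 3) : M.conormal l 0 = M.n₀ l := by
  simp [conormal, height_zero, eta_zero, n₀, y]

lemma sum_lam (l : Fin 3) : M.lam (l + 1) + M.lam (l + 2) = M.x l * M.y l := by
  rw [lam_eq', lam_eq'']
  linear_combination (-M.x l) * M.y_eq l

lemma hasDerivAt_eta (i : Fin 3) :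
    HasDerivAt (fun t => M.eta (M.B * t) (M.height t) i) (M.k * M.lam i) 0 := by
  have hpos : M.qAt (M.B * 0) (M.height 0) i ≠ 0 := by
    rw [mul_zero, height_zero, qAt_zero]; exact (M.q_pos i).ne'
  refine (((M.hasDerivAt_qAt 0 i).div_const _).sqrt
    (div_ne_zero hpos (M.q_pos i).ne')).congr_deriv ?_
  have hw := M.w_zero i
  rw [w, div_eq_iff hpos] at hw
  rw [hw]
  have := M.eta_zero i
  have hq := (M.q_pos i).ne'
  simp only [mul_zero, height_zero, qAt_zero, div_self hq, sqrt_one]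
  field_simp

lemma hasDerivAt_conormal (l : Fin 3) : HasDerivAt (M.conormal l) (M.n₁ l) 0 := by
  have h1 : HasDerivAt (fun t => M.σ l + M.B * t) M.B 0 := by
    simpa using ((hasDerivAt_id (0 : ℝ)).const_mul M.B).const_add (M.σ l)
  refine ((h1.cos.div_const (M.D l)).mul
    ((M.hasDerivAt_eta (l + 1)).mul (M.hasDerivAt_eta (l + 2)))).congr_deriv ?_
  have hs := M.sum_lam l
  simp only [Pi.mul_apply, mul_zero, add_zero, height_zero, eta_zero, n₁]
  simp only [x, y] at hs ⊢
  have hD := M.D_ne_zero l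
  field_simp
  linear_combination (M.k * cos (M.σ l)) * hs

/-- The factors `eta` and `D` cancel, and each `w t i` then occurs twice with the same product of
sine and cosines and opposite signs. The shape of `w` plays no role, so the conormal kills every
tangent direction of the cylinder. -/
lemma sum_conormal_mul_F {t : ℝ} (ht : 0 < M.height t) : ∑ l, M.conormal l t * M.F l t = 0 := by
  have h : ∀ l, M.conormal l t * M.F l t = M.k * cos (M.σ l + M.B * t) *
      (M.w t (l + 1) * (sin (M.σ (l + 1) + M.B * t) * cos (M.σ (l + 2) + M.B * t)) -
        M.w t (l + 2) * (sin (M.σ (l + 2) + M.B * t) * cos (M.σ (l + 1) + M.B * t))) / 2 := by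
    intro l
    have h1 := (M.eta_pos (M.B * t) ht (l + 1)).ne'
    have h2 := (M.eta_pos (M.B * t) ht (l + 2)).ne'
    have hD := M.D_ne_zero l
    rw [conormal, F]
    field_simp
  rw [Fin.sum_univ_three, h, h, h]
  simp only [Fin.isValue, zero_add, Fin.reduceAdd]
  ring

/-- The directional derivative of the cosines, up to the factors of the pairs. -/
noncomputable def L (v : Fin 3 → ℝ) (l : Fin 3) : ℝ := M.k * M.D l *
  (M.x (l + 1) * M.y (l + 2) * v (l + 1) - M.x (l + 2) * M.y (l + 1) * v (l + 2))

lemma sum_n₀_mul_L (v : Fin 3 → ℝ) : ∑ l, M.n₀ l * M.L v l = 0 := by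
  have h : ∀ l, M.n₀ l * M.L v l = M.k * M.y l *
      (M.x (l + 1) * M.y (l + 2) * v (l + 1) - M.x (l + 2) * M.y (l + 1) * v (l + 2)) := by
    intro l
    have hD := M.D_ne_zero l
    rw [n₀, L]
    field_simp
  rw [Fin.sum_univ_three, h, h, h]
  simp only [Fin.isValue, zero_add, Fin.reduceAdd]
  ring

lemma D_mul_q (l : Fin 3) : M.x (l + 1) * M.y (l + 2) * (M.k * M.y (l + 1) ^ 2 - M.B) -
    M.x (l + 2) * M.y (l + 1) * (M.k * M.y (l + 2) ^ 2 - M.B) = M.D l * M.q l := by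
  have h1 := M.x_mul_y_sub l
  have h2 := M.D_eq l
  have h3 := M.X_eq l
  have h4 := M.x_eq l
  rw [q, B]
  linear_combination (M.k * M.y (l + 1) * M.y (l + 2)) * h1 +
    (M.k * M.X - M.H) * h2 - M.k * M.D l * h3 - M.k * M.D l * M.x l * h4

/-- For the direction `1 / (2 q)` of the generatrix the right side reduces to `∑ D i * x i = 0`, so
`n₁` kills `gam'`; `power_sums` evaluates it on `gam''`. -/
lemma sum_n₁_mul_L (v : Fin 3 → ℝ) :
    ∑ l, M.n₁ l * M.L v l = -(M.k * ∑ i, M.D i * M.x i * (M.q i * v i)) := by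
  have h : ∀ l, M.n₁ l * M.L v l = M.k * (M.x l * (M.k * M.y l ^ 2 - M.B)) *
      (M.x (l + 1) * M.y (l + 2) * v (l + 1) - M.x (l + 2) * M.y (l + 1) * v (l + 2)) := by
    intro l
    have hD := M.D_ne_zero l
    rw [n₁, L]
    field_simp
  have h0 := M.D_mul_q 0
  have h1 := M.D_mul_q 1
  have h2 := M.D_mul_q 2
  rw [Fin.sum_univ_three, Fin.sum_univ_three, h, h, h]
  simp only [Fin.isValue, zero_add, Fin.reduceAdd] at *
  linear_combination (-M.k * M.x 0 * v 0) * h0 - M.k * M.x 1 * v 1 * h1 - M.k * M.x 2 * v 2 * h2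

lemma gam'_eq : M.gam' = M.L (fun i => (M.q i)⁻¹ / 2) := by
  ext l
  rw [gam', polarForm_one, L]
  ring

/-- The mixed term of `gam''` is absorbed by the same identity that underlies `rho`. Being a value
of `L`, `gam''` is annihilated by `n₀`. -/
lemma gam''_eq : M.gam'' = M.L (fun i => M.w' i / 2 - M.k * M.B * (M.y i ^ 2 - M.X)) := by
  ext l
  have h4 := M.x_mul_y_sub l
  have h5 := M.D_eq l
  have h6 := M.X_eq l
  have h7 := M.x_eq l
  rw [gam'', L]
  have hm : M.D l * M.x l * M.x l =
      (M.x (l + 1) * M.y (l + 2) * (M.y (l + 1) ^ 2 - M.X) -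
        M.x (l + 2) * M.y (l + 1) * (M.y (l + 2) ^ 2 - M.X)) := by
    linear_combination (M.D l * M.x l) * h7 + M.D l * h6 -
      (M.y (l + 1) * M.y (l + 2)) * h4 - M.X * h5
  linear_combination (-(M.k * M.D l * M.k * M.B)) * hm

lemma D_zero : M.D 0 = M.x 1 * M.y 2 - M.x 2 * M.y 1 := M.D_eq 0
lemma D_one : M.D 1 = M.x 2 * M.y 0 - M.x 0 * M.y 2 := M.D_eq 1
lemma D_two : M.D 2 = M.x 0 * M.y 1 - M.x 1 * M.y 0 := M.D_eq 2

lemma sum_D_mul_x : ∑ i, M.D i * M.x i = 0 := by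
  rw [Fin.sum_univ_three, D_zero, D_one, D_two]
  ring

/-- Moments for the weights `D i * x i`; eliminating the third angle leaves polynomial identities on
two circles. -/
lemma power_sums : (∑ i, M.D i * M.x i * (M.x i * M.y i) = 0) ∧
    (∑ i, M.D i * M.x i * M.x i ^ 2 = -(M.D 0 * M.D 1 * M.D 2)) ∧
    (∑ i, M.D i * M.x i * M.x i ^ 4 = (1 - M.X) * -(M.D 0 * M.D 1 * M.D 2)) := by
  have h0 := M.circle 0
  have h1 := M.circle 1
  have h2 : M.x 2 = M.y 0 * M.y 1 - M.x 0 * M.x 1 := M.x_eq 2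
  have h3 : M.y 2 = M.y 0 * M.x 1 + M.x 0 * M.y 1 := M.y_eq 2
  simp only [Fin.sum_univ_three, D_zero, D_one, D_two, X]
  generalize M.x 0 = a, M.y 0 = b, M.x 1 = c, M.y 1 = d, M.x 2 = e, M.y 2 = f at *
  subst h2 h3
  refine ⟨?_, ?_, ?_⟩ <;> grind

/-- When `B ≠ 0` this number is nonzero, and it separates the `t²` and `t³` directions of the cusp
from the remaining ones. -/
lemma sum_n₁_mul_gam'' :
    ∑ l, M.n₁ l * M.gam'' l = 3 * M.k ^ 2 * M.B * M.H * (M.D 0 * M.D 1 * M.D 2) := by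
  rw [gam''_eq, sum_n₁_mul_L]
  obtain ⟨p1, p2, p4⟩ := M.power_sums
  have p0 := M.sum_D_mul_x
  -- An expansion in `1`, `x y`, `x²`, `x⁴`, the functions whose moments are known; the division by
  -- `q` in `w'` disappears because of `lam_mul_q`.
  have h : ∀ i, M.q i * (M.w' i / 2 - M.k * M.B * (M.y i ^ 2 - M.X)) =
      (M.k * M.B ^ 2 - 2 * M.k ^ 2 * M.Y ^ 2 * M.H - M.k * M.B * (1 - M.X) * M.H) +
      (-2 * M.k ^ 2 * (M.B * M.Y - M.Y * M.H)) * (M.x i * M.y i) +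
      (-2 * M.k * M.B ^ 2 + 2 * M.k ^ 2 * M.B + M.k * M.B * M.H - M.k ^ 2 * M.B * (1 - M.X)) *
        M.x i ^ 2 + (-2 * M.k ^ 2 * M.B + M.k ^ 2 * M.B) * M.x i ^ 4 := by
    intro i
    have hq := (M.q_pos i).ne'
    have h1 := M.lam_mul_q i
    have h2 := M.circle i
    have h3 : M.y i ^ 2 = 1 - M.x i ^ 2 := by linear_combination h2
    have h4 : M.q i * M.w' i = 2 * M.k * M.B ^ 2 * (M.y i ^ 2 - M.x i ^ 2) -
        4 * M.k ^ 2 * (M.lam i * (M.lam i * M.q i)) := by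
      rw [w']; field_simp; ring
    rw [h1, lam] at h4
    have h5 : M.q i = M.H + M.k * M.x i ^ 2 := rfl
    rw [mul_sub, ← mul_div_assoc, h4, h5]
    linear_combination (M.k * M.B ^ 2 + 2 * M.k ^ 2 * M.B * M.x i ^ 2
      - (M.H + M.k * M.x i ^ 2) * M.k * M.B) * h3
  simp only [h]
  rw [Fin.sum_univ_three] at *
  have hB : M.B = M.k * M.X - M.H := rfl
  linear_combination
    (-M.k * (M.k * M.B ^ 2 - 2 * M.k ^ 2 * M.Y ^ 2 * M.H - M.k * M.B * (1 - M.X) * M.H)) * p0 -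
    M.k * (-2 * M.k ^ 2 * (M.B * M.Y - M.Y * M.H)) * p1 -
    M.k * (-2 * M.k * M.B ^ 2 + 2 * M.k ^ 2 * M.B + M.k * M.B * M.H -
      M.k ^ 2 * M.B * (1 - M.X)) * p2 -
    M.k * (-2 * M.k ^ 2 * M.B + M.k ^ 2 * M.B) * p4 -
    (2 * M.k ^ 2 * M.B * (M.D 0 * M.D 1 * M.D 2)) * hB

/-- The relation is the coefficient of `t²` in `∑ conormal * F = 0`, where `F = gam'' t + 3 c t² +
o(t²)` and the conormal is `n₀ + n₁ t + o(t)`. -/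
lemma exists_third_derivative : ∃ c : Fin 3 → ℝ,
    (∀ l, (fun t => M.gam (M.B * t) (M.height t) l -
      (M.g l + t ^ 2 * (M.gam'' l / 2) + t ^ 3 * (c l))) =o[𝓝 0] fun t => t ^ 3) ∧
    3 * ∑ l, M.n₀ l * c l = -∑ l, M.n₁ l * M.gam'' l := by
  have hjet := fun l => exists_jet (f := fun t => M.gam (M.B * t) (M.height t) l)
    (by filter_upwards [M.eventually_height_pos] with t ht using M.hasDerivAt_gam ht l)
    (M.contDiffAt_F l) (M.F_zero l) (M.hasDerivAt_F l)
  choose b hb1 hb2 using hjet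
  refine ⟨fun l => b l / 3, fun l => ?_, ?_⟩
  · simpa [height_zero, gam_zero] using hb2 l
  · have hn : ∀ l, (fun t => M.conormal l t - (M.n₀ l + t * M.n₁ l)) =o[𝓝 0] fun t => t := by
      intro l
      have := (M.hasDerivAt_conormal l).isLittleO
      rw [conormal_zero] at this
      refine this.congr (fun t => ?_) (fun t => by simp)
      simp
      ring
    have hF : ∀ l, M.F l =O[𝓝 0] fun t => t := by
      intro l
      have := (M.hasDerivAt_F l).isBigO_sub
      simpa [F_zero] using this
    have hsum : (fun t => t ^ 2 * ∑ l, (M.n₀ l * b l + M.n₁ l * M.gam'' l))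
        =o[𝓝 0] fun t : ℝ => t ^ 2 := by
      have h1 : ∀ l, (fun t => M.conormal l t * M.F l t - (M.n₀ l + t * M.n₁ l) * M.F l t)
          =o[𝓝 0] fun t : ℝ => t ^ 2 := by
        intro l
        refine ((hn l).mul_isBigO (hF l)).congr (fun t => ?_) (fun t => by ring)
        ring
      have h2 : ∀ l, (fun t => (M.n₀ l + t * M.n₁ l) *
          (M.F l t - (M.gam'' l * t + b l * t ^ 2))) =o[𝓝 0] fun t : ℝ => t ^ 2 := by
        intro l
        have hO : (fun t : ℝ => M.n₀ l + t * M.n₁ l) =O[𝓝 0] fun _ => (1 : ℝ) := by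
          have : ContinuousAt (fun t : ℝ => M.n₀ l + t * M.n₁ l) 0 := by fun_prop
          exact this.tendsto.isBigO_one ℝ
        simpa using hO.mul_isLittleO (hb1 l)
      have h3 : (fun t : ℝ => t ^ 3 * ∑ l, M.n₁ l * b l) =o[𝓝 0] fun t : ℝ => t ^ 2 := by
        have : (fun t : ℝ => t ^ 3) =o[𝓝 0] fun t : ℝ => t ^ 2 := isLittleO_pow_pow (by norm_num)
        simpa [mul_comm] using this.const_mul_left (∑ l, M.n₁ l * b l)
      have h4 := ((IsLittleO.sum fun l (_ : l ∈ Finset.univ) => (h1 l).add (h2 l)).add h3).neg_left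
      refine h4.congr' ?_ EventuallyEq.rfl
      filter_upwards [M.eventually_height_pos] with t ht
      have e1 := M.sum_conormal_mul_F ht
      have e2 : ∑ l, M.n₀ l * M.gam'' l = 0 := by rw [gam''_eq, sum_n₀_mul_L]
      simp only [Fin.sum_univ_three, Pi.add_apply] at e1 e2 ⊢
      linear_combination (-1 : ℝ) * e1 + t * e2
    have hz : ∑ l, (M.n₀ l * b l + M.n₁ l * M.gam'' l) = 0 :=
      eq_zero_of_isLittleO hsum
    rw [Finset.sum_add_distrib] at hz
    simp only [Fin.sum_univ_three] at hz ⊢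
    linear_combination hz

end MorleyConfig

end P3P

namespace P3P

open Filter Topology Asymptotics

namespace MorleyConfig

variable (M : MorleyConfig)

/-! ### Lifting curves of cosines to curves of solutions -/

/-- The values of `gam` belonging to a solution. -/
noncomputable def Psi (r : Fin 3 → ℂ) (l : Fin 3) : ℂ :=
  (M.q (l + 1) * r (l + 1) ^ 2 + M.q (l + 2) * r (l + 2) ^ 2 - M.k * M.D l ^ 2) /
    (2 * (r (l + 1) * r (l + 2)))

variable {M} {r : Fin 3 → ℂ}

lemma contDiffAt_Psi (h0 : ∀ i, r i ≠ 0) : ContDiffAt ℂ 1 M.Psi r := by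
  rw [contDiffAt_pi]
  intro l
  unfold Psi
  refine ContDiffAt.div (by fun_prop) (by fun_prop) ?_
  exact mul_ne_zero two_ne_zero (mul_ne_zero (h0 _) (h0 _))

lemma Psi_mul (h0 : ∀ i, r i ≠ 0) (l : Fin 3) : M.Psi r l * (2 * (r (l + 1) * r (l + 2))) =
    M.q (l + 1) * r (l + 1) ^ 2 + M.q (l + 2) * r (l + 2) ^ 2 - M.k * M.D l ^ 2 :=
  div_mul_cancel₀ _ (mul_ne_zero two_ne_zero (mul_ne_zero (h0 _) (h0 _)))

lemma form_apply (v w : Fin 3 → ℂ) (l : Fin 3) :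
    M.form v w l = M.q (l + 1) * (v (l + 1) * w (l + 1)) +
      M.q (l + 2) * (v (l + 2) * w (l + 2)) - M.g l * (v (l + 1) * w (l + 2) + v (l + 2) * w (l + 1)) :=
  rfl

lemma Psi_eq (hr : M.form r r = M.form 1 1) (h0 : ∀ i, r i ≠ 0) (l : Fin 3) :
    M.Psi r l = M.g l := by
  have h1 := congrFun hr l
  rw [form_one_one, form_apply] at h1
  push_cast at h1
  rw [Psi, div_eq_iff (mul_ne_zero two_ne_zero (mul_ne_zero (h0 _) (h0 _)))]
  linear_combination h1

/-- Obtained by differentiating the polynomial identity `Psi_mul` along `r + t v`. It translates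
simplicity of the base point `r` into invertibility of the derivative of `Psi`. -/
lemma mul_fderiv_Psi (hr : M.form r r = M.form 1 1) (h0 : ∀ i, r i ≠ 0) (v : Fin 3 → ℂ)
    (l : Fin 3) : r (l + 1) * r (l + 2) * fderiv ℂ M.Psi r v l = M.form r v l := by
  have hd : HasFDerivAt M.Psi (fderiv ℂ M.Psi r) r :=
    ((contDiffAt_Psi h0).differentiableAt (by norm_num)).hasFDerivAt
  have hline : HasDerivAt (fun t : ℂ => r + t • v) v 0 := by
    simpa using ((hasDerivAt_id (0 : ℂ)).smul_const v).const_add r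
  have hi : ∀ i, HasDerivAt (fun t : ℂ => (r + t • v) i) (v i) 0 := hasDerivAt_pi.1 hline
  have hr0 : r = r + (0 : ℂ) • v := by simp
  have hP : HasDerivAt (fun t : ℂ => M.Psi (r + t • v) l) (fderiv ℂ M.Psi r v l) 0 := by
    rw [hr0] at hd
    have := hd.comp_hasDerivAt (0 : ℂ) hline
    rw [← hr0] at this
    exact hasDerivAt_pi.1 this l
  have h1 := hP.mul (((hi (l + 1)).mul (hi (l + 2))).const_mul 2)
  have h2 := ((((hi (l + 1)).pow 2).const_mul (M.q (l + 1) : ℂ)).add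
    (((hi (l + 2)).pow 2).const_mul (M.q (l + 2) : ℂ))).sub_const ((M.k * M.D l ^ 2 : ℂ))
  have hev : ∀ᶠ t : ℂ in 𝓝 0, ∀ i, (r + t • v) i ≠ 0 := by
    rw [eventually_all]
    intro i
    refine (hi i).continuousAt.eventually_ne ?_
    simpa using h0 i
  have h3 := h1.unique (h2.congr_of_eventuallyEq (by
    filter_upwards [hev] with t ht
    exact Psi_mul ht l))
  have h4 := Psi_eq hr h0 l
  simp only [zero_smul, add_zero, Pi.mul_apply, Nat.cast_ofNat, Nat.reduceSub, pow_one, h4] at h3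
  rw [form_apply]
  linear_combination h3 / 2

/-- Inverse function theorem at `r`; the derivative is injective by `form_injective`. -/
lemma exists_localInverse (hr : M.form r r = M.form 1 1) (h1 : r ≠ 1) (h2 : r ≠ -1)
    (h0 : ∀ i, r i ≠ 0) : ∃ (ψ : (Fin 3 → ℂ) → (Fin 3 → ℂ)) (A : (Fin 3 → ℂ) →L[ℂ] (Fin 3 → ℂ)),
      HasFDerivAt ψ A (fun l => (M.g l : ℂ)) ∧ ψ (fun l => (M.g l : ℂ)) = r ∧
      (∀ᶠ c in 𝓝 (fun l => (M.g l : ℂ)), M.Psi (ψ c) = c) ∧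
      ∀ c l, M.form r (A c) l = r (l + 1) * r (l + 2) * c l := by
  have hd : HasStrictFDerivAt M.Psi (fderiv ℂ M.Psi r) r :=
    (contDiffAt_Psi h0).hasStrictFDerivAt (by norm_num)
  have hinj : Function.Injective (fderiv ℂ M.Psi r : (Fin 3 → ℂ) →ₗ[ℂ] (Fin 3 → ℂ)) := by
    rw [← LinearMap.ker_eq_bot, LinearMap.ker_eq_bot']
    intro v hv
    refine M.form_injective hr h1 h2 (funext fun l => ?_)
    rw [← mul_fderiv_Psi hr h0]
    have : fderiv ℂ M.Psi r v = 0 := hv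
    rw [this]; simp
  let e := (LinearEquiv.ofInjectiveEndo _ hinj).toContinuousLinearEquiv
  have he : ∀ v, e v = fderiv ℂ M.Psi r v := fun v => rfl
  have hd' : HasStrictFDerivAt M.Psi (e : (Fin 3 → ℂ) →L[ℂ] (Fin 3 → ℂ)) r := by
    convert hd using 1
    exact ContinuousLinearMap.ext fun v => he v
  have hg : M.Psi r = fun l => (M.g l : ℂ) := funext (Psi_eq hr h0)
  refine ⟨hd'.localInverse _ _ _, e.symm, ?_, ?_, ?_, fun c l => ?_⟩
  · rw [← hg]; exact hd'.to_localInverse.hasFDerivAt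
  · rw [← hg]; exact hd'.localInverse_apply_image
  · rw [← hg]; exact hd'.eventually_right_inverse
  · rw [← mul_fderiv_Psi hr h0]
    have : fderiv ℂ M.Psi r (e.symm c) = c := by rw [← he]; simp
    change r (l + 1) * r (l + 2) * fderiv ℂ M.Psi r (e.symm c) l = _
    rw [this]

/-- A first order curve of solutions over a first order curve of cosines. -/
lemma exists_lift_of_hasDerivAt (hr : M.form r r = M.form 1 1) (h1 : r ≠ 1) (h2 : r ≠ -1)
    (h0 : ∀ i, r i ≠ 0) {γ : ℝ → Fin 3 → ℝ} {a : Fin 3 → ℝ} (hγ0 : γ 0 = M.g)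
    (hγ : ∀ l, HasDerivAt (fun t => γ t l) (a l) 0) :
    ∃ (ρ : ℝ → Fin 3 → ℂ) (u : Fin 3 → ℂ), Tendsto ρ (𝓝 0) (𝓝 r) ∧
      (∀ᶠ t in 𝓝 0, M.Psi (ρ t) = fun l => (γ t l : ℂ)) ∧
      (fun t => ρ t - (r + t • u)) =o[𝓝 0] (fun t : ℝ => t) ∧
      ∀ l, M.form r u l = r (l + 1) * r (l + 2) * a l := by
  obtain ⟨ψ, A, hψ, hψ0, hinv, hA⟩ := exists_localInverse hr h1 h2 h0
  have hd : HasDerivAt (fun t l => (γ t l : ℂ)) (fun l => (a l : ℂ)) 0 :=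
    hasDerivAt_pi.2 fun l => (hγ l).ofReal_comp
  have hc : (fun l => (γ 0 l : ℂ)) = fun l => (M.g l : ℂ) := by rw [hγ0]
  rw [← hc] at hψ hψ0 hinv
  have hcomp := (hψ.restrictScalars ℝ).comp_hasDerivAt (0 : ℝ) hd
  refine ⟨fun t => ψ fun l => (γ t l : ℂ), A fun l => (a l : ℂ), ?_, ?_, ?_, fun l => hA _ l⟩
  · have := hcomp.continuousAt.tendsto
    simpa only [Function.comp_def, hψ0] using this
  · exact hd.continuousAt.eventually hinv
  · refine hcomp.isLittleO.congr (fun t => ?_) (fun t => by simp)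
    simp only [Function.comp_def, hψ0, sub_zero]
    rw [sub_sub]
    rfl

/-- A third order curve of solutions over a third order curve of cosines with vanishing
velocity. -/
lemma exists_lift_of_isLittleO (hr : M.form r r = M.form 1 1) (h1 : r ≠ 1) (h2 : r ≠ -1)
    (h0 : ∀ i, r i ≠ 0) {γ : ℝ → Fin 3 → ℝ} {a c : Fin 3 → ℝ}
    (hγ : ∀ l, (fun t => γ t l - (M.g l + t ^ 2 * a l + t ^ 3 * c l)) =o[𝓝 0] fun t => t ^ 3) :
    ∃ (ρ : ℝ → Fin 3 → ℂ) (u v : Fin 3 → ℂ), Tendsto ρ (𝓝 0) (𝓝 r) ∧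
      (∀ᶠ t in 𝓝 0, M.Psi (ρ t) = fun l => (γ t l : ℂ)) ∧
      (fun t => ρ t - (r + t ^ 2 • u + t ^ 3 • v)) =o[𝓝 0] (fun t : ℝ => t ^ 3) ∧
      (∀ l, M.form r u l = r (l + 1) * r (l + 2) * a l) ∧
      ∀ l, M.form r v l = r (l + 1) * r (l + 2) * c l := by
  obtain ⟨ψ, A, hψ, hψ0, hinv, hA⟩ := exists_localInverse hr h1 h2 h0
  have hO3 : (fun t : ℝ => t ^ 3) =O[𝓝 0] fun t => t ^ 2 := by
    have : (fun t : ℝ => t ^ 3) =o[𝓝 0] fun t : ℝ => t ^ 2 := isLittleO_pow_pow (by norm_num)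
    exact this.isBigO
  have hγ2 : ∀ l, (fun t => γ t l - M.g l) =O[𝓝 0] fun t => t ^ 2 := by
    intro l
    have e1 : (fun t : ℝ => t ^ 2 * a l + t ^ 3 * c l) =O[𝓝 0] fun t : ℝ => t ^ 2 := by
      refine IsBigO.add ?_ ?_
      · simpa [mul_comm] using (isBigO_refl (fun t : ℝ => t ^ 2) (𝓝 0)).const_mul_left (a l)
      · simpa [mul_comm] using hO3.const_mul_left (c l)
    refine (((hγ l).isBigO.trans hO3).add e1).congr_left fun t => ?_
    ring
  have hcγ : (fun t => (fun l => (γ t l : ℂ)) - fun l => (M.g l : ℂ)) =O[𝓝 0]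
      fun t : ℝ => t ^ 2 := by
    rw [isBigO_pi]
    intro l
    refine IsBigO.of_norm_left ((hγ2 l).norm_left.congr_left fun t => ?_)
    simp only [Pi.sub_apply]
    rw [← Complex.ofReal_sub, Complex.norm_real]
  have htend : Tendsto (fun t l => (γ t l : ℂ)) (𝓝 0) (𝓝 fun l => (M.g l : ℂ)) := by
    rw [tendsto_iff_norm_sub_tendsto_zero]
    have := (hcγ.trans_tendsto (by
      have : ContinuousAt (fun t : ℝ => t ^ 2) 0 := by fun_prop
      simpa [ContinuousAt] using this)).norm
    simpa using this
  have hrO : (fun t => (ψ fun l => (γ t l : ℂ)) - r) =O[𝓝 0] fun t : ℝ => t ^ 2 := by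
    have := hψ.isBigO_sub.comp_tendsto htend
    simp only [Function.comp_def, hψ0] at this
    exact this.trans hcγ
  have hΨ := htend.eventually hinv
  have hrt : Tendsto (fun t => ψ fun l => (γ t l : ℂ)) (𝓝 0) (𝓝 r) := by
    have := hψ.continuousAt.tendsto.comp htend
    rwa [hψ0] at this
  refine ⟨fun t => ψ fun l => (γ t l : ℂ), A fun l => (a l : ℂ), A fun l => (c l : ℂ), hrt, hΨ,
    ?_, fun l => hA _ l, fun l => hA _ l⟩
  set ρ : ℝ → Fin 3 → ℂ := fun t => ψ fun l => (γ t l : ℂ) with hρ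
  have hne : ∀ᶠ t in 𝓝 0, ∀ i, ρ t i ≠ 0 := by
    rw [eventually_all]
    exact fun i => (tendsto_pi_nhds.1 hrt i).eventually_ne (h0 i)
  have hB : Function.Injective (M.form r) := by
    rw [← LinearMap.ker_eq_bot, LinearMap.ker_eq_bot']
    exact fun v hv => M.form_injective hr h1 h2 hv
  let e := (LinearEquiv.ofInjectiveEndo _ hB).toContinuousLinearEquiv
  have he : ∀ v, e v = M.form r v := fun v => rfl
  have hi : ∀ i, (fun t => ρ t i - r i) =O[𝓝 0] fun t : ℝ => t ^ 2 := fun i =>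
    isBigO_pi.1 hrO i
  have h43 : (fun t : ℝ => t ^ 2 * t ^ 2) =o[𝓝 0] fun t : ℝ => t ^ 3 := by
    simp only [← pow_add]
    exact isLittleO_pow_pow (by norm_num)
  -- Only first derivatives of the local inverse are used. The equation `Psi (ρ t) = γ t` is
  -- polynomial, and `ρ - r` and `γ - g` are both `O(t²)`, so all their products are `O(t⁴)`;
  -- applying the invertible map `form r` leaves only such terms and the error of `γ`.
  have hform : (fun t => e (ρ t - (r + t ^ 2 • (A fun l => (a l : ℂ)) +
      t ^ 3 • (A fun l => (c l : ℂ))))) =o[𝓝 0] fun t : ℝ => t ^ 3 := by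
    rw [isLittleO_pi]
    intro l
    have p1 : (fun t => (γ t l - M.g l : ℂ)) =O[𝓝 0] fun t : ℝ => t ^ 2 := isBigO_pi.1 hcγ l
    have p2 : (fun t => ((γ t l : ℂ) - (M.g l + t ^ 2 * a l + t ^ 3 * c l))) =o[𝓝 0]
        fun t : ℝ => t ^ 3 := by
      refine IsLittleO.of_norm_left ((hγ l).norm_left.congr_left fun t => ?_)
      rw [← Complex.norm_real]
      push_cast
      rfl
    have p3 := p2.const_mul_left (r (l + 1) * r (l + 2))
    have p4 := (p1.mul ((hi (l + 1)).const_mul_left (r (l + 2)))).trans_isLittleO h43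
    have p5 := (p1.mul ((hi (l + 2)).const_mul_left (r (l + 1)))).trans_isLittleO h43
    have p6 := (((hi (l + 1)).mul (hi (l + 1))).const_mul_left (M.q (l + 1) / 2 : ℂ)).trans_isLittleO
      h43
    have p7 := (((hi (l + 2)).mul (hi (l + 2))).const_mul_left (M.q (l + 2) / 2 : ℂ)).trans_isLittleO
      h43
    have p8 := (((hi (l + 1)).mul (hi (l + 2))).const_mul_left (M.g l : ℂ)).trans_isLittleO h43
    have p9 : (fun t => (γ t l - M.g l : ℂ) * ((ρ t (l + 1) - r (l + 1)) *
        (ρ t (l + 2) - r (l + 2)))) =o[𝓝 0] fun t : ℝ => t ^ 3 := by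
      have q1 : (fun t => ρ t (l + 2) - r (l + 2)) =O[𝓝 0] fun _ : ℝ => (1 : ℝ) := by
        have : Tendsto (fun t => ρ t (l + 2) - r (l + 2)) (𝓝 0) (𝓝 (r (l + 2) - r (l + 2))) :=
          (tendsto_pi_nhds.1 hrt (l + 2)).sub_const _
        exact this.isBigO_one ℝ
      refine (p1.mul ((hi (l + 1)).mul q1)).trans_isLittleO ?_
      simpa using h43
    refine ((((((p3.add p4).add p5).sub p6).sub p7).add p8).add p9).congr' ?_ EventuallyEq.rfl
    filter_upwards [hΨ, hne] with t ht hnt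
    have e1 := Psi_mul (M := M) hnt l
    have e2 : M.Psi (ρ t) l = γ t l := congrFun ht l
    rw [e2] at e1
    have e3 := congrFun hr l
    rw [form_one_one, form_apply] at e3
    push_cast at e3
    have e4 := hA (fun l => (a l : ℂ)) l
    have e5 := hA (fun l => (c l : ℂ)) l
    rw [he, map_sub, map_add, map_add]
    simp only [← Complex.coe_smul, map_smul, Pi.sub_apply, Pi.add_apply, Pi.smul_apply, e4, e5,
      smul_eq_mul]
    simp only [form_apply] at e3 ⊢
    push_cast
    linear_combination (1 / 2 : ℂ) * e1 + (1 / 2 : ℂ) * e3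
  have := (e.symm : (Fin 3 → ℂ) →L[ℂ] (Fin 3 → ℂ)).isBigO_comp (fun t => e (ρ t - (r + t ^ 2 •
    (A fun l => (a l : ℂ)) + t ^ 3 • (A fun l => (c l : ℂ))))) (𝓝 0)
  refine (this.trans_isLittleO hform).congr_left fun t => ?_
  simp

end MorleyConfig
end P3P

namespace P3P

open Filter Topology Asymptotics

/-! ### Second order behaviour of polynomials along curves -/

/-- The linear part of `f` at `p`. -/
noncomputable def grad (f : MvPolynomial (Fin 3) ℂ) (p w : Fin 3 → ℂ) : ℂ :=
  ∑ i, MvPolynomial.eval p (MvPolynomial.pderiv i f) * w i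

/-- The second derivative of `f` at `p`. -/
noncomputable def hess (f : MvPolynomial (Fin 3) ℂ) (p v w : Fin 3 → ℂ) : ℂ :=
  ∑ i, ∑ j, MvPolynomial.eval p (MvPolynomial.pderiv i (MvPolynomial.pderiv j f)) * (v i * w j)

lemma pderiv_comm (f : MvPolynomial (Fin 3) ℂ) (i j : Fin 3) :
    MvPolynomial.pderiv i (MvPolynomial.pderiv j f) =
      MvPolynomial.pderiv j (MvPolynomial.pderiv i f) := by
  induction f using MvPolynomial.induction_on with
  | C a => simp
  | add f g hf hg => simp [hf, hg]
  | mul_X f k hf =>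
    simp only [MvPolynomial.pderiv_mul, map_add, hf, MvPolynomial.pderiv_X]
    have : ∀ a b c : Fin 3, MvPolynomial.pderiv a (Pi.single (M := fun _ => MvPolynomial (Fin 3) ℂ)
        b 1 c) = 0 := by
      intro a b c
      rcases eq_or_ne c b with rfl | h
      · simp
      · simp [h]
    simp only [this]
    ring

lemma hess_comm (f : MvPolynomial (Fin 3) ℂ) (p v w : Fin 3 → ℂ) : hess f p v w = hess f p w v := by
  unfold hess
  rw [Finset.sum_comm]
  refine Finset.sum_congr rfl fun i _ => Finset.sum_congr rfl fun j _ => ?_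
  rw [pderiv_comm, mul_comm (v j)]

lemma hess_eq_sum_grad (f : MvPolynomial (Fin 3) ℂ) (p v w : Fin 3 → ℂ) :
    hess f p v w = ∑ j, w j * grad (MvPolynomial.pderiv j f) p v := by
  simp only [hess, grad, Fin.sum_univ_three]
  ring

lemma isBigO_coord {ι : Type*} [Fintype ι] (i : ι) :
    (fun w : ι → ℂ => w i) =O[𝓝 0] fun w => ‖w‖ :=
  IsBigO.of_bound 1 (Eventually.of_forall fun w => by simpa using norm_le_pi_norm w i)

lemma hess_isBigO (f : MvPolynomial (Fin 3) ℂ) (p : Fin 3 → ℂ) :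
    (fun w => hess f p w w) =O[𝓝 0] fun w => ‖w‖ ^ 2 := by
  unfold hess
  refine IsBigO.fun_sum fun i _ => IsBigO.fun_sum fun j _ => IsBigO.const_mul_left ?_ _
  simpa only [pow_two] using (isBigO_coord i).mul (isBigO_coord j)

lemma grad_mul_X (f : MvPolynomial (Fin 3) ℂ) (p w : Fin 3 → ℂ) (k : Fin 3) :
    grad (f * MvPolynomial.X k) p w = grad f p w * p k + MvPolynomial.eval p f * w k := by
  simp only [grad, MvPolynomial.pderiv_mul, MvPolynomial.pderiv_X, map_add, map_mul,
    MvPolynomial.eval_X, add_mul, Finset.sum_add_distrib, Finset.sum_mul]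
  congr 1
  · exact Finset.sum_congr rfl fun i _ => by ring
  · rw [Finset.sum_eq_single k]
    · simp
    · intro b _ hb; simp [hb.symm]
    · simp

/-- For `f * X k` the new error is that of `f` times a bounded factor, plus the cubic term `w k *
hess f p w w / 2`. -/
lemma taylor_two (f : MvPolynomial (Fin 3) ℂ) (p : Fin 3 → ℂ) :
    (fun w => MvPolynomial.eval (p + w) f -
      (MvPolynomial.eval p f + grad f p w + hess f p w w / 2)) =O[𝓝 0] fun w => ‖w‖ ^ 3 := by
  induction f using MvPolynomial.induction_on with
  | C a => simpa [grad, hess] using isBigO_zero _ _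
  | add f g hf hg =>
    refine (hf.add hg).congr_left fun w => ?_
    simp only [grad, hess, map_add, Fin.sum_univ_three]
    ring
  | mul_X f k hf =>
    have h1 : (fun w : Fin 3 → ℂ => p k + w k) =O[𝓝 0] fun _ => (1 : ℝ) := by
      have : ContinuousAt (fun w : Fin 3 → ℂ => p k + w k) 0 :=
        continuousAt_const.add (continuous_apply k).continuousAt
      exact this.tendsto.isBigO_one ℝ
    have h2 := hf.mul h1
    have h3 := ((isBigO_coord k).mul (hess_isBigO f p)).const_mul_left (1 / 2)
    have h4 : (fun w : Fin 3 → ℂ => ‖w‖ ^ 3 * 1) = fun w => ‖w‖ * ‖w‖ ^ 2 := by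
      ext w; ring
    rw [h4] at h2
    refine ((h2.add h3).congr_left fun w => ?_).congr_right fun w => ?_
    · have hg := grad_mul_X f p w k
      have hh : hess (f * MvPolynomial.X k) p w w = hess f p w w * p k + 2 * (w k * grad f p w) := by
        rw [hess_eq_sum_grad, hess_eq_sum_grad]
        have : ∀ j, grad (MvPolynomial.pderiv j (f * MvPolynomial.X k)) p w =
            grad (MvPolynomial.pderiv j f) p w * p k +
              MvPolynomial.eval p (MvPolynomial.pderiv j f) * w k +
              (if j = k then grad f p w else 0) := by
          intro j
          rcases eq_or_ne j k with rfl | h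
          · rw [if_pos rfl, MvPolynomial.pderiv_mul, MvPolynomial.pderiv_X_self, mul_one,
              ← grad_mul_X]
            simp [grad, add_mul, Finset.sum_add_distrib]
          · rw [if_neg h, MvPolynomial.pderiv_mul, MvPolynomial.pderiv_X_of_ne h.symm, mul_zero,
              add_zero, add_zero, grad_mul_X]
        simp only [this, mul_add, Finset.sum_add_distrib, Finset.sum_mul]
        simp only [mul_ite, mul_zero, Finset.sum_ite_eq', Finset.mem_univ, if_true]
        have h5 : ∑ i, w i * (MvPolynomial.eval p (MvPolynomial.pderiv i f) * w k) =
            w k * grad f p w := by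
          rw [grad, Finset.mul_sum]
          exact Finset.sum_congr rfl fun i _ => by ring
        rw [h5]
        have h6 : ∑ i, w i * (grad (MvPolynomial.pderiv i f) p w * p k) =
            ∑ i, w i * grad (MvPolynomial.pderiv i f) p w * p k :=
          Finset.sum_congr rfl fun i _ => by ring
        rw [h6]; ring
      rw [hg, hh, map_mul, map_mul, MvPolynomial.eval_X, MvPolynomial.eval_X, Pi.add_apply]
      ring
    · ring

/-! ### Conditions on gradient and Hessian from vanishing along regular and cuspidal curves. -/

section Curves

variable {f : MvPolynomial (Fin 3) ℂ} {p : Fin 3 → ℂ} {δ : ℝ → Fin 3 → ℂ}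

lemma grad_add (v w : Fin 3 → ℂ) : grad f p (v + w) = grad f p v + grad f p w := by
  simp [grad, mul_add, Finset.sum_add_distrib]

lemma grad_smul (c : ℂ) (v : Fin 3 → ℂ) : grad f p (c • v) = c * grad f p v := by
  simp only [grad, Pi.smul_apply, smul_eq_mul, Finset.mul_sum]
  exact Finset.sum_congr rfl fun i _ => by ring

lemma hess_add_left (u v w : Fin 3 → ℂ) : hess f p (u + v) w = hess f p u w + hess f p v w := by
  simp [hess, mul_add, add_mul, Finset.sum_add_distrib]

lemma hess_smul_left (c : ℂ) (v w : Fin 3 → ℂ) : hess f p (c • v) w = c * hess f p v w := by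
  simp only [hess, Pi.smul_apply, smul_eq_mul, Finset.mul_sum]
  exact Finset.sum_congr rfl fun i _ => Finset.sum_congr rfl fun j _ => by ring

lemma hess_add_right (u v w : Fin 3 → ℂ) : hess f p w (u + v) = hess f p w u + hess f p w v := by
  rw [hess_comm, hess_add_left, hess_comm f p u, hess_comm f p v]

lemma hess_smul_right (c : ℂ) (v w : Fin 3 → ℂ) : hess f p w (c • v) = c * hess f p w v := by
  rw [hess_comm, hess_smul_left, hess_comm f p v]

lemma grad_isLittleO {w : ℝ → Fin 3 → ℂ} {n : ℕ} (hw : w =o[𝓝 0] fun t => t ^ n) :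
    (fun t => grad f p (w t)) =o[𝓝 0] fun t => t ^ n := by
  unfold grad
  exact IsLittleO.fun_sum fun i _ => (isLittleO_pi.1 hw i).const_mul_left _

lemma hess_isBigO_comp {v w : ℝ → Fin 3 → ℂ} {m n : ℕ} (hv : v =O[𝓝 0] fun t => t ^ m)
    (hw : w =O[𝓝 0] fun t => t ^ n) :
    (fun t => hess f p (v t) (w t)) =O[𝓝 0] fun t => t ^ (m + n) := by
  unfold hess
  refine IsBigO.fun_sum fun i _ => IsBigO.fun_sum fun j _ => IsBigO.const_mul_left ?_ _
  simpa only [pow_add] using (isBigO_pi.1 hv i).mul (isBigO_pi.1 hw j)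

lemma hess_isLittleO_comp {v w : ℝ → Fin 3 → ℂ} {m n : ℕ} (hv : v =o[𝓝 0] fun t => t ^ m)
    (hw : w =O[𝓝 0] fun t => t ^ n) :
    (fun t => hess f p (v t) (w t)) =o[𝓝 0] fun t => t ^ (m + n) := by
  unfold hess
  refine IsLittleO.fun_sum fun i _ => IsLittleO.fun_sum fun j _ => IsLittleO.const_mul_left ?_ _
  simpa only [pow_add] using (isLittleO_pi.1 hv i).mul_isBigO (isBigO_pi.1 hw j)

lemma taylor_two_comp {w : ℝ → Fin 3 → ℂ} {n : ℕ} (hn : n ≠ 0) (hw : w =O[𝓝 0] fun t => t ^ n)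
    (hp : MvPolynomial.eval p f = 0) (hδ : ∀ᶠ t in 𝓝 0, MvPolynomial.eval (p + w t) f = 0) :
    (fun t => grad f p (w t) + hess f p (w t) (w t) / 2) =O[𝓝 0] fun t => t ^ (3 * n) := by
  have ht : Tendsto w (𝓝 0) (𝓝 0) := by
    refine hw.trans_tendsto ?_
    have : ContinuousAt (fun t : ℝ => t ^ n) 0 := by fun_prop
    simpa [ContinuousAt, hn] using this
  have h1 := (taylor_two f p).comp_tendsto ht
  have h2 : (fun t => ‖w t‖ ^ 3) =O[𝓝 0] fun t => t ^ (3 * n) := by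
    have := hw.norm_left.pow 3
    simpa only [← pow_mul, mul_comm n 3] using this
  refine (h1.trans h2).neg_left.congr' ?_ EventuallyEq.rfl
  filter_upwards [hδ] with t h
  simp only [Function.comp_def, h, hp]
  ring

lemma isLittleO_pow_of_lt {m n : ℕ} (h : m < n) : (fun t : ℝ => t ^ n) =o[𝓝 0] fun t => t ^ m :=
  isLittleO_pow_pow h

lemma isBigO_smul_pow (n : ℕ) (u : Fin 3 → ℂ) :
    (fun t : ℝ => t ^ n • u) =O[𝓝 0] fun t => t ^ n := by
  refine IsBigO.of_bound ‖u‖ (Eventually.of_forall fun t => ?_)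
  rw [norm_smul, mul_comm]

lemma grad_eq_zero_of_curve {u : Fin 3 → ℂ} (hp : MvPolynomial.eval p f = 0)
    (hδ : ∀ᶠ t in 𝓝 0, MvPolynomial.eval (δ t) f = 0)
    (hu : (fun t => δ t - (p + t • u)) =o[𝓝 0] fun t : ℝ => t) : grad f p u = 0 := by
  have hu' : (fun t => δ t - (p + t • u)) =o[𝓝 0] fun t : ℝ => t ^ 1 := by simpa using hu
  have hw : (fun t => δ t - p) =O[𝓝 0] fun t : ℝ => t ^ 1 := by
    refine (hu'.isBigO.add (isBigO_smul_pow 1 u)).congr_left fun t => ?_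
    rw [pow_one]
    abel
  have h1 := taylor_two_comp one_ne_zero hw hp (by simpa using hδ)
  have h2 : (fun t => hess f p (δ t - p) (δ t - p) / 2) =o[𝓝 0] fun t : ℝ => t ^ 1 := by
    have := (hess_isBigO_comp (f := f) (p := p) hw hw).const_mul_left (1 / 2)
    refine (this.trans_isLittleO (isLittleO_pow_of_lt (by norm_num))).congr_left fun t => ?_
    ring
  have h3 := ((h1.trans_isLittleO (isLittleO_pow_of_lt (m := 1) (by norm_num))).sub h2).sub
    (grad_isLittleO (f := f) (p := p) hu')
  refine eq_zero_of_isLittleO (n := 1) (h3.congr_left fun t => ?_)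
  have : δ t - p = (δ t - (p + t • u)) + (t : ℂ) • u := by
    rw [Complex.coe_smul]; abel
  have h4 : grad f p (δ t - p) = grad f p (δ t - (p + t • u)) + t * grad f p u := by
    rw [this, grad_add, grad_smul]
  rw [h4]
  simp

lemma cusp_isBigO {u v : Fin 3 → ℂ}
    (huv : (fun t => δ t - (p + t ^ 2 • u + t ^ 3 • v)) =o[𝓝 0] fun t : ℝ => t ^ 3) :
    (fun t => δ t - p) =O[𝓝 0] fun t : ℝ => t ^ 2 := by
  have h1 := huv.trans (isLittleO_pow_of_lt (m := 2) (n := 3) (by norm_num))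
  have h2 := (isBigO_smul_pow 3 v).trans (isLittleO_pow_of_lt (m := 2) (n := 3) (by norm_num)).isBigO
  refine ((h1.isBigO.add (isBigO_smul_pow 2 u)).add h2).congr_left fun t => ?_
  abel

lemma cusp_decomp (t : ℝ) (u v : Fin 3 → ℂ) : δ t - p =
    (δ t - (p + t ^ 2 • u + t ^ 3 • v)) + ((t : ℂ) ^ 2 • u + (t : ℂ) ^ 3 • v) := by
  rw [← Complex.ofReal_pow, ← Complex.ofReal_pow, Complex.coe_smul, Complex.coe_smul]
  abel

/-- The displacement is `O(t²)`, so the Hessian contributes only from `t⁴` on, and the gradient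
alone supplies the coefficients of `t²` and `t³`. -/
lemma grad_eq_zero_of_cusp {u v : Fin 3 → ℂ} (hp : MvPolynomial.eval p f = 0)
    (hδ : ∀ᶠ t in 𝓝 0, MvPolynomial.eval (δ t) f = 0)
    (huv : (fun t => δ t - (p + t ^ 2 • u + t ^ 3 • v)) =o[𝓝 0] fun t : ℝ => t ^ 3) :
    grad f p u = 0 ∧ grad f p v = 0 := by
  have hw := cusp_isBigO huv
  have h1 := taylor_two_comp two_ne_zero hw hp (by simpa using hδ)
  have h2 : (fun t => hess f p (δ t - p) (δ t - p) / 2) =o[𝓝 0] fun t : ℝ => t ^ 3 := by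
    have := (hess_isBigO_comp (f := f) (p := p) hw hw).const_mul_left (1 / 2)
    refine (this.trans_isLittleO (isLittleO_pow_of_lt (by norm_num))).congr_left fun t => ?_
    ring
  have h3 := ((h1.trans_isLittleO (isLittleO_pow_of_lt (m := 3) (by norm_num))).sub h2).sub
    (grad_isLittleO (f := f) (p := p) huv)
  have h4 : (fun t : ℝ => t ^ 2 • grad f p u + t ^ 3 • grad f p v) =o[𝓝 0] fun t => t ^ 3 := by
    refine h3.congr_left fun t => ?_
    have h5 : grad f p (δ t - p) = grad f p (δ t - (p + t ^ 2 • u + t ^ 3 • v)) +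
        ((t : ℂ) ^ 2 * grad f p u + (t : ℂ) ^ 3 * grad f p v) := by
      rw [cusp_decomp t u v, grad_add, grad_add, grad_smul, grad_smul]
    rw [h5]
    simp
  have h6 : grad f p u = 0 := by
    refine eq_zero_of_isLittleO (n := 2) ?_
    have h7 : (fun t : ℝ => t ^ 3 • grad f p v) =o[𝓝 0] fun t => t ^ 2 := by
      refine IsBigO.trans_isLittleO (g := fun t : ℝ => t ^ 3) ?_
        (isLittleO_pow_of_lt (by norm_num))
      refine IsBigO.of_bound ‖grad f p v‖ (Eventually.of_forall fun t => ?_)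
      rw [norm_smul, mul_comm]
    refine ((h4.trans (isLittleO_pow_of_lt (by norm_num))).sub h7).congr_left fun t => ?_
    simp
  refine ⟨h6, eq_zero_of_isLittleO (n := 3) ?_⟩
  simpa [h6] using h4

/-- Without a gradient the Taylor remainder is `O(t⁶)`, and an `o(t³)` error paired with an `O(t²)`
displacement is `o(t⁵)`. So the coefficients of `t⁴` and `t⁵` can be read off; the value at `(v, v)`
enters only at `t⁶`. -/
lemma hess_eq_zero_of_cusp {u v : Fin 3 → ℂ} (hp : MvPolynomial.eval p f = 0)
    (hδ : ∀ᶠ t in 𝓝 0, MvPolynomial.eval (δ t) f = 0)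
    (huv : (fun t => δ t - (p + t ^ 2 • u + t ^ 3 • v)) =o[𝓝 0] fun t : ℝ => t ^ 3)
    (hgrad : ∀ w, grad f p w = 0) : hess f p u u = 0 ∧ hess f p u v = 0 := by
  have hw := cusp_isBigO huv
  have h1 := taylor_two_comp two_ne_zero hw hp (by simpa using hδ)
  simp only [hgrad, zero_add] at h1
  have hu : (fun t : ℝ => (t : ℂ) ^ 2 • u) =O[𝓝 0] fun t : ℝ => t ^ 2 := by
    refine (isBigO_smul_pow 2 u).congr_left fun t => ?_
    rw [← Complex.ofReal_pow, Complex.coe_smul]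
  have hv : (fun t : ℝ => (t : ℂ) ^ 3 • v) =O[𝓝 0] fun t : ℝ => t ^ 3 := by
    refine (isBigO_smul_pow 3 v).congr_left fun t => ?_
    rw [← Complex.ofReal_pow, Complex.coe_smul]
  have hv2 := hv.trans (isLittleO_pow_of_lt (m := 2) (n := 3) (by norm_num)).isBigO
  have e1 := h1.trans_isLittleO (isLittleO_pow_of_lt (m := 5) (by norm_num))
  have e2 := hess_isLittleO_comp (f := f) (p := p) huv hw
  have e3 := hess_isLittleO_comp (f := f) (p := p) huv (hu.add hv2)
  have e4 := (hess_isBigO_comp (f := f) (p := p) hv hv).trans_isLittleO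
    (isLittleO_pow_of_lt (m := 5) (by norm_num))
  have h4 : (fun t : ℝ => t ^ 4 • hess f p u u + t ^ 5 • (2 * hess f p u v)) =o[𝓝 0]
      fun t => t ^ 5 := by
    refine ((((e1.const_mul_left 2).sub e2).sub e3).sub e4).congr_left fun t => ?_
    have h5 : hess f p (δ t - p) (δ t - p) =
        hess f p (δ t - (p + t ^ 2 • u + t ^ 3 • v)) (δ t - p) +
        (hess f p (δ t - (p + t ^ 2 • u + t ^ 3 • v)) ((t : ℂ) ^ 2 • u + (t : ℂ) ^ 3 • v) +
        hess f p ((t : ℂ) ^ 2 • u + (t : ℂ) ^ 3 • v) ((t : ℂ) ^ 2 • u + (t : ℂ) ^ 3 • v)) := by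
      conv_lhs => rw [cusp_decomp t u v, hess_add_left, ← cusp_decomp t u v]
      congr 1
      rw [hess_comm]
      conv_lhs => rw [cusp_decomp t u v, hess_add_left]
    have h6 : hess f p ((t : ℂ) ^ 2 • u + (t : ℂ) ^ 3 • v) ((t : ℂ) ^ 2 • u + (t : ℂ) ^ 3 • v) =
        (t : ℂ) ^ 4 * hess f p u u + (t : ℂ) ^ 5 * (2 * hess f p u v) +
          hess f p ((t : ℂ) ^ 3 • v) ((t : ℂ) ^ 3 • v) := by
      simp only [hess_add_left, hess_smul_left, hess_add_right, hess_smul_right, hess_comm f p v u]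
      ring
    rw [h5, h6]
    simp only [Complex.real_smul]
    push_cast
    ring
  have h6 : hess f p u u = 0 := by
    refine eq_zero_of_isLittleO (n := 4) ?_
    have h7 : (fun t : ℝ => t ^ 5 • (2 * hess f p u v)) =o[𝓝 0] fun t => t ^ 4 := by
      refine IsBigO.trans_isLittleO (g := fun t : ℝ => t ^ 5) ?_
        (isLittleO_pow_of_lt (by norm_num))
      refine IsBigO.of_bound ‖2 * hess f p u v‖ (Eventually.of_forall fun t => ?_)
      rw [norm_smul, mul_comm]
    refine ((h4.trans (isLittleO_pow_of_lt (by norm_num))).sub h7).congr_left fun t => ?_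
    simp
  refine ⟨h6, ?_⟩
  have h8 : 2 * hess f p u v = 0 := eq_zero_of_isLittleO (n := 5) (by simpa [h6] using h4)
  simpa using h8

end Curves

/-- A symmetric form that kills `x` and vanishes on `(u, u)` and `(u, v)` is a multiple of the
square of a fixed linear form. -/
lemma exists_linear_form {x u v : Fin 3 → ℂ} (hli : LinearIndependent ℂ ![x, u, v]) :
    ∃ l : Fin 3 → ℂ, l ≠ 0 ∧ ∀ (f : MvPolynomial (Fin 3) ℂ) (p : Fin 3 → ℂ),
      (∀ w, hess f p x w = 0) → hess f p u u = 0 → hess f p u v = 0 →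
      ∃ a : ℂ, ∀ i j, MvPolynomial.eval p (MvPolynomial.pderiv i (MvPolynomial.pderiv j f)) =
        a * (l i * l j) := by
  let b := basisOfLinearIndependentOfCardEqFinrank hli (by simp)
  have hb : ∀ i, b i = ![x, u, v] i := fun i => by
    simp [b, coe_basisOfLinearIndependentOfCardEqFinrank]
  -- The linear form is the coordinate along `v` in the basis `x, u, v`; the multiple will be `hess
  -- f p v v`.
  refine ⟨fun i => b.coord 2 (Pi.single i 1), ?_, ?_⟩
  · intro h
    have h0 : b.coord 2 = 0 := LinearMap.pi_ext' fun i => LinearMap.ext_ring (congrFun h i)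
    have h1 : b.coord 2 (b 2) = 1 := by simp
    rw [h0] at h1
    simp at h1
  · intro f p hx huu huv
    refine ⟨hess f p v v, fun i j => ?_⟩
    have h1 : ∀ i j, MvPolynomial.eval p (MvPolynomial.pderiv i (MvPolynomial.pderiv j f)) =
        hess f p (Pi.single i 1) (Pi.single j 1) := by
      intro i j
      rw [hess, Finset.sum_eq_single i, Finset.sum_eq_single j]
      · simp
      · intro k _ hk; simp [hk]
      · simp
      · intro k _ hk
        refine Finset.sum_eq_zero fun m _ => ?_
        simp [hk]
      · simp
    have h2 : ∀ y : Fin 3 → ℂ, y = b.coord 0 y • x + b.coord 1 y • u + b.coord 2 y • v := by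
      intro y
      conv_lhs => rw [← b.sum_repr y, Fin.sum_univ_three, hb, hb, hb]
      rfl
    have h3 : ∀ y z, hess f p y z = b.coord 2 y * b.coord 2 z * hess f p v v := by
      intro y z
      conv_lhs => rw [h2 y, h2 z]
      simp only [hess_add_left, hess_smul_left, hess_add_right, hess_smul_right, hess_comm f p u x,
        hess_comm f p v x, hess_comm f p v u, hx, huu, huv]
      ring
    rw [h1, h3]
    ring

end P3P

namespace P3P

open Real EuclideanGeometry

/-! ### The danger cylinder in an adapted frame -/

section Frame

variable {V : Type*} [NormedAddCommGroup V] [InnerProductSpace ℝ V]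

/-- The two angles determine the components of `P - Y` along `u` and `v`, whose squares already add
up to `‖P - Y‖²`; this forces `P` into the plane. -/
lemma eq_smul_of_angle {u v P Y Q X : V} (hu : ‖u‖ = 1) (hv : ‖v‖ = 1) (huv : inner ℝ u v = 0)
    {l m φ θ : ℝ} (hl : 0 < l) (hm : 0 < m) (hφ : sin φ ≠ 0) (hQ : Q - Y = l • u)
    (hX : X - Y = m • (cos φ • u + sin φ • v)) (h₁ : ∠ P Y Q = θ) (h₂ : ∠ P Y X = φ - θ) :
    P - Y = dist P Y • (cos θ • u + sin θ • v) := by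
  have huu : inner ℝ u u = (1 : ℝ) := by rw [real_inner_self_eq_norm_sq, hu]; norm_num
  have hvv : inner ℝ v v = (1 : ℝ) := by rw [real_inner_self_eq_norm_sq, hv]; norm_num
  have hvu : inner ℝ v u = (0 : ℝ) := by rw [real_inner_comm, huv]
  have hw : ‖cos φ • u + sin φ • v‖ = 1 := by
    rw [← sq_eq_sq₀ (norm_nonneg _) one_pos.le, ← real_inner_self_eq_norm_sq]
    simp only [inner_add_left, inner_add_right, real_inner_smul_left, real_inner_smul_right, huu,
      hvv, huv, hvu]
    linarith [sin_sq_add_cos_sq φ]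
  have k₁ := InnerProductGeometry.cos_angle_mul_norm_mul_norm (P - Y) (Q - Y)
  have k₂ := InnerProductGeometry.cos_angle_mul_norm_mul_norm (P - Y) (X - Y)
  rw [show InnerProductGeometry.angle (P - Y) (Q - Y) = θ from h₁, hQ, norm_smul, hu, mul_one,
    Real.norm_of_nonneg hl.le, real_inner_smul_right] at k₁
  rw [show InnerProductGeometry.angle (P - Y) (X - Y) = φ - θ from h₂, hX, norm_smul, hw, mul_one,
    Real.norm_of_nonneg hm.le, real_inner_smul_right, inner_add_right, real_inner_smul_right,
    real_inner_smul_right] at k₂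
  rw [dist_eq_norm]
  have e₁ : inner ℝ (P - Y) u = ‖P - Y‖ * cos θ := by
    apply mul_left_cancel₀ hl.ne'; linarith
  have e₂ : inner ℝ (P - Y) v = ‖P - Y‖ * sin θ := by
    apply mul_left_cancel₀ hφ
    have : cos (φ - θ) * ‖P - Y‖ = cos φ * inner ℝ (P - Y) u + sin φ * inner ℝ (P - Y) v := by
      apply mul_left_cancel₀ hm.ne'; linarith
    rw [cos_sub, e₁] at this
    linear_combination -this
  have hw' : ‖cos θ • u + sin θ • v‖ ^ 2 = 1 := by
    rw [← real_inner_self_eq_norm_sq]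
    simp only [inner_add_left, inner_add_right, real_inner_smul_left, real_inner_smul_right, huu,
      hvv, huv, hvu]
    linarith [sin_sq_add_cos_sq θ]
  rw [← sub_eq_zero, ← norm_eq_zero, ← sq_eq_zero_iff, norm_sub_sq_real, norm_smul,
    inner_smul_right, inner_add_right, real_inner_smul_right, real_inner_smul_right, e₁, e₂,
    norm_norm, mul_pow, hw']
  linear_combination (-2 * ‖P - Y‖ ^ 2) * sin_sq_add_cos_sq θ

lemma dist_mul_sin {P X Y : V} {a b : ℝ} (hXY : X ≠ Y) (ha : ∠ P X Y = a) (hb : ∠ P Y X = b) :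
    dist P X * sin (a + b) = dist X Y * sin b := by
  have h := law_sin P Y X
  have h' := angle_add_angle_add_angle_eq_pi P hXY
  rw [angle_comm Y X P, angle_comm X P Y, ha, hb] at h'
  rw [hb, show ∠ X P Y = π - (a + b) by rw [angle_comm]; linarith, sin_pi_sub, dist_comm Y X,
    dist_comm X P] at h
  linarith

end Frame

lemma exists_basis_of_angle {u v : Space} (hu : u ≠ 0) (hv : v ≠ 0)
    (h : sin (InnerProductGeometry.angle u v) ≠ 0) : ∃ f : OrthonormalBasis (Fin 3) ℝ Space,
      u = ‖u‖ • f 0 ∧ v = ‖v‖ • (cos (InnerProductGeometry.angle u v) • f 0 +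
        sin (InnerProductGeometry.angle u v) • f 1) := by
  have huv := InnerProductGeometry.cos_angle_mul_norm_mul_norm u v
  have hs : 0 < ‖u‖ := norm_pos_iff.2 hu
  have ht : 0 < ‖v‖ := norm_pos_iff.2 hv
  have huu := real_inner_self_eq_norm_sq u
  have hvv := real_inner_self_eq_norm_sq v
  have hsc := sin_sq_add_cos_sq (InnerProductGeometry.angle u v)
  set β := InnerProductGeometry.angle u v
  set s := ‖u‖
  set t := ‖v‖
  have hvu : inner ℝ v u = cos β * (s * t) := by rw [real_inner_comm, huv]
  have hfin : Module.finrank ℝ Space = Fintype.card (Fin 3) := by simp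
  have k₁ : inner ℝ ((1 / s) • u) ((1 / s) • u) = (1 : ℝ) := by
    simp only [real_inner_smul_left, real_inner_smul_right, huu]; field_simp
  have k₂ : inner ℝ ((1 / s) • u) ((1 / sin β) • ((1 / t) • v - (cos β / s) • u)) = (0 : ℝ) := by
    simp only [real_inner_smul_left, real_inner_smul_right, inner_sub_right, huu, ← huv]
    field_simp; ring
  have k₃ : inner ℝ ((1 / sin β) • ((1 / t) • v - (cos β / s) • u))
      ((1 / sin β) • ((1 / t) • v - (cos β / s) • u)) = (1 : ℝ) := by
    simp only [real_inner_smul_left, real_inner_smul_right, inner_sub_right, inner_sub_left, huu,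
      ← huv, hvu, hvv]
    field_simp
    linear_combination -hsc
  obtain ⟨f, hf⟩ := Orthonormal.exists_orthonormalBasis_extension_of_card_eq hfin
    (v := ![(1 / s) • u, (1 / sin β) • ((1 / t) • v - (cos β / s) • u), 0]) (s := {0, 1}) (by
    rw [orthonormal_iff_ite]
    rintro ⟨i, rfl | rfl⟩ ⟨j, rfl | rfl⟩
    · rw [if_pos rfl]; exact k₁
    · rw [if_neg fun h => absurd (congrArg Subtype.val h) (by decide)]; exact k₂
    · rw [if_neg fun h => absurd (congrArg Subtype.val h) (by decide)]; exact (real_inner_comm _ _).trans k₂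
    · rw [if_pos rfl]; exact k₃)
  have f0 := hf 0 (by simp)
  have f1 := hf 1 (by simp)
  simp only [Matrix.cons_val_zero, Matrix.cons_val_one] at f0 f1
  refine ⟨f, ?_, ?_⟩
  · rw [f0, smul_smul, mul_one_div_cancel hs.ne', one_smul]
  · rw [f1, f0]
    match_scalars <;> field_simp
    ring

lemma exists_frame {A B C : Space} (h : ¬ Collinear ℝ {A, B, C}) :
    ∃ (f : OrthonormalBasis (Fin 3) ℝ Space) (R a b c : ℝ), 0 < R ∧ 0 < a ∧ 0 < b ∧ 0 < c ∧
      a + b + c = π / 3 ∧ ∠ B A C = 3 * a ∧ ∠ A B C = 3 * b ∧ ∠ A C B = 3 * c ∧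
      C - B = (2 * R * sin (3 * a)) • f 0 ∧
      A - B = (2 * R * sin (3 * c)) • (cos (3 * b) • f 0 + sin (3 * b) • f 1) := by
  have hB := sin_pos_of_not_collinear h
  have hA : 0 < sin (∠ B A C) := sin_pos_of_not_collinear (by rwa [Set.insert_comm])
  have hC : 0 < sin (∠ A C B) := sin_pos_of_not_collinear (by rwa [Set.pair_comm])
  have hne : B ≠ A := by rintro rfl; exact h (by simpa using collinear_pair ℝ B C)
  have hBC : B ≠ C := by rintro rfl; exact h (by simpa using collinear_pair ℝ A B)
  have hsum := angle_add_angle_add_angle_eq_pi C hne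
  rw [angle_comm B C A, angle_comm C A B] at hsum
  have pos : ∀ {x : ℝ}, 0 ≤ x → 0 < sin x → 0 < x := fun {x} h0 hs =>
    lt_of_le_of_ne h0 (by rintro rfl; simp at hs)
  have h1 := pos (angle_nonneg _ _ _) hA
  have h2 := pos (angle_nonneg _ _ _) hB
  have h3 := pos (angle_nonneg _ _ _) hC
  have hs : 0 < dist C B := dist_pos.2 hBC.symm
  have ht : 0 < dist A B := dist_pos.2 hne.symm
  have hlaw := law_sin A C B
  rw [dist_comm B A] at hlaw
  set α := ∠ B A C
  set β := ∠ A B C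
  set γ := ∠ A C B
  obtain ⟨f, f0, f1⟩ := exists_basis_of_angle (sub_ne_zero.2 hBC.symm) (sub_ne_zero.2 hne.symm)
    (by rw [InnerProductGeometry.angle_comm]; exact hB.ne')
  rw [← dist_eq_norm] at f0 f1
  rw [InnerProductGeometry.angle_comm, show InnerProductGeometry.angle (A - B) (C - B) = β from rfl]
    at f1
  refine ⟨f, dist C B / (2 * sin α), α / 3, β / 3, γ / 3, by positivity, by positivity,
    by positivity, by positivity, by linarith, by ring, by ring, by ring, ?_, ?_⟩
  · rw [f0, mul_div_cancel₀ _ three_ne_zero]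
    congr 1
    field_simp
  · rw [f1, mul_div_cancel₀ _ three_ne_zero, mul_div_cancel₀ _ three_ne_zero,
      show 2 * (dist C B / (2 * sin α)) * sin γ = dist A B by field_simp; linarith]

end P3P

namespace P3P

open Real EuclideanGeometry

/-! ### The altitude of the first Morley triangle -/

/-- In the law of sines for the triangle cut off by two trisectors, the factor `sin (π / 3 - a) =
sin (b + c)` cancels the denominator. -/
lemma sin_three_mul_eq (a : ℝ) : sin (3 * a) = 4 * sin a * sin (π / 3 - a) * sin (π / 3 + a) := by
  rw [sin_three_mul, sin_sub, sin_add, sin_pi_div_three, cos_pi_div_three]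
  have h3 : √3 ^ 2 = 3 := sq_sqrt (by norm_num)
  have := sin_sq_add_cos_sq a
  grind

/-- The component along `BC` of the Morley altitude, divided by `8 R sin a`; `morley_altitude_snd`
is the perpendicular one. -/
lemma morley_altitude_fst (b c : ℝ) :
    sin c * sin (π / 3 + b + c) * cos b - (sin (b + c) * sin (π / 3 + b + c) -
      sin b * sin (π / 3 + b) * cos (2 * c) + sin c * sin (π / 3 + c) * cos (2 * b)) / 2 =
    √3 / 2 * sin b * sin c * sin (b - c) := by
  simp only [sin_add, sin_sub, cos_add, sin_pi_div_three, cos_pi_div_three, cos_two_mul']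
  have h3 : √3 ^ 2 = 3 := sq_sqrt (by norm_num)
  have := sin_sq_add_cos_sq b
  have := sin_sq_add_cos_sq c
  grind

lemma morley_altitude_snd (b c : ℝ) :
    sin c * sin (π / 3 + b + c) * sin b - (sin b * sin (π / 3 + b) * sin (2 * c) +
      sin c * sin (π / 3 + c) * sin (2 * b)) / 2 =
    -(√3 / 2 * sin b * sin c * cos (b - c)) := by
  simp only [sin_add, cos_sub, cos_add, sin_pi_div_three, cos_pi_div_three, sin_two_mul]
  have h3 : √3 ^ 2 = 3 := sq_sqrt (by norm_num)
  have := sin_sq_add_cos_sq b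
  have := sin_sq_add_cos_sq c
  grind

/-- The law of sines gives the distances from the vertices, for instance `LB = 8 R sin a sin c sin
(π / 3 + a)`. Positivity of `κ` retains the sense of the altitude, which distinguishes the Morley
generatrices from the opposite ones. -/
lemma morley_altitude {A B C L M N : Space} {u v : Space} (hu : ‖u‖ = 1) (hv : ‖v‖ = 1)
    (huv : inner ℝ u v = 0) {R a b c : ℝ} (hR : 0 < R) (ha : 0 < a) (hb : 0 < b) (hc : 0 < c)
    (habc : a + b + c = π / 3)
    (hC : C - B = (2 * R * sin (3 * a)) • u)
    (hA : A - B = (2 * R * sin (3 * c)) • (cos (3 * b) • u + sin (3 * b) • v))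
    (hLB : ∠ L B C = b) (hLB' : ∠ L B A = 2 * b) (hLC : ∠ L C B = c)
    (hMC : ∠ M C A = c) (hMC' : ∠ M C B = 2 * c) (hMA : ∠ M A C = a)
    (hNB : ∠ N B A = b) (hNB' : ∠ N B C = 2 * b) (hNA : ∠ N A B = a) :
    ∃ κ : ℝ, 0 < κ ∧ L - midpoint ℝ M N = κ • (sin (b - c) • u - cos (b - c) • v) := by
  have pos : ∀ x, 0 < x → x < π → 0 < sin x := fun x => sin_pos_of_pos_of_lt_pi
  have sa := pos a ha (by linarith [pi_pos])
  have sb := pos b hb (by linarith [pi_pos])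
  have sc := pos c hc (by linarith [pi_pos])
  have sa3 := pos (3 * a) (by linarith) (by linarith [pi_pos])
  have sb3 := pos (3 * b) (by linarith) (by linarith [pi_pos])
  have sc3 := pos (3 * c) (by linarith) (by linarith [pi_pos])
  have sbc := pos (b + c) (by linarith) (by linarith [pi_pos])
  have sac := pos (a + c) (by linarith) (by linarith [pi_pos])
  have sab := pos (a + b) (by linarith) (by linarith [pi_pos])
  have hAC : A - C = (2 * R * sin (3 * b)) • (cos (3 * c) • (-u) + sin (3 * c) • v) := by
    rw [← sub_sub_sub_cancel_right A C B, hA, hC,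
      show 3 * a = π - (3 * b + 3 * c) by linarith, sin_pi_sub, sin_add]
    match_scalars <;> ring
  have hBC : B - C = (2 * R * sin (3 * a)) • (-u) := by rw [← neg_sub, hC, smul_neg]
  have unit : ∀ θ : ℝ, ∀ w : Space, ‖w‖ = 1 → inner ℝ w v = 0 →
      ‖cos θ • w + sin θ • v‖ = 1 := fun θ w hw hwv => by
    have := norm_add_sq_real (cos θ • w) (sin θ • v)
    rw [real_inner_smul_left, real_inner_smul_right, hwv, norm_smul, norm_smul, hw, hv, mul_one,
      mul_one, norm_eq_abs, norm_eq_abs, sq_abs, sq_abs] at this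
    rw [← sq_eq_sq₀ (norm_nonneg _) one_pos.le, this]
    linarith [sin_sq_add_cos_sq θ]
  have hu' : ‖-u‖ = 1 := by rw [norm_neg, hu]
  have huv' : inner ℝ (-u) v = 0 := by rw [inner_neg_left, huv, neg_zero]
  have dBC : dist B C = 2 * R * sin (3 * a) := by
    rw [dist_comm, dist_eq_norm, hC, norm_smul, hu, mul_one, norm_of_nonneg (by positivity)]
  have dBA : dist B A = 2 * R * sin (3 * c) := by
    rw [dist_comm, dist_eq_norm, hA, norm_smul, unit _ _ hu huv, mul_one,
      norm_of_nonneg (by positivity)]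
  have dCA : dist C A = 2 * R * sin (3 * b) := by
    rw [dist_comm, dist_eq_norm, hAC, norm_smul, unit _ _ hu' huv', mul_one,
      norm_of_nonneg (by positivity)]
  have ne : ∀ {X Y : Space} {r : ℝ}, dist X Y = 2 * R * r → 0 < r → X ≠ Y := fun h hr =>
    dist_pos.1 (by rw [h]; positivity)
  have L₁ := dist_mul_sin (ne dBC sa3) hLB hLC
  have M₁ := dist_mul_sin (ne dCA sb3) hMC hMA
  have N₁ := dist_mul_sin (ne dBA sc3) hNB hNA
  have L₂ := eq_smul_of_angle hu hv huv (by positivity) (by positivity) sb3.ne' hC hA hLB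
    (by rw [hLB']; ring)
  have N₂ := eq_smul_of_angle hu hv huv (by positivity) (by positivity) sb3.ne' hC hA hNB'
    (by rw [hNB]; ring)
  have M₂ := eq_smul_of_angle hu' hv huv' (by positivity) (by positivity) sc3.ne' hBC hAC hMC'
    (by rw [hMC]; ring)
  rw [dBC, sin_three_mul_eq, show π / 3 - a = b + c by linarith] at L₁
  rw [dCA, sin_three_mul_eq, show π / 3 - b = c + a by linarith] at M₁
  rw [dBA, sin_three_mul_eq, show π / 3 - c = b + a by linarith] at N₁
  have sym : sin (π / 3 + a) = sin (π / 3 + b + c) := by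
    rw [← sin_pi_sub]; congr 1; linarith
  have L₃ : dist L B = 8 * R * sin a * (sin c * sin (π / 3 + b + c)) := by
    apply mul_right_cancel₀ sbc.ne'; rw [L₁, sym]; ring
  have M₃ : dist M C = 8 * R * sin a * (sin b * sin (π / 3 + b)) := by
    rw [add_comm] at sac; apply mul_right_cancel₀ sac.ne'; rw [M₁]; ring
  have N₃ : dist N B = 8 * R * sin a * (sin c * sin (π / 3 + c)) := by
    rw [add_comm] at sab; apply mul_right_cancel₀ sab.ne'; rw [N₁]; ring
  refine ⟨8 * R * sin a * (√3 / 2 * sin b * sin c), by positivity, ?_⟩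
  -- `M` is located from `C`, while `L` and `N` are located from `B`.
  have key : L - midpoint ℝ M N = (L - B) - (1 / 2 : ℝ) • ((M - C) + (C - B) + (N - B)) := by
    rw [midpoint_eq_smul_add, invOf_eq_inv]
    module
  rw [key, L₂, M₂, N₂, L₃, M₃, N₃, hC, sin_three_mul_eq, show π / 3 - a = b + c by linarith, sym]
  have e₁ := morley_altitude_fst b c
  have e₂ := morley_altitude_snd b c
  match_scalars
  · linear_combination 8 * R * sin a * e₁
  · linear_combination 8 * R * sin a * e₂

end P3P

namespace P3P

open Real EuclideanGeometry

/-! ### Cylinder coordinates -/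

/-- The point with polar angle `ω` and height `h` on the cylinder of radius `R` around the line
through `Z` in the direction of the last vector of the frame `f`. -/
noncomputable def cylPt (f : OrthonormalBasis (Fin 3) ℝ Space) (Z : Space) (R ω h : ℝ) : Space :=
  Z + ((R * cos ω) • f 0 + (R * sin ω) • f 1 + h • f 2)

lemma norm_sq_comb (f : OrthonormalBasis (Fin 3) ℝ Space) (x y z : ℝ) :
    ‖x • f 0 + y • f 1 + z • f 2‖ ^ 2 = x ^ 2 + y ^ 2 + z ^ 2 := by
  rw [← f.sum_sq_norm_inner_right, Fin.sum_univ_three]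
  simp [inner_add_right, real_inner_smul_right, f.inner_eq_ite]

lemma dist_cylPt_sq (f : OrthonormalBasis (Fin 3) ℝ Space) (Z : Space) (R α β h h' : ℝ) :
    dist (cylPt f Z R α h) (cylPt f Z R β h') ^ 2 =
      (h - h') ^ 2 + 4 * R ^ 2 * sin ((α - β) / 2) ^ 2 := by
  have : cylPt f Z R α h - cylPt f Z R β h' = (R * (cos α - cos β)) • f 0 +
      (R * (sin α - sin β)) • f 1 + (h - h') • f 2 := by
    rw [cylPt, cylPt]; module
  rw [dist_eq_norm, this, norm_sq_comb, sin_sq_eq_half_sub, mul_div_cancel₀ _ two_ne_zero, cos_sub]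
  linear_combination R ^ 2 * (sin_sq_add_cos_sq α + sin_sq_add_cos_sq β)

lemma dist_cylPt_axis (f : OrthonormalBasis (Fin 3) ℝ Space) (Z : Space) {R : ℝ} (hR : 0 < R)
    (α : ℝ) : dist (cylPt f Z R α 0) Z = R := by
  have h : cylPt f Z R α 0 - Z = (R * cos α) • f 0 + (R * sin α) • f 1 + (0 : ℝ) • f 2 := by
    rw [cylPt]; module
  rw [dist_eq_norm, ← sq_eq_sq₀ (norm_nonneg _) hR.le, h, norm_sq_comb]
  linear_combination R ^ 2 * sin_sq_add_cos_sq α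

lemma exists_eq_smul_of_inner_eq_zero (f : OrthonormalBasis (Fin 3) ℝ Space) {v : Space}
    (h₀ : inner ℝ (f 0) v = 0) (h₁ : inner ℝ (f 1) v = 0) : ∃ h : ℝ, v = h • f 2 := by
  refine ⟨inner ℝ (f 2) v, ?_⟩
  conv_lhs => rw [← f.sum_repr' v, Fin.sum_univ_three, h₀, h₁]
  simp

/-- The frame `f` and the polar angles `α` of the vertices are adapted to the triangle. -/
structure IsCylinderFrame (T : ControlTriangle) (f : OrthonormalBasis (Fin 3) ℝ Space)
    (α : Fin 3 → ℝ) : Prop where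
  radius_pos : 0 < T.circumradius
  points_eq : ∀ j, T.points j = cylPt f T.circumcenter T.circumradius (α j) 0
  mem_zero : f 0 ∈ (affineSpan ℝ (Set.range T.points)).direction
  mem_one : f 1 ∈ (affineSpan ℝ (Set.range T.points)).direction

namespace IsCylinderFrame

variable {T : ControlTriangle} {f : OrthonormalBasis (Fin 3) ℝ Space} {α : Fin 3 → ℝ}

lemma cylPt_mem_plane (hf : IsCylinderFrame T f α) (ω : ℝ) :
    cylPt f T.circumcenter T.circumradius ω 0 ∈ affineSpan ℝ (Set.range T.points) := by
  rw [cylPt, add_comm T.circumcenter, zero_smul, add_zero]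
  exact AffineSubspace.vadd_mem_of_mem_direction (Submodule.add_mem _
    (Submodule.smul_mem _ _ hf.mem_zero) (Submodule.smul_mem _ _ hf.mem_one))
    T.circumcenter_mem_affineSpan

lemma mem_orthogonal (hf : IsCylinderFrame T f α) :
    f 2 ∈ (affineSpan ℝ (Set.range T.points)).directionᗮ := by
  rw [direction_affineSpan, vectorSpan_def]
  have : Submodule.span ℝ (Set.range T.points -ᵥ Set.range T.points) ≤ (ℝ ∙ f 2)ᗮ := by
    rw [Submodule.span_le]
    rintro _ ⟨_, ⟨j, rfl⟩, _, ⟨k, rfl⟩, rfl⟩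
    rw [SetLike.mem_coe, Submodule.mem_orthogonal_singleton_iff_inner_right, hf.points_eq j,
      hf.points_eq k]
    simp [cylPt, inner_sub_right, inner_add_right, real_inner_smul_right, f.inner_eq_ite]
  exact Submodule.orthogonal_le this (Submodule.le_orthogonal_orthogonal _
    (Submodule.mem_span_singleton_self _))

lemma foot_cylPt (hf : IsCylinderFrame T f α) (ω h : ℝ) :
    foot T (cylPt f T.circumcenter T.circumradius ω h) =
      cylPt f T.circumcenter T.circumradius ω 0 := by
  rw [foot, Affine.Simplex.orthogonalProjectionSpan, coe_orthogonalProjection_eq_iff_mem]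
  refine ⟨hf.cylPt_mem_plane ω, ?_⟩
  have : cylPt f T.circumcenter T.circumradius ω h -ᵥ cylPt f T.circumcenter T.circumradius ω 0 =
      h • f 2 := by
    rw [cylPt, cylPt, vsub_eq_sub]; module
  rw [this]
  exact Submodule.smul_mem _ _ hf.mem_orthogonal

lemma cylPt_mem_dangerCylinder (hf : IsCylinderFrame T f α) (ω h : ℝ) :
    cylPt f T.circumcenter T.circumradius ω h ∈ dangerCylinder T := by
  rw [dangerCylinder, Set.mem_ofPred_eq, hf.foot_cylPt, dist_cylPt_axis _ _ hf.radius_pos]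

lemma cylPt_notMem_plane (hf : IsCylinderFrame T f α) (ω : ℝ) {h : ℝ} (hh : h ≠ 0) :
    cylPt f T.circumcenter T.circumradius ω h ∉ plane T := fun hp => by
  have h₁ := hf.foot_cylPt ω h
  rw [foot, Affine.Simplex.orthogonalProjectionSpan, orthogonalProjection_eq_self_iff.2 hp] at h₁
  have h₂ := dist_cylPt_sq f T.circumcenter T.circumradius ω ω h 0
  rw [h₁, dist_self, sub_self, zero_div, sin_zero] at h₂
  exact hh (by simpa using h₂.symm)

lemma exists_eq_cylPt (hf : IsCylinderFrame T f α) {O : Space} {ω : ℝ}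
    (h : foot T O = cylPt f T.circumcenter T.circumradius ω 0) :
    ∃ t, O = cylPt f T.circumcenter T.circumradius ω t := by
  have h₁ := vsub_orthogonalProjection_mem_direction_orthogonal
    (affineSpan ℝ (Set.range T.points)) O
  obtain ⟨t, ht⟩ := exists_eq_smul_of_inner_eq_zero f
    ((Submodule.mem_orthogonal _ _).1 h₁ _ hf.mem_zero)
    ((Submodule.mem_orthogonal _ _).1 h₁ _ hf.mem_one)
  refine ⟨t, ?_⟩
  have h₂ : O - foot T O = t • f 2 := ht
  rw [h, sub_eq_iff_eq_add] at h₂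
  rw [h₂, cylPt, cylPt]
  module

end IsCylinderFrame

lemma range_points (T : ControlTriangle) (i : Fin 3) :
    Set.range T.points = {T.points i, T.points (i + 1), T.points (i + 2)} := by
  ext x
  simp only [Set.mem_range, Set.mem_insert_iff, Set.mem_singleton_iff, Fin.exists_fin_succ,
    eq_comm (a := x)]
  fin_cases i <;> simp <;> tauto

lemma exists_cylinderFrame {T : ControlTriangle} {i : Fin 3} {M : Fin 3 → Space}
    (hM : IsFirstMorleyTriangle T M) :
    ∃ (f : OrthonormalBasis (Fin 3) ℝ Space) (α : Fin 3 → ℝ) (ω κ : ℝ),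
      IsCylinderFrame T f α ∧ α 0 + α 1 + α 2 = 3 * ω + 3 * π ∧ 0 < κ ∧
      M i - midpoint ℝ (M (i + 1)) (M (i + 2)) = κ • (cos ω • f 0 + sin ω • f 1) := by
  have hnc : ¬ Collinear ℝ {T.points i, T.points (i + 1), T.points (i + 2)} := by
    rw [← range_points]; exact affineIndependent_iff_not_collinear.1 T.independent
  obtain ⟨f, R, a, b, c, hR, ha, hb, hc, habc, hA, hB, hC, eC, eA⟩ := exists_frame hnc
  have sa3 : 0 < sin (3 * a) := sin_pos_of_pos_of_lt_pi (by linarith) (by linarith [pi_pos])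
  have sb3 : 0 < sin (3 * b) := sin_pos_of_pos_of_lt_pi (by linarith) (by linarith [pi_pos])
  have sc3 : 0 < sin (3 * c) := sin_pos_of_pos_of_lt_pi (by linarith) (by linarith [pi_pos])
  have i1 : i ≠ i + 1 := by clear * -; revert i; decide
  have i2 : i ≠ i + 2 := by clear * -; revert i; decide
  have i3 : i + 1 ≠ i + 2 := by clear * -; revert i; decide
  have hcases : ∀ j, j = i ∨ j = i + 1 ∨ j = i + 2 := by clear * -; revert i; decide
  obtain ⟨L₁, L₁'⟩ := hM i (i + 1) (i + 2) i1 i3 i2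
  obtain ⟨L₂, -⟩ := hM i (i + 2) (i + 1) i2 i3.symm i1
  obtain ⟨M₁, M₁'⟩ := hM (i + 1) (i + 2) i i3 i2.symm i1.symm
  obtain ⟨M₂, -⟩ := hM (i + 1) i (i + 2) i1.symm i2 i3
  obtain ⟨N₁, N₁'⟩ := hM (i + 2) (i + 1) i i3.symm i1.symm i2.symm
  obtain ⟨N₂, -⟩ := hM (i + 2) i (i + 1) i2.symm i1 i3.symm
  obtain ⟨κ, hκ, h⟩ := morley_altitude (f.norm_eq_one 0) (f.norm_eq_one 1)
    (f.inner_eq_zero (by decide)) hR ha hb hc habc eC eA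
    (by rw [L₁, hB]; ring) (by rw [L₁', hB]; ring) (by rw [L₂, hC]; ring)
    (by rw [M₁, angle_comm, hC]; ring) (by rw [M₁', angle_comm, hC]; ring) (by rw [M₂, hA]; ring)
    (by rw [N₁, angle_comm, hB]; ring) (by rw [N₁', angle_comm, hB]; ring)
    (by rw [N₂, angle_comm, hA]; ring)
  let Z : Space := T.points (i + 1) + R • (sin (3 * a) • f 0 + cos (3 * a) • f 1)
  -- The choice of representatives modulo `2π` matters: shifting one of them by `2π` shifts a half
  -- angle by `π` and would reverse the sign in `sin_sum`.
  let α : Fin 3 → ℝ := fun l => if l = i then π / 2 + 3 * b - 3 * c else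
    if l = i + 1 then π / 2 + 3 * (b + c) else π / 2 - 3 * (b + c)
  have h3a : 3 * a = π - (3 * b + 3 * c) := by linarith
  have hpts : ∀ j, T.points j = cylPt f Z R (α j) 0 := fun j => by
    rcases hcases j with rfl | rfl | rfl
    · have hα : α j = π / 2 + 3 * b - 3 * c := if_pos rfl
      rw [hα, eq_add_of_sub_eq eA, cylPt, show π / 2 + 3 * b - 3 * c =
        (3 * b - 3 * c) + π / 2 by ring, cos_add_pi_div_two, sin_add_pi_div_two]
      simp only [Z, h3a, sin_pi, cos_pi, sin_add, cos_add, sin_sub, cos_sub]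
      match_scalars <;> ring
    · have hα : α (i + 1) = π / 2 + 3 * (b + c) := by simp only [α, if_neg i1.symm, if_true]
      rw [hα, cylPt, show π / 2 + 3 * (b + c) = (3 * b + 3 * c) + π / 2 by ring,
        cos_add_pi_div_two, sin_add_pi_div_two]
      simp only [Z, h3a, sin_pi_sub, cos_pi_sub]
      module
    · have hα : α (i + 2) = π / 2 - 3 * (b + c) := by
        simp only [α, if_neg i2.symm, if_neg i3.symm]
      rw [hα, eq_add_of_sub_eq eC, cylPt, show π / 2 - 3 * (b + c) = π / 2 - (3 * b + 3 * c)
        by ring, cos_pi_div_two_sub, sin_pi_div_two_sub]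
      simp only [Z, h3a, sin_pi_sub, cos_pi_sub]
      module
  set S := affineSpan ℝ (Set.range T.points)
  have mem : ∀ j, T.points j ∈ S := fun j => mem_affineSpan ℝ ⟨j, rfl⟩
  have m0 : f 0 ∈ S.direction := by
    have := AffineSubspace.vsub_mem_direction (mem (i + 2)) (mem (i + 1))
    rw [vsub_eq_sub, eC] at this
    exact (Submodule.smul_mem_iff _ (by positivity)).1 this
  have m1 : f 1 ∈ S.direction := by
    have := AffineSubspace.vsub_mem_direction (mem i) (mem (i + 1))
    rw [vsub_eq_sub, eA, Submodule.smul_mem_iff _ (by positivity), Submodule.add_mem_iff_right _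
      (Submodule.smul_mem _ _ m0)] at this
    exact (Submodule.smul_mem_iff _ sb3.ne').1 this
  have hZ : Z ∈ S := by
    have := AffineSubspace.vadd_mem_of_mem_direction (Submodule.smul_mem _ R (Submodule.add_mem _
      (Submodule.smul_mem _ (sin (3 * a)) m0) (Submodule.smul_mem _ (cos (3 * a)) m1)))
      (mem (i + 1))
    rwa [vadd_eq_add, add_comm] at this
  have hd : ∀ j, dist (T.points j) Z = R := fun j => by rw [hpts j, dist_cylPt_axis _ _ hR]
  have hZc := T.eq_circumcenter_of_dist_eq hZ hd
  have hRc := T.eq_circumradius_of_dist_eq hZ hd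
  refine ⟨f, α, b - c - π / 2, κ, ⟨hRc ▸ hR, ?_, m0, m1⟩, ?_, hκ, ?_⟩
  · rw [← hZc, ← hRc]; exact hpts
  · have : α 0 + α 1 + α 2 = α i + α (i + 1) + α (i + 2) := by
      generalize α = α'
      fin_cases i <;> simp <;> ring
    rw [this]
    simp only [α, if_neg i1.symm, if_neg i2.symm, if_neg i3.symm, if_true]
    ring
  · rw [h, cos_sub_pi_div_two, sin_sub_pi_div_two, neg_smul, sub_eq_add_neg]

/-- The inscribed angles are the halves `(ω - α j) / 2` of central angles. The last two clauses
realise the formal distances `qAt` by actual camera centres, so that curves of parameters are curves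
of centres. -/
lemma exists_config {T : ControlTriangle} {i : Fin 3} {O : Space} (hO : O ∈ morleyGeneratrix T i)
    (hOp : O ∉ plane T) : ∃ M : MorleyConfig,
      (∀ j, dist O (T.points j) ^ 2 = M.q j) ∧
      (∀ l, dist (T.points (l + 1)) (T.points (l + 2)) ^ 2 = M.k * M.D l ^ 2) ∧
      (∀ t H, 0 < H → ∃ P ∈ dangerCylinder T, P ∉ plane T ∧
        ∀ j, dist P (T.points j) ^ 2 = M.qAt t H j) ∧
      (∀ H, 0 < H → ∃ P ∈ morleyGeneratrix T i, P ∉ plane T ∧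
        ∀ j, dist P (T.points j) ^ 2 = M.qAt 0 H j) := by
  obtain ⟨hcyl, N, hN, r, hr, hfoot⟩ := hO
  obtain ⟨f, α, ω, κ, hf, hα, hκ, hN'⟩ := exists_cylinderFrame (i := i) hN
  have hR := hf.radius_pos
  have hfoot' : foot T O = cylPt f T.circumcenter T.circumradius ω 0 := by
    have h₁ : foot T O = cylPt f T.circumcenter (r * κ) ω 0 := by
      rw [eq_add_of_sub_eq hfoot, hN', cylPt]; module
    have h₂ : r * κ = T.circumradius := by
      rw [← dist_cylPt_axis f T.circumcenter (mul_pos hr hκ) ω, ← h₁]; exact hcyl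
    rw [h₁, h₂]
  obtain ⟨h, rfl⟩ := hf.exists_eq_cylPt hfoot'
  have hh : h ≠ 0 := by rintro rfl; exact hOp (hf.cylPt_mem_plane ω)
  have hdist : ∀ ω' h' j, dist (cylPt f T.circumcenter T.circumradius ω' h') (T.points j) ^ 2 =
      h' ^ 2 + 4 * T.circumradius ^ 2 * sin ((ω' - α j) / 2) ^ 2 := fun ω' h' j => by
    rw [hf.points_eq j, dist_cylPt_sq, sub_zero]
  have hside : ∀ l, dist (T.points (l + 1)) (T.points (l + 2)) ^ 2 = 4 * T.circumradius ^ 2 *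
      sin ((ω - α (l + 1)) / 2 - (ω - α (l + 2)) / 2) ^ 2 := fun l => by
    rw [hf.points_eq (l + 1), hdist, ← neg_sq (sin _), ← sin_neg]
    ring_nf
  have hsum : (ω - α 0) / 2 + (ω - α 1) / 2 + (ω - α 2) / 2 = π / 2 - 2 * π := by
    linear_combination -hα / 2
  refine ⟨⟨fun j => (ω - α j) / 2, 4 * T.circumradius ^ 2, h ^ 2, by positivity, by positivity,
    fun l hl => ?_, ?_, ?_⟩, fun j => hdist _ _ j, hside, fun t H hH => ?_, fun H hH => ?_⟩
  · have hs := hside l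
    rw [hl, zero_pow two_ne_zero, mul_zero, sq_eq_zero_iff, dist_eq_zero] at hs
    have := T.independent.injective hs
    clear * - this; revert this l; decide
  · rw [hsum, cos_sub_two_pi, cos_pi_div_two]
  · rw [hsum, sin_sub_two_pi, sin_pi_div_two]
  -- Turning the inscribed angles by `t` turns the central angle by `2 * t`.
  · refine ⟨cylPt f T.circumcenter T.circumradius (ω + 2 * t) √H, hf.cylPt_mem_dangerCylinder _ _,
      hf.cylPt_notMem_plane _ (sqrt_pos.2 hH).ne', fun j => ?_⟩
    rw [hdist, sq_sqrt hH.le, MorleyConfig.qAt]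
    ring_nf
  · refine ⟨cylPt f T.circumcenter T.circumradius ω √H, ⟨hf.cylPt_mem_dangerCylinder _ _, N, hN, r,
      hr, ?_⟩, hf.cylPt_notMem_plane _ (sqrt_pos.2 hH).ne', fun j => ?_⟩
    · rw [hf.foot_cylPt, ← hfoot', hfoot]
    · rw [hdist, sq_sqrt hH.le, MorleyConfig.qAt, add_zero]

end P3P

namespace P3P

open Filter Topology Asymptotics

/-! ### Complementary solutions near a Morley generatrix -/

lemma exists_pair {a b : Fin 3} (h : a ≠ b) :
    ∃ l : Fin 3, (a = l + 1 ∧ b = l + 2) ∨ (a = l + 2 ∧ b = l + 1) := by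
  revert a b
  decide

lemma isP3PSolution_of_pairs {T : ControlTriangle} {c : Fin 3 → Fin 3 → ℂ} {e : Fin 3 → ℂ}
    (hc : ∀ i j, c i j = c j i)
    (h : ∀ l : Fin 3, e (l + 1) ^ 2 + e (l + 2) ^ 2 - 2 * c (l + 1) (l + 2) *
      (e (l + 1) * e (l + 2)) = ((dist (T.points (l + 1)) (T.points (l + 2)) : ℝ) : ℂ) ^ 2) :
    IsP3PSolution T c e := by
  intro i j hij
  obtain ⟨l, ⟨rfl, rfl⟩ | ⟨rfl, rfl⟩⟩ := exists_pair hij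
  · exact h l
  · rw [dist_comm, hc, ← h l]
    ring

section Local

variable {T : ControlTriangle} {M : MorleyConfig} {e : Fin 3 → ℂ}

lemma ne_zero_of_sq_eq (he : ∀ i, e i ^ 2 = M.q i) (i : Fin 3) : e i ≠ 0 := by
  intro h
  have h1 := he i
  rw [h] at h1
  have h2 : M.q i = 0 := by
    have : ((0 : ℝ) : ℂ) = M.q i := by rw [← h1]; simp
    exact_mod_cast this.symm
  exact (M.q_pos i).ne' h2

lemma form_ratio (hside : ∀ l, dist (T.points (l + 1)) (T.points (l + 2)) ^ 2 = M.k * M.D l ^ 2)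
    (he : ∀ i, e i ^ 2 = M.q i) {e' : Fin 3 → ℂ} (h : IsComplementary T e e') :
    M.form (fun i => e' i / e i) (fun i => e' i / e i) = M.form 1 1 := by
  obtain ⟨h0, h0', ⟨c, hc, hc'⟩, -, -⟩ := h
  ext l
  have hl : l + 1 ≠ l + 2 := by revert l; decide
  have h1 := hc _ _ hl
  have h2 := hc' _ _ hl
  rw [← Complex.ofReal_pow, hside] at h1 h2
  rw [M.form_one_one, MorleyConfig.form_apply]
  have hg : (M.g l : ℂ) = (M.q (l + 1) + M.q (l + 2) - M.k * M.D l ^ 2) / 2 := by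
    rw [MorleyConfig.g]; push_cast; ring
  rw [hg, ← he, ← he]
  push_cast at h1 h2 ⊢
  have hc : c (l + 1) (l + 2) =
      (e (l + 1) ^ 2 + e (l + 2) ^ 2 - M.k * M.D l ^ 2) / (2 * (e (l + 1) * e (l + 2))) := by
    rw [eq_div_iff (mul_ne_zero two_ne_zero (mul_ne_zero (h0 _) (h0 _)))]
    linear_combination -h1
  rw [hc] at h2
  have ha := h0 (l + 1)
  have hb := h0 (l + 2)
  refine Eq.trans ?_ h2
  field_simp
  ring

/-- The centre `P` gets the triple `eta * e`, which keeps the signs chosen in `e`. Since `Psi ρ` has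
the values `gam` belonging to `eta`, `ρ * e` solves the same system. -/
lemma mem_complementarySolutions
    (hside : ∀ l, dist (T.points (l + 1)) (T.points (l + 2)) ^ 2 = M.k * M.D l ^ 2)
    (he : ∀ i, e i ^ 2 = M.q i) {S : Set Space} {P : Space} (hPS : P ∈ S) (hPp : P ∉ plane T)
    {t H : ℝ} (hH : 0 < H) (hP : ∀ j, dist P (T.points j) ^ 2 = M.qAt t H j) {ρ : Fin 3 → ℂ}
    (hρ0 : ∀ i, ρ i ≠ 0) (hρ : M.Psi ρ = fun l => (M.gam t H l : ℂ))
    (h1 : ρ ≠ fun i => (M.eta t H i : ℂ)) (h2 : ρ ≠ fun i => -(M.eta t H i : ℂ)) :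
    (fun i => ρ i * e i) ∈ complementarySolutions T S := by
  have he0 := ne_zero_of_sq_eq he
  have hη0 : ∀ i, (M.eta t H i : ℂ) ≠ 0 := fun i => by exact_mod_cast (M.eta_pos t hH i).ne'
  have hsq : ∀ i, ((M.eta t H i : ℂ) * e i) ^ 2 = M.qAt t H i := fun i => by
    rw [mul_pow, he, ← M.eta_sq t hH i]; push_cast; ring
  refine ⟨P, hPS, hPp, fun i => M.eta t H i * e i, fun i => ?_, ?_, ?_, ?_, ?_, ?_⟩
  · rw [hsq, ← hP]; push_cast; rfl
  · exact fun i => mul_ne_zero (hη0 i) (he0 i)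
  · exact fun i => mul_ne_zero (hρ0 i) (he0 i)
  · refine ⟨fun i j => ((M.eta t H i * e i) ^ 2 + (M.eta t H j * e j) ^ 2 -
      ((dist (T.points i) (T.points j) : ℝ) : ℂ) ^ 2) /
        (2 * ((M.eta t H i * e i) * (M.eta t H j * e j))), ?_, ?_⟩
    · intro i j _
      have := hη0 i
      have := hη0 j
      have := he0 i
      have := he0 j
      field_simp
      ring
    · refine isP3PSolution_of_pairs (fun i j => ?_) fun l => ?_
      · rw [dist_comm]; congr 1 <;> ring
      · have h3 := MorleyConfig.Psi_mul (M := M) hρ0 l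
        rw [hρ] at h3
        simp only [MorleyConfig.gam] at h3
        rw [hsq, hsq, ← Complex.ofReal_pow, hside]
        push_cast at h3 ⊢
        have := hη0 (l + 1)
        have := hη0 (l + 2)
        have := he0 (l + 1)
        have := he0 (l + 2)
        rw [mul_pow, mul_pow, he, he]
        have h4 : 2 * ((M.qAt t H (l + 1) + M.qAt t H (l + 2) - M.k * M.D l ^ 2) /
            (2 * (M.eta t H (l + 1) * e (l + 1) * (M.eta t H (l + 2) * e (l + 2)))) : ℂ) *
            (ρ (l + 1) * e (l + 1) * (ρ (l + 2) * e (l + 2))) =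
            (M.qAt t H (l + 1) + M.qAt t H (l + 2) - M.k * M.D l ^ 2) /
            (2 * (M.eta t H (l + 1) * M.eta t H (l + 2))) * (2 * (ρ (l + 1) * ρ (l + 2))) := by
          field_simp
        rw [h4, h3]
        ring
  · intro h
    exact h1 (funext fun i => mul_right_cancel₀ (he0 i) (congrFun h i))
  · intro h
    refine h2 (funext fun i => mul_right_cancel₀ (he0 i) ?_)
    rw [neg_mul]
    exact congrFun h i

/-- The eventual behaviour needed to lift a curve of camera centres to complementary solutions. -/
lemma eventually_mem_complementarySolutions
    (hside : ∀ l, dist (T.points (l + 1)) (T.points (l + 2)) ^ 2 = M.k * M.D l ^ 2)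
    (he : ∀ i, e i ^ 2 = M.q i) {S : Set Space} {r : Fin 3 → ℂ} (h1 : r ≠ 1) (h2 : r ≠ -1)
    (h0 : ∀ i, r i ≠ 0) {τ h : ℝ → ℝ} (hτ : ContinuousAt τ 0) (hh : ContinuousAt h 0)
    (hτ0 : τ 0 = 0) (hh0 : h 0 = M.H)
    (hS : ∀ t, 0 < h t → ∃ P ∈ S, P ∉ plane T ∧ ∀ j, dist P (T.points j) ^ 2 = M.qAt (τ t) (h t) j)
    {ρ : ℝ → Fin 3 → ℂ} (hρ : Tendsto ρ (𝓝 0) (𝓝 r))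
    (hΨ : ∀ᶠ t in 𝓝 0, M.Psi (ρ t) = fun l => (M.gam (τ t) (h t) l : ℂ)) :
    ∀ᶠ t in 𝓝 0, (fun i => ρ t i * e i) ∈ complementarySolutions T S := by
  have hη : Tendsto (fun t i => (M.eta (τ t) (h t) i : ℂ)) (𝓝 0) (𝓝 1) := by
    rw [tendsto_pi_nhds]
    intro i
    have hc : ContinuousAt (fun t => M.eta (τ t) (h t) i) 0 := by
      unfold MorleyConfig.eta MorleyConfig.qAt
      fun_prop
    have := hc.tendsto
    rw [hτ0, hh0, M.eta_zero] at this
    have h3 := (Complex.continuous_ofReal.tendsto 1).comp this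
    simpa [Function.comp_def] using h3
  have e1 : ∀ᶠ t in 𝓝 0, ∀ i, ρ t i ≠ 0 := by
    rw [eventually_all]
    exact fun i => (tendsto_pi_nhds.1 hρ i).eventually_ne (h0 i)
  have e2 : ∀ᶠ t in 𝓝 0, ρ t - (fun i => (M.eta (τ t) (h t) i : ℂ)) ≠ 0 :=
    (hρ.sub hη).eventually_ne (sub_ne_zero.2 h1)
  have e3 : ∀ᶠ t in 𝓝 0, ρ t + (fun i => (M.eta (τ t) (h t) i : ℂ)) ≠ 0 :=
    (hρ.add hη).eventually_ne (fun h => h2 (eq_neg_of_add_eq_zero_left h))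
  have e4 : ∀ᶠ t in 𝓝 0, 0 < h t := hh.eventually (lt_mem_nhds (by rw [hh0]; exact M.H_pos))
  filter_upwards [e1, e2, e3, e4, hΨ] with t a1 a2 a3 a4 a5
  obtain ⟨P, hPS, hPp, hP⟩ := hS t a4
  refine mem_complementarySolutions hside he hPS hPp a4 hP a1 a5 (sub_ne_zero.1 a2) fun h => a3 ?_
  rw [h]
  ext i
  simp

end Local

lemma morleyGeneratrix_subset (T : ControlTriangle) (i : Fin 3) :
    morleyGeneratrix T i ⊆ dangerCylinder T := fun _ h => h.1

lemma complementarySolutions_mono (T : ControlTriangle) {S S' : Set Space} (h : S ⊆ S') :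
    complementarySolutions T S ⊆ complementarySolutions T S' := by
  rintro p ⟨O, hO, hrest⟩
  exact ⟨O, h hO, hrest⟩

/-- Through a complementary solution belonging to a Morley generatrix passes a regular curve of
such solutions, and a cuspidal curve of solutions belonging to the danger cylinder. -/
lemma exists_curves {T : ControlTriangle} {i : Fin 3} {O : Space} (hO : O ∈ morleyGeneratrix T i)
    (hOp : O ∉ plane T) {e e' : Fin 3 → ℂ} (he : IsDistanceTriple T O e)
    (h : IsComplementary T e e') :
    ∃ x u v : Fin 3 → ℂ, LinearIndependent ℂ ![x, u, v] ∧
      (∃ δ : ℝ → Fin 3 → ℂ, (∀ᶠ t in 𝓝 0, δ t ∈ complementarySolutions T (morleyGeneratrix T i)) ∧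
        (fun t => δ t - (e' + t • x)) =o[𝓝 0] fun t : ℝ => t) ∧
      ∃ δ : ℝ → Fin 3 → ℂ, (∀ᶠ t in 𝓝 0, δ t ∈ complementarySolutions T (dangerCylinder T)) ∧
        (fun t => δ t - (e' + t ^ 2 • u + t ^ 3 • v)) =o[𝓝 0] fun t : ℝ => t ^ 3 := by
  obtain ⟨M, hd, hside, hcyl, hgen⟩ := exists_config hO hOp
  have hq : ∀ i, e i ^ 2 = M.q i := fun i => by rw [he i, ← hd i]; push_cast; rfl
  have he0 := ne_zero_of_sq_eq hq
  set r : Fin 3 → ℂ := fun i => e' i / e i with hrdef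
  have hre : ∀ i, r i * e i = e' i := fun i => div_mul_cancel₀ _ (he0 i)
  have hr : M.form r r = M.form 1 1 := form_ratio hside hq h
  have h0 : ∀ i, r i ≠ 0 := fun i => div_ne_zero (h.2.1 i) (he0 i)
  have h1 : r ≠ 1 := fun h' => h.2.2.2.1 (funext fun i => by rw [← hre i, h']; simp)
  have h2 : r ≠ -1 := fun h' => h.2.2.2.2 (funext fun i => by rw [← hre i, h']; simp)
  have hB := M.B_ne_zero hr h1 h2
  obtain ⟨c, hc, hn⟩ := M.exists_third_derivative
  obtain ⟨ρ₁, x, hρ₁, hΨ₁, hx, hfx⟩ := MorleyConfig.exists_lift_of_hasDerivAt hr h1 h2 h0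
    (γ := fun t => M.gam 0 (M.H + t)) (a := M.gam') (by ext l; simp [M.gam_zero])
    M.hasDerivAt_gam_generatrix
  obtain ⟨ρ₂, u, v, hρ₂, hΨ₂, huv, hfu, hfv⟩ := MorleyConfig.exists_lift_of_isLittleO hr h1 h2 h0
    (γ := fun t => M.gam (M.B * t) (M.height t)) (a := fun l => M.gam'' l / 2) (c := c) hc
  refine ⟨fun i => x i * e i, fun i => u i * e i, fun i => v i * e i, ?_, ?_, ?_⟩
  · rw [Fintype.linearIndependent_iff]
    intro w hw
    simp only [Fin.sum_univ_three, Matrix.cons_val_zero, Matrix.cons_val_one,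
      Matrix.cons_val_two, Matrix.head_cons, Matrix.tail_cons] at hw
    have hw' : w 0 • x + w 1 • u + w 2 • v = 0 := by
      ext j
      refine (mul_eq_zero.1 ?_).resolve_right (he0 j)
      have := congrFun hw j
      simp only [Pi.add_apply, Pi.smul_apply, smul_eq_mul, Pi.zero_apply] at this ⊢
      linear_combination this
    -- `form r` turns the relation between tangent vectors into one between the jets of the cosines,
    -- up to the factor `r (l + 1) * r (l + 2)`.
    have hl : ∀ l, w 0 * M.gam' l + w 1 * (M.gam'' l / 2) + w 2 * c l = 0 := by
      intro l
      have h3 := congrFun (congrArg (M.form r) hw') l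
      simp only [map_add, map_smul, Pi.add_apply, Pi.smul_apply, smul_eq_mul, hfx, hfu, hfv,
        map_zero, Pi.zero_apply] at h3
      refine (mul_eq_zero.1 ?_).resolve_left (mul_ne_zero (h0 (l + 1)) (h0 (l + 2)))
      push_cast at h3
      linear_combination h3
    have z1 : ((∑ l, M.n₀ l * M.gam' l : ℝ) : ℂ) = 0 := by
      rw [M.gam'_eq, M.sum_n₀_mul_L]; simp
    have z2 : ((∑ l, M.n₀ l * M.gam'' l : ℝ) : ℂ) = 0 := by
      rw [M.gam''_eq, M.sum_n₀_mul_L]; simp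
    have z3 : ((∑ l, M.n₁ l * M.gam' l : ℝ) : ℂ) = 0 := by
      have h3 : ∀ i, M.D i * M.x i * (M.q i * ((M.q i)⁻¹ / 2)) = M.D i * M.x i / 2 := fun i => by
        have := (M.q_pos i).ne'
        field_simp
      rw [M.gam'_eq, M.sum_n₁_mul_L]
      simp only [h3]
      rw [← Finset.sum_div, M.sum_D_mul_x]
      simp
    have hne : ∑ l, M.n₁ l * M.gam'' l ≠ 0 := by
      rw [M.sum_n₁_mul_gam'']
      have := M.H_pos.ne'
      have := M.k_pos.ne'
      have := M.D_ne_zero 0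
      have := M.D_ne_zero 1
      have := M.D_ne_zero 2
      positivity
    have z4 : ((∑ l, M.n₁ l * M.gam'' l : ℝ) : ℂ) ≠ 0 := by exact_mod_cast hne
    have z5 : ((∑ l, M.n₀ l * c l : ℝ) : ℂ) ≠ 0 := by
      have : ∑ l, M.n₀ l * c l ≠ 0 := fun h => hne (by rw [h] at hn; linarith)
      exact_mod_cast this
    push_cast [Fin.sum_univ_three] at z1 z2 z3 z4 z5
    have hl0 := hl 0
    have hl1 := hl 1
    have hl2 := hl 2
    -- The system is triangular: `n₀` kills `gam'` and `gam''` but not `c`, and `n₁` kills `gam'`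
    -- but not `gam''`. Finally `gam' ≠ 0`, because multiplicity four is excluded.
    have hw2 : w 2 = 0 := by
      refine (mul_eq_zero.1 ?_).resolve_right z5
      linear_combination M.n₀ 0 * hl0 + M.n₀ 1 * hl1 + M.n₀ 2 * hl2 - w 0 * z1 - w 1 / 2 * z2
    rw [hw2] at hl hl0 hl1 hl2
    have hw1 : w 1 = 0 := by
      refine (mul_eq_zero.1 ?_).resolve_right z4
      linear_combination 2 * (M.n₁ 0 * hl0 + M.n₁ 1 * hl1 + M.n₁ 2 * hl2 - w 0 * z3)
    have hw0 : w 0 = 0 := by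
      by_contra hw0
      refine M.exists_polarForm_inv_ne_zero hr h1 h2 (funext fun l => ?_)
      have h3 := hl l
      rw [hw1, zero_mul, zero_mul, add_zero, add_zero] at h3
      have h4 : M.gam' l = 0 := by exact_mod_cast (mul_eq_zero.1 h3).resolve_left hw0
      rw [MorleyConfig.gam'] at h4
      simpa using h4
    intro j
    fin_cases j <;> assumption
  · refine ⟨fun t i => ρ₁ t i * e i, eventually_mem_complementarySolutions hside hq h1 h2 h0
      (τ := fun _ => 0) (h := fun t => M.H + t) continuousAt_const (by fun_prop) rfl (by simp)
      (fun t ht => hgen _ ht) hρ₁ hΨ₁, ?_⟩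
    rw [isLittleO_pi] at hx ⊢
    intro j
    refine ((hx j).const_mul_left (e j)).congr_left fun t => ?_
    simp only [Pi.sub_apply, Pi.add_apply, Pi.smul_apply, ← hre, Complex.real_smul]
    ring
  · have hcont : Continuous M.height := by unfold MorleyConfig.height; fun_prop
    refine ⟨fun t i => ρ₂ t i * e i, eventually_mem_complementarySolutions hside hq h1 h2 h0
      (τ := fun t => M.B * t) (h := M.height) (by fun_prop) hcont.continuousAt (by simp)
      M.height_zero (fun t ht => hcyl _ _ ht) hρ₂ hΨ₂, ?_⟩
    rw [isLittleO_pi] at huv ⊢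
    intro j
    refine ((huv j).const_mul_left (e j)).congr_left fun t => ?_
    simp only [Pi.sub_apply, Pi.add_apply, Pi.smul_apply, ← hre, Complex.real_smul]
    ring

/-! ### The singular locus -/

lemma subset_zariskiClosure (A : Set (Fin 3 → ℂ)) : A ⊆ zariskiClosure A :=
  MvPolynomial.zeroLocus_vanishingIdeal_le A

lemma zariskiClosure_mono {A B : Set (Fin 3 → ℂ)} (h : A ⊆ B) :
    zariskiClosure A ⊆ zariskiClosure B :=
  MvPolynomial.zeroLocus_anti_mono (MvPolynomial.vanishingIdeal_anti_mono h)

lemma eval_eq_zero_of_mem {V : Set (Fin 3 → ℂ)} {f : MvPolynomial (Fin 3) ℂ}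
    (hf : f ∈ MvPolynomial.vanishingIdeal ℂ V) {p : Fin 3 → ℂ} (hp : p ∈ V) :
    MvPolynomial.eval p f = 0 := by
  have := hf p hp
  rwa [MvPolynomial.aeval_eq_eval] at this

lemma cuspidalCurve_subset_deltoidalSurface (T : ControlTriangle) (i : Fin 3) :
    cuspidalCurve T i ⊆ deltoidalSurface T :=
  zariskiClosure_mono (complementarySolutions_mono T (morleyGeneratrix_subset T i))

lemma eval_eq_zero_of_mem_surface {T : ControlTriangle} {f : MvPolynomial (Fin 3) ℂ}
    (hf : f ∈ MvPolynomial.vanishingIdeal ℂ (deltoidalSurface T)) {p : Fin 3 → ℂ}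
    (hp : p ∈ complementarySolutions T (dangerCylinder T)) : MvPolynomial.eval p f = 0 :=
  eval_eq_zero_of_mem hf (subset_zariskiClosure _ hp)

/-- All equations of the deltoidal surface are singular at the complementary solutions that belong
to a Morley generatrix. -/
lemma grad_eq_zero {T : ControlTriangle} {i : Fin 3} {p : Fin 3 → ℂ}
    (hp : p ∈ complementarySolutions T (morleyGeneratrix T i)) {f : MvPolynomial (Fin 3) ℂ}
    (hf : f ∈ MvPolynomial.vanishingIdeal ℂ (deltoidalSurface T)) (w : Fin 3 → ℂ) :
    grad f p w = 0 := by
  have hsub := complementarySolutions_mono T (morleyGeneratrix_subset T i)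
  have hp0 := eval_eq_zero_of_mem_surface hf (hsub hp)
  obtain ⟨O, hO, hOp, e, he, h⟩ := hp
  obtain ⟨x, u, v, hli, ⟨δ₁, hδ₁, hx⟩, δ₂, hδ₂, huv⟩ := exists_curves hO hOp he h
  have g1 := grad_eq_zero_of_curve hp0
    (hδ₁.mono fun t ht => eval_eq_zero_of_mem_surface hf (hsub ht)) hx
  obtain ⟨g2, g3⟩ := grad_eq_zero_of_cusp hp0
    (hδ₂.mono fun t ht => eval_eq_zero_of_mem_surface hf ht) huv
  have hw : w ∈ Submodule.span ℂ (Set.range ![x, u, v]) := by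
    rw [hli.span_eq_top_of_card_eq_finrank (by simp)]; trivial
  obtain ⟨c, rfl⟩ := (Submodule.mem_span_range_iff_exists_fun ℂ).1 hw
  simp [Fin.sum_univ_three, grad_add, grad_smul, g1, g2, g3]

lemma eval_pderiv_eq_grad (f : MvPolynomial (Fin 3) ℂ) (p : Fin 3 → ℂ) (j : Fin 3) :
    MvPolynomial.eval p (MvPolynomial.pderiv j f) = grad f p (Pi.single j 1) := by
  simp [grad, Pi.single_apply]

/-- The partial derivatives of `f` are polynomials vanishing at the complementary solutions over the
generatrix, hence on their Zariski closure. -/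
lemma cuspidalCurve_subset_singularLocus (T : ControlTriangle) (i : Fin 3) :
    cuspidalCurve T i ⊆ singularLocus (deltoidalSurface T) := by
  refine fun p hp => ⟨cuspidalCurve_subset_deltoidalSurface T i hp, fun f hf j => ?_⟩
  refine eval_eq_zero_of_mem (V := cuspidalCurve T i)
    (MvPolynomial.le_vanishingIdeal_zeroLocus _ ?_) hp
  intro q hq
  rw [MvPolynomial.aeval_eq_eval]
  change MvPolynomial.eval q _ = 0
  rw [eval_pderiv_eq_grad, grad_eq_zero hq hf]

lemma isCuspidalPoint {T : ControlTriangle} {i : Fin 3} {p : Fin 3 → ℂ}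
    (hp : p ∈ complementarySolutions T (morleyGeneratrix T i)) :
    IsCuspidalPoint (deltoidalSurface T) p := by
  refine ⟨cuspidalCurve_subset_singularLocus T i (subset_zariskiClosure _ hp), ?_⟩
  have hp' := hp
  obtain ⟨O, hO, hOp, e, he, h⟩ := hp
  obtain ⟨x, u, v, hli, ⟨δ₁, hδ₁, hx⟩, δ₂, hδ₂, huv⟩ := exists_curves hO hOp he h
  obtain ⟨l, hl, hform⟩ := exists_linear_form hli
  refine ⟨l, hl, fun f hf => ?_⟩
  have hp0 := eval_eq_zero_of_mem_surface hf
    (complementarySolutions_mono T (morleyGeneratrix_subset T i) hp')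
  obtain ⟨h1, h2⟩ := hess_eq_zero_of_cusp hp0
    (hδ₂.mono fun t ht => eval_eq_zero_of_mem_surface hf ht) huv (grad_eq_zero hp' hf)
  refine hform f p (fun w => ?_) h1 h2
  rw [hess_eq_sum_grad]
  refine Finset.sum_eq_zero fun j _ => ?_
  -- Each partial derivative of `f` vanishes along the lifted generatrix `δ₁`, so its own gradient
  -- kills the tangent `x`.
  rw [grad_eq_zero_of_curve (p := p) (δ := δ₁), mul_zero]
  · rw [eval_pderiv_eq_grad, grad_eq_zero hp' hf]
  · refine hδ₁.mono fun t ht => ?_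
    rw [eval_pderiv_eq_grad, grad_eq_zero ht hf]
  · exact hx

/-- Changing signs of the unknowns preserves complementarity. -/
lemma IsComplementary.mul_sign {T : ControlTriangle} {e e' ε : Fin 3 → ℂ} (hε : ∀ i, ε i ^ 2 = 1)
    (h : IsComplementary T e e') : IsComplementary T (ε * e) (ε * e') := by
  have hε0 : ∀ i, ε i ≠ 0 := fun i hi => by simpa [hi] using hε i
  obtain ⟨h0, h0', ⟨c, hc, hc'⟩, h1, h2⟩ := h
  have hsol : ∀ {f : Fin 3 → ℂ}, IsP3PSolution T c f →
      IsP3PSolution T (fun i j => ε i * ε j * c i j) (ε * f) := by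
    intro f hf i j hij
    simp only [Pi.mul_apply]
    rw [← hf i j hij]
    linear_combination (f i ^ 2 - 2 * c i j * f i * f j * ε j ^ 2) * hε i +
      (f j ^ 2 - 2 * c i j * f i * f j) * hε j
  refine ⟨fun i => mul_ne_zero (hε0 i) (h0 i), fun i => mul_ne_zero (hε0 i) (h0' i),
    ⟨_, hsol hc, hsol hc'⟩, fun h => h1 ?_, fun h => h2 ?_⟩
  · exact funext fun i => mul_left_cancel₀ (hε0 i) (congrFun h i)
  · refine funext fun i => mul_left_cancel₀ (hε0 i) ?_
    have := congrFun h i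
    simpa using this

end P3P

/-- The three cuspidal curves lie in the singular locus of the deltoidal surface, and whenever the
camera centre `O` lies on the `i`-th Morley generatrix (and not on the circumcircle), every
complementary solution `e'` lies on the `i`-th cuspidal curve and is a singular point of cuspidal
type of the deltoidal surface. The last clause says this for a camera centre `O'` in space. -/
theorem mainTheorem6 (T : P3P.ControlTriangle) (i : Fin 3) :
    P3P.cuspidalCurve T i ⊆ P3P.singularLocus (P3P.deltoidalSurface T) ∧
    ∀ O ∈ P3P.morleyGeneratrix T i, O ∉ P3P.plane T →
      (∀ e e' : Fin 3 → ℂ, P3P.IsDistanceTriple T O e → P3P.IsComplementary T e e' →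
        e' ∈ P3P.cuspidalCurve T i ∧ P3P.IsCuspidalPoint (P3P.deltoidalSurface T) e') ∧
      (∀ O' : P3P.Space,
        (∃ e e' : Fin 3 → ℂ, P3P.IsDistanceTriple T O e ∧ P3P.IsDistanceTriple T O' e' ∧
          P3P.IsComplementary T e e') →
        (fun j => ((dist O' (T.points j) : ℝ) : ℂ)) ∈ P3P.cuspidalCurve T i ∧
          P3P.IsCuspidalPoint (P3P.deltoidalSurface T)
            (fun j => ((dist O' (T.points j) : ℝ) : ℂ))) := by
  have key : ∀ O ∈ P3P.morleyGeneratrix T i, O ∉ P3P.plane T →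
      ∀ e e' : Fin 3 → ℂ, P3P.IsDistanceTriple T O e → P3P.IsComplementary T e e' →
        e' ∈ P3P.cuspidalCurve T i ∧ P3P.IsCuspidalPoint (P3P.deltoidalSurface T) e' := by
    intro O hO hOp e e' he h
    have hp : e' ∈ P3P.complementarySolutions T (P3P.morleyGeneratrix T i) :=
      ⟨O, hO, hOp, e, he, h⟩
    exact ⟨P3P.subset_zariskiClosure _ hp, P3P.isCuspidalPoint hp⟩
  refine ⟨P3P.cuspidalCurve_subset_singularLocus T i, fun O hO hOp => ⟨key O hO hOp, ?_⟩⟩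
  rintro O' ⟨e, e', he, he', h⟩
  have h0' := h.2.1
  -- The triple `e'` of `O'` agrees with the actual distances only up to signs; the same signs
  -- applied to `e` give another distance triple of `O`.
  set ε : Fin 3 → ℂ := fun j => ((dist O' (T.points j) : ℝ) : ℂ) / e' j with hεdef
  have hε : ∀ j, ε j ^ 2 = 1 := fun j => by
    rw [hεdef]
    simp only [div_pow]
    rw [he' j, div_self]
    rw [← he' j]
    exact pow_ne_zero 2 (h0' j)
  have hεe : (fun j => ((dist O' (T.points j) : ℝ) : ℂ)) = ε * e' :=
    funext fun j => (div_mul_cancel₀ _ (h0' j)).symm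
  rw [hεe]
  refine key O hO hOp (ε * e) (ε * e') (fun j => ?_) (h.mul_sign hε)
  rw [Pi.mul_apply, mul_pow, hε, one_mul, he j]
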